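/- Let $n\ge 1$, let $\bar M$ be a smooth compact $(n+1)$-dimensional manifold with boundary $\partial M$ and interior $M$, and let $\rho\colon\bar M\to[0,\infty)$ be a smooth function with $\rho^{-1}(0)=\partial M$ and $d\rho\ne0$ on $\partial M$. *Function spaces.* Background coordinates are smooth charts $\Theta=(\rho,\theta)$ of $\bar M$ near $\partial M$ that have $\rho$ as a coordinate; the Möbius parametrization centered at the point with coordinates $(\rho_0,\theta_0)$, $\rho_0>0$, is $\Phi(y,x)=(\rho_0y,\theta_0+\rho_0x)$, defined on the hyperbolic ball $B_2$ of radius $2$ about $(1,0)$ in the upper half-space $\{(y,x):y>0\}$. For $k\in\mathbb N_0$, $\alpha\in[0,1)$, $\delta\in\mathbb R$, a tensor field $u$ on $M$ is in $C^{k,\alpha}_\delta(M)$ if it is locally of class $C^{k,\alpha}$ on $M$ and the norms $\|\Phi^*(\rho^{-\delta}u)\|_{C^{k,\alpha}(B_2)}$ are bounded uniformly over all Möbius parametrizations with image in a given compact subset (of $\bar M$) of a given background chart. (Since $\bar M$ is compact, this is the finiteness of the supremum of the norms over a countable uniformly locally finite family of Möbius parametrizations covering $M$.) *Metrics.* For $k\ge2$,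 let $\mathscr M^{k,\alpha;2}_{\rm weak}$ be the set of Riemannian metrics $g$ on $M$ such that, with $\bar g=\rho^2g$: (i) for $0\le j\le2$ and all smooth vector fields $X_1,\dots,X_j$ on $\bar M$, $\mathcal L_{X_1}\cdots\mathcal L_{X_j}\bar g\in C^{k-j,\alpha}_2(M)$; (ii) $\bar g$ extends to a continuous, nondegenerate metric on $\bar M$; (iii) the curvature operator satisfies $\mathrm{Riem}[g]\to-\mathrm{Id}$ as $\rho\to0$. *The tensor.* Let $\mathcal D_{\bar g}X=\frac12\mathcal L_X\bar g-\frac1{n+1}(\mathrm{div}_{\bar g}X)\bar g$, let $A_{\bar g}(\rho)=\frac1n|d\rho|_{\bar g}^{3-n}\,\mathrm{div}_{\bar g}\big[|d\rho|_{\bar g}^{n-1}\mathrm{grad}_{\bar g}\rho\big]$, and $$\mathcal H_{\bar g}(\rho)=|d\rho|_{\bar g}^6\,\mathcal D_{\bar g}\big(|d\rho|_{\bar g}^{-2}\mathrm{grad}_{\bar g}\rho\big)+A_{\bar g}(\rho)\Big(d\rho\otimes d\rho-\tfrac1{n+1}|d\rho|^2_{\bar g}\,\bar g\Big),$$ which is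 understood to be $0$ at critical points of $\rho$ (its continuous extension). **Proposition.** Let $k\ge2$, $\alpha\in[0,1)$ and $g\in\mathscr M^{k,\alpha;2}_{\rm weak}$. If the scalar curvature satisfies $R[g]+n(n+1)\in C^{k-2,\alpha}_2(M)$, then $\mathcal H_{\bar g}(\rho)$ extends continuously to $\bar M$ and $$\mathcal H_{\bar g}(\rho)-\Big(\mathrm{Hess}_{\bar g}\rho-\tfrac1{n+1}(\Delta_{\bar g}\rho)\,\bar g\Big)\in C^{k-1,\alpha}_3(M).$$ In particular, the trace-free Hessian $\mathrm{Hess}_{\bar g}\rho-\frac1{n+1}(\Delta_{\bar g}\rho)\bar g$ also extends continuously to $\bar M$, and the two extensions agree on $\partial M$. -/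

import Mathlib

open Set Filter Topology
open scoped Manifold ContDiff

noncomputable section

namespace AH

/-! ### Tensor calculus in coordinates on open subsets of `ℝ^(n+1)` -/

/-- Coordinate space `ℝ^(n+1)`; the coordinate with index `0` is the one transverse to the
boundary. -/
abbrev Coord (n : ℕ) : Type := EuclideanSpace ℝ (Fin (n + 1))

/-- Components of a vector field in coordinates. -/
abbrev VecField (n : ℕ) : Type := Coord n → Fin (n + 1) → ℝ

/-- Components of a covariant 2-tensor field in coordinates. -/
abbrev MatField (n : ℕ) : Type := Coord n → Fin (n + 1) → Fin (n + 1) → ℝ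

variable {n : ℕ}

/-- Partial derivative in the `i`-th coordinate direction. -/
def pd (i : Fin (n + 1)) (f : Coord n → ℝ) (z : Coord n) : ℝ :=
  fderiv ℝ f z (EuclideanSpace.single i 1)

/-- Components `G^{ij}` of the inverse metric. -/
def invMetric (G : MatField n) : MatField n := fun z i j => (Matrix.of (G z))⁻¹ i j

/-- Christoffel symbols `Γ^k_{ij}` of the Levi-Civita connection of `G`. -/
def christoffel (G : MatField n) (k i j : Fin (n + 1)) (z : Coord n) : ℝ :=
  (1 / 2) * ∑ l, invMetric G z k l *
    (pd i (fun y => G y j l) z + pd j (fun y => G y i l) z - pd l (fun y => G y i j) z)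

/-- Components `R^k_{mij}` of the curvature tensor: `R(∂_i, ∂_j) ∂_m = R^k_{mij} ∂_k`, where
`R(X, Y) = [∇_X, ∇_Y] - ∇_{[X, Y]}`. -/
def curvature (G : MatField n) (k m i j : Fin (n + 1)) (z : Coord n) : ℝ :=
  pd i (christoffel G k j m) z - pd j (christoffel G k i m) z
    + ∑ p, (christoffel G k i p z * christoffel G p j m z
      - christoffel G k j p z * christoffel G p i m z)

/-- Components `Riem_{ij}^{kl}` of the Riemann curvature operator on `Λ²(TM)`, viewed as a
`(2,2)` tensor; it is the identity for the unit round sphere, minus the identity for hyperbolic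
space. -/
def riemOp (G : MatField n) (k l i j : Fin (n + 1)) (z : Coord n) : ℝ :=
  ∑ m, invMetric G z l m * curvature G k m i j z

/-- Components `δ_i^k δ_j^l - δ_i^l δ_j^k` of the identity operator of `Λ²(TM)`. -/
def idOp (k l i j : Fin (n + 1)) : ℝ :=
  (if i = k then 1 else 0) * (if j = l then 1 else 0)
    - (if i = l then 1 else 0) * (if j = k then 1 else 0)

/-- The scalar curvature, the full contraction of the curvature operator. -/
def scalarCurv (G : MatField n) (z : Coord n) : ℝ := ∑ i, ∑ j, riemOp G i j i j z

/-- The Hessian `∇df` with respect to `G`. -/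
def hess (G : MatField n) (f : Coord n → ℝ) : MatField n := fun z i j =>
  pd i (pd j f) z - ∑ k, christoffel G k i j z * pd k f z

/-- The Laplacian, the `G`-trace of the Hessian. -/
def laplacian (G : MatField n) (f : Coord n → ℝ) (z : Coord n) : ℝ :=
  ∑ i, ∑ j, invMetric G z i j * hess G f z i j

/-- The trace-free Hessian `Hess f - (1/(n+1)) (Δf) G`. -/
def traceFreeHess (G : MatField n) (f : Coord n → ℝ) : MatField n := fun z i j =>
  hess G f z i j - 1 / ((n : ℝ) + 1) * laplacian G f z * G z i j

/-- The gradient of `f` with respect to `G`. -/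
def grad (G : MatField n) (f : Coord n → ℝ) : VecField n := fun z i =>
  ∑ j, invMetric G z i j * pd j f z

/-- The pointwise norm `|df|_G`. -/
def normD (G : MatField n) (f : Coord n → ℝ) (z : Coord n) : ℝ :=
  Real.sqrt (∑ i, ∑ j, invMetric G z i j * pd i f z * pd j f z)

/-- The divergence of a vector field with respect to `G`. -/
def divergence (G : MatField n) (X : VecField n) (z : Coord n) : ℝ :=
  ∑ i, (pd i (fun y => X y i) z + ∑ k, christoffel G i i k z * X z k)

/-- The Lie derivative of a covariant 2-tensor field. -/
def lieDeriv (X : VecField n) (u : MatField n) : MatField n := fun z i j =>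
  ∑ k, (X z k * pd k (fun y => u y i j) z
    + u z k j * pd i (fun y => X y k) z + u z i k * pd j (fun y => X y k) z)

/-- The conformal Killing (Ahlfors) operator `½ 𝓛_X G - (1/(n+1)) (div X) G`. -/
def ahlfors (G : MatField n) (X : VecField n) : MatField n := fun z i j =>
  (1 / 2) * lieDeriv X G z i j - 1 / ((n : ℝ) + 1) * divergence G X z * G z i j

/-- The function `A_G(f) = (1/n) |df|^(3-n) div (|df|^(n-1) grad f)`. -/
def coeffA (G : MatField n) (f : Coord n → ℝ) (z : Coord n) : ℝ :=
  1 / (n : ℝ) * normD G f z ^ (3 - (n : ℤ)) *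
    divergence G (fun y i => normD G f y ^ ((n : ℤ) - 1) * grad G f y i) z

/-- The tensor `𝓗_G(f)`, the conformally invariant version of the trace-free Hessian:
`|df|^6 𝓓_G(|df|^(-2) grad f) + A_G(f) (df ⊗ df - (1/(n+1)) |df|² G)`.
At a critical point of `f` both summands evaluate to `0`, which is also the value there of the
polynomial in `G⁻¹`, `G`, `df`, `∇df` that the expression equals at noncritical points. -/
def tensorH (G : MatField n) (f : Coord n → ℝ) : MatField n := fun z i j =>
  normD G f z ^ 6 * ahlfors G (fun y l => normD G f y ^ (-2 : ℤ) * grad G f y l) z i j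
    + coeffA G f z *
      (pd i f z * pd j f z - 1 / ((n : ℝ) + 1) * normD G f z ^ 2 * G z i j)

/-! ### Hölder norms on open subsets, and Möbius parametrizations -/

/-- `‖f‖_{C^{k,α}(Ω)} ≤ C` for an open set `Ω` (up to a factor depending only on `k`). -/
structure HolderBound {V : Type*} [NormedAddCommGroup V] [NormedSpace ℝ V]
    (k : ℕ) (α C : ℝ) (Ω : Set (Coord n)) (f : Coord n → V) : Prop where
  contDiffOn : ContDiffOn ℝ k f Ω
  norm_le : ∀ j ≤ k, ∀ x ∈ Ω, ‖iteratedFDeriv ℝ j f x‖ ≤ C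
  holder : ∀ x ∈ Ω, ∀ y ∈ Ω,
    ‖iteratedFDeriv ℝ k f x - iteratedFDeriv ℝ k f y‖ ≤ C * ‖x - y‖ ^ α

/-- The hyperbolic ball of radius `r` centred at `(1, 0, …, 0)` in the upper half-space
`{w | 0 < w 0}`; the hyperbolic distance `d` satisfies
`cosh d(w, v) = 1 + |w - v|² / (2 w₀ v₀)`. -/
def hypBall (n : ℕ) (r : ℝ) : Set (Coord n) :=
  {w | 0 < w 0 ∧ 1 + ‖w - EuclideanSpace.single 0 1‖ ^ 2 / (2 * w 0) < Real.cosh r}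

/-- The Möbius parametrization centred at `p = (ρ₀, θ₀)`: `(y, x) ↦ (ρ₀ y, θ₀ + ρ₀ x)`. -/
def mobius (p w : Coord n) : Coord n :=
  WithLp.toLp 2 (fun i => if i = 0 then p 0 * w 0 else p i + p 0 * w i)

/-! ### Manifolds with boundary -/

variable {M : Type*} [TopologicalSpace M] [ChartedSpace (EuclideanHalfSpace (n + 1)) M]

/-- Charts of a manifold with boundary. -/
abbrev Chart (n : ℕ) (M : Type*) [TopologicalSpace M] : Type _ :=
  OpenPartialHomeomorph M (EuclideanHalfSpace (n + 1))

/-- A smooth function `ρ ≥ 0` on the manifold with boundary that vanishes exactly on the boundary,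
with nonvanishing differential there. -/
structure IsDefiningFunction (ρ : M → ℝ) : Prop where
  smooth : ContMDiff (𝓡∂ (n + 1)) 𝓘(ℝ, ℝ) ∞ ρ
  nonneg : ∀ x, 0 ≤ ρ x
  eq_zero_iff : ∀ x, ρ x = 0 ↔ x ∈ (𝓡∂ (n + 1)).boundary M
  mfderiv_ne_zero : ∀ x ∈ (𝓡∂ (n + 1)).boundary M, mfderiv (𝓡∂ (n + 1)) 𝓘(ℝ, ℝ) ρ x ≠ 0

/-- The points of the target of a chart that correspond to interior points of the manifold. -/
def chartInterior (e : Chart n M) : Set (Coord n) :=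
  (e.extend (𝓡∂ (n + 1))).target ∩
    (e.extend (𝓡∂ (n + 1))).symm ⁻¹' (𝓡∂ (n + 1)).interior M

/-- The points of the target of a chart that correspond to boundary points of the manifold. -/
def chartBoundary (e : Chart n M) : Set (Coord n) :=
  (e.extend (𝓡∂ (n + 1))).target ∩
    (e.extend (𝓡∂ (n + 1))).symm ⁻¹' (𝓡∂ (n + 1)).boundary M

/-- Background coordinates `(ρ, θ)`: smooth charts whose transverse coordinate is `ρ`. If `ρ` is a
defining function, then their domains cover a neighbourhood of the boundary, because
`(ρ, z₁, …, zₙ)` are coordinates near a boundary point whenever `(z₀, z₁, …, zₙ)` are. -/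
def IsBackgroundChart (ρ : M → ℝ) (e : Chart n M) : Prop :=
  e ∈ IsManifold.maximalAtlas (𝓡∂ (n + 1)) ∞ M ∧
    ∀ x ∈ e.source, (e.extend (𝓡∂ (n + 1)) x) 0 = ρ x

/-- The coordinate expression of a function in a chart. -/
def funComp (f : M → ℝ) (e : Chart n M) (z : Coord n) : ℝ :=
  f ((e.extend (𝓡∂ (n + 1))).symm z)

/-- Covariant 2-tensor fields (with no regularity or symmetry). -/
abbrev TwoTensor (n : ℕ) (M : Type*) [TopologicalSpace M]
    [ChartedSpace (EuclideanHalfSpace (n + 1)) M] : Type _ :=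
  (x : M) → TangentSpace (𝓡∂ (n + 1)) x →L[ℝ] TangentSpace (𝓡∂ (n + 1)) x →L[ℝ] ℝ

/-- The coordinate vector `∂_i` of a chart, at the point with coordinates `z`. -/
def coordVec (e : Chart n M) (i : Fin (n + 1)) (z : Coord n) :
    TangentSpace (𝓡∂ (n + 1)) ((e.extend (𝓡∂ (n + 1))).symm z) :=
  mfderivWithin 𝓘(ℝ, Coord n) (𝓡∂ (n + 1)) (e.extend (𝓡∂ (n + 1))).symm
    (range (𝓡∂ (n + 1))) z (EuclideanSpace.single i (1 : ℝ) : Coord n)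

/-- The components `T(∂_i, ∂_j)` of a covariant 2-tensor field in a chart. -/
def tensorComp (T : TwoTensor n M) (e : Chart n M) : MatField n := fun z i j =>
  T ((e.extend (𝓡∂ (n + 1))).symm z) (coordVec e i z) (coordVec e j z)

/-- The smooth vector fields on the manifold with boundary. -/
abbrev SmoothVecField (n : ℕ) (M : Type*) [TopologicalSpace M]
    [ChartedSpace (EuclideanHalfSpace (n + 1)) M] [IsManifold (𝓡∂ (n + 1)) ∞ M] : Type _ :=
  ContMDiffSection (𝓡∂ (n + 1)) (Coord n) ∞ (fun x : M => TangentSpace (𝓡∂ (n + 1)) x)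

/-- The components of a vector field in a chart. -/
def vecComp (X : (x : M) → TangentSpace (𝓡∂ (n + 1)) x) (e : Chart n M) : VecField n :=
  fun z i =>
    (show Coord n from
      mfderiv (𝓡∂ (n + 1)) 𝓘(ℝ, Coord n) (e.extend (𝓡∂ (n + 1)))
        ((e.extend (𝓡∂ (n + 1))).symm z) (X ((e.extend (𝓡∂ (n + 1))).symm z))) i

/-- The conformally rescaled tensor `ρ² g`. -/
def rescale (ρ : M → ℝ) (g : TwoTensor n M) : TwoTensor n M := fun x => (ρ x) ^ 2 • g x

/-! ### Regularity classes

Tensor fields on the interior `M` are given by their components in every chart. -/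

/-- The weighted intrinsic Hölder space `C^{k,α}_δ(M)` of tensor fields `u` that are covariant of
rank `r`, where `u e` is the array of components of `u` in the chart `e`.

Near the boundary, `ρ^(-δ) u` is pulled back by the Möbius parametrizations
`Φ(y, x) = (ρ₀ y, θ₀ + ρ₀ x)` in background coordinates (so the components of the pullback
are those of `ρ^(-δ) u` at `Φ`, times `ρ₀^r`) and has to be bounded in `C^{k,α}(B₂)`, uniformly for
all `Φ` with image in a fixed compact subset of the background chart (compact in the
manifold with boundary). Away from the boundary, `u` has to be of class `C^{k,α}` in charts.
By compactness of the manifold with boundary this is finiteness of the supremum of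
the pullback norms over a covering uniformly locally finite family of Möbius parametrizations. -/
def MemHolder {V : Type*} [NormedAddCommGroup V] [NormedSpace ℝ V]
    (ρ : M → ℝ) (k : ℕ) (α δ : ℝ) (r : ℕ) (u : Chart n M → Coord n → V) : Prop :=
  (∀ e : Chart n M, IsBackgroundChart ρ e → ∀ K : Set M, IsCompact K → K ⊆ e.source →
    ∃ C : ℝ, ∀ p : Coord n, 0 < p 0 →
      MapsTo (mobius p) (hypBall n 2) (e.extend (𝓡∂ (n + 1)) '' K) →
      HolderBound k α C (hypBall n 2)
        (fun w => ((p 0 * w 0) ^ (-δ) * (p 0) ^ r) • u e (mobius p w))) ∧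
  (∀ e ∈ IsManifold.maximalAtlas (𝓡∂ (n + 1)) ∞ M, ∀ (z : Coord n) (s : ℝ),
    Metric.closedBall z s ⊆ chartInterior e → ∃ C : ℝ, HolderBound k α C (Metric.ball z s) (u e))

/-- The class `𝒞^{k,α;m}(M)` for covariant 2-tensor fields: for all `j ≤ m` and all vector fields
`X₁, …, X_j` smooth up to the boundary, `𝓛_{X₁} ⋯ 𝓛_{X_j} T` is in `C^{k-j,α}_2(M)`. -/
def MemScriptC [IsManifold (𝓡∂ (n + 1)) ∞ M]
    (ρ : M → ℝ) (k : ℕ) (α : ℝ) (m : ℕ) (T : TwoTensor n M) : Prop :=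
  ∀ Xs : List (SmoothVecField n M), Xs.length ≤ m →
    MemHolder ρ (k - Xs.length) α 2 2
      (fun e => Xs.foldr (fun X u => lieDeriv (vecComp (fun x => X x) e) u) (tensorComp T e))

/-- The class `𝓜_weak^{k,α;m}` of metrics `g` on the interior (the values of `g` at boundary points
are irrelevant). The limit of the curvature operator is expressed by its components in background
coordinates. -/
structure MemMWeak [IsManifold (𝓡∂ (n + 1)) ∞ M]
    (ρ : M → ℝ) (k : ℕ) (α : ℝ) (m : ℕ) (g : TwoTensor n M) : Prop where
  symm : ∀ x ∈ (𝓡∂ (n + 1)).interior M, ∀ v w, g x v w = g x w v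
  pos : ∀ x ∈ (𝓡∂ (n + 1)).interior M, ∀ v, v ≠ 0 → 0 < g x v v
  regular : MemScriptC ρ k α m (rescale ρ g)
  extends_metric :
    ∃ G : Bundle.ContinuousRiemannianMetric (Coord n)
        (fun x : M => TangentSpace (𝓡∂ (n + 1)) x),
      ∀ x ∈ (𝓡∂ (n + 1)).interior M, G.inner x = rescale ρ g x
  riem_tendsto : ∀ e : Chart n M, IsBackgroundChart ρ e → ∀ z ∈ chartBoundary e,
    ∀ a b i j : Fin (n + 1),
      Tendsto (riemOp (tensorComp g e) a b i j) (𝓝[chartInterior e] z) (𝓝 (-idOp a b i j))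

/-- `v` is, in the chart `e`, a continuous extension up to the boundary of the components of `u`. -/
def IsExtension {V : Type*} [TopologicalSpace V] (u : Chart n M → Coord n → V) (e : Chart n M)
    (v : Coord n → V) : Prop :=
  ContinuousOn v (e.extend (𝓡∂ (n + 1))).target ∧ EqOn v (u e) (chartInterior e)

/-- A tensor field on the interior extends continuously to the manifold with boundary:
it is continuous on the interior, and its components in background coordinates extend
continuously up to the boundary. -/
def ExtendsContinuously {V : Type*} [TopologicalSpace V] (ρ : M → ℝ)
    (u : Chart n M → Coord n → V) : Prop :=
  (∀ e ∈ IsManifold.maximalAtlas (𝓡∂ (n + 1)) ∞ M, ContinuousOn (u e) (chartInterior e)) ∧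
    ∀ e : Chart n M, IsBackgroundChart ρ e → ∃ v, IsExtension u e v

/-- Two tensor fields on the interior extend continuously to the manifold with boundary, and the
extensions (which are unique) agree along the boundary. -/
def AgreeOnBoundary {V : Type*} [TopologicalSpace V] (ρ : M → ℝ)
    (u₁ u₂ : Chart n M → Coord n → V) : Prop :=
  ExtendsContinuously ρ u₁ ∧ ExtendsContinuously ρ u₂ ∧
    ∀ e : Chart n M, IsBackgroundChart ρ e → ∀ v₁ v₂, IsExtension u₁ e v₁ →
      IsExtension u₂ e v₂ → EqOn v₁ v₂ (chartBoundary e)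

/-- The scalar curvature `R[g]`, in charts. -/
def scalarCurvature (g : TwoTensor n M) : Chart n M → Coord n → ℝ :=
  fun e => scalarCurv (tensorComp g e)

/-- The tensor `𝓗_{ḡ}(ρ)`, `ḡ = ρ² g`, in charts. -/
def tensorHBar (ρ : M → ℝ) (g : TwoTensor n M) : Chart n M → MatField n :=
  fun e => tensorH (tensorComp (rescale ρ g) e) (funComp ρ e)

/-- The trace-free Hessian of `ρ` with respect to `ḡ = ρ² g`, in charts. -/
def traceFreeHessBar (ρ : M → ℝ) (g : TwoTensor n M) : Chart n M → MatField n :=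
  fun e => traceFreeHess (tensorComp (rescale ρ g) e) (funComp ρ e)

end AH

end

/-! Write `N = |dρ|²`, `T` for the trace-free Hessian of `ρ` and `W = dN - (2/(n+1)) Δρ dρ`, all
with respect to `ḡ`; since `dN = 2 Hess ρ(grad ρ, ·)`, in fact `W = 2 T(grad ρ, ·)`. Expanding the
definition, the coefficient `A` is exactly what makes all terms `Δρ dρ ⊗ dρ` and `Δρ ḡ` outside `T`
cancel, so that `𝓗 - T = (N² - 1) T` plus terms linear in `W` (`tensorH_sub_traceFreeHess`). A
covariant 2-tensor of weight 3 has components of size `ρ`, so everything reduces to showing that `N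
- 1` and `W` are `O(ρ)` in the Hölder sense on Möbius balls.

The input is the conformal formula `R[g] = ρ² R[ḡ] + 2nρ Δρ - n(n+1) N` (`scalarCurv_conformal`).
Two Lie derivatives of `ḡ` are under control, so `R[ḡ]` is bounded, and the hypothesis on `R[g]`
gives `N - 1 = (2/(n+1)) ρ Δρ + O(ρ²)`. Hence `N - 1 = O(ρ)`. Formally the differential of this
expansion gives `W = O(ρ)`, but the `O(ρ²)` error need not have a controlled derivative.
Interpolation replaces the missing derivative (`ubound_defectW`): on a Möbius ball of scale `λ`,
subtract from `λ⁻²(N - 1)` the linear function of `y` obtained by freezing `Δρ` at the center. The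
result is bounded, and so are its second derivatives, because these are the second derivatives of
`N`. So its gradient is bounded, and this is `λ⁻¹ W` up to the oscillation of `λ⁻¹ Δρ`, which is
bounded as well.

Higher regularity is then free. A derivative of `λ⁻¹ u ∘ Φ` is `(∂u) ∘ Φ`, so for a function whose
background derivatives are controlled only the sup bound of `λ⁻¹ u` has to be proved
(`Adm.ub_inv_mul`). The control of background derivatives comes from the Lie derivative condition
applied to cut-off coordinate fields (`exists_admGeometry_mobius`). Finally `T` has bounded first
derivatives near the boundary, hence is Lipschitz on half-balls and extends continuously, while `𝓗 -
T` tends to 0. In the interior the same calculus is used with `Φ = id`, `λ = 1`. -/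

noncomputable section

namespace AH

variable {n : ℕ}

/-! ### Partial derivatives -/

section PartialDerivatives

variable {f g : Coord n → ℝ} {z : Coord n}

theorem pd_congr (h : f =ᶠ[𝓝 z] g) (i : Fin (n + 1)) : pd i f z = pd i g z := by
  rw [pd, pd, h.fderiv_eq]

theorem pd_const (i : Fin (n + 1)) (c : ℝ) : pd i (fun _ : Coord n => c) z = 0 := by
  simp [pd]

theorem pd_coord (i j : Fin (n + 1)) :
    pd i (fun y : Coord n => y j) z = if i = j then 1 else 0 := by
  have : (fun y : Coord n => y j) = EuclideanSpace.proj (𝕜 := ℝ) j := rfl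
  rw [pd, this, ContinuousLinearMap.fderiv]
  simp [eq_comm]

theorem pd_add (hf : DifferentiableAt ℝ f z) (hg : DifferentiableAt ℝ g z) (i : Fin (n + 1)) :
    pd i (fun y => f y + g y) z = pd i f z + pd i g z := by
  simp [pd, fderiv_fun_add hf hg]

theorem pd_sub (hf : DifferentiableAt ℝ f z) (hg : DifferentiableAt ℝ g z) (i : Fin (n + 1)) :
    pd i (fun y => f y - g y) z = pd i f z - pd i g z := by
  simp [pd, fderiv_fun_sub hf hg]

theorem pd_neg (i : Fin (n + 1)) : pd i (fun y => -f y) z = -pd i f z := by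
  simp [pd]

theorem pd_mul (hf : DifferentiableAt ℝ f z) (hg : DifferentiableAt ℝ g z) (i : Fin (n + 1)) :
    pd i (fun y => f y * g y) z = pd i f z * g z + f z * pd i g z := by
  simp [pd, fderiv_fun_mul hf hg]
  ring

theorem pd_const_mul (hf : DifferentiableAt ℝ f z) (c : ℝ) (i : Fin (n + 1)) :
    pd i (fun y => c * f y) z = c * pd i f z := by
  rw [pd_mul (differentiableAt_const c) hf, pd_const, zero_mul, zero_add]

theorem pd_sum {ι : Type*} (s : Finset ι) {F : ι → Coord n → ℝ}
    (hF : ∀ a ∈ s, DifferentiableAt ℝ (F a) z) (i : Fin (n + 1)) :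
    pd i (fun y => ∑ a ∈ s, F a y) z = ∑ a ∈ s, pd i (F a) z := by
  simp [pd, fderiv_fun_sum hF]

theorem pd_comp (φ : ℝ → ℝ) {φ' : ℝ} (hφ : HasDerivAt φ φ' (f z)) (hf : DifferentiableAt ℝ f z)
    (i : Fin (n + 1)) : pd i (fun y => φ (f y)) z = φ' * pd i f z := by
  have := (hφ.comp_hasFDerivAt z hf.hasFDerivAt).fderiv
  simp only [pd]
  erw [this]
  simp

theorem pd_inv (hf : DifferentiableAt ℝ f z) (h0 : f z ≠ 0) (i : Fin (n + 1)) :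
    pd i (fun y => (f y)⁻¹) z = -pd i f z * (f z)⁻¹ ^ 2 := by
  rw [pd_comp (fun t => t⁻¹) (hasDerivAt_inv h0) hf, ← inv_pow]
  ring

theorem contDiffAt_pd {m : WithTop ℕ∞} {m' : WithTop ℕ∞} (hf : ContDiffAt ℝ m' f z)
    (h : m + 1 ≤ m') (i : Fin (n + 1)) : ContDiffAt ℝ m (pd i f) z :=
  (hf.fderiv_right h).clm_apply contDiffAt_const

theorem pd_comm (hf : ContDiffAt ℝ 2 f z) (i j : Fin (n + 1)) :
    pd i (pd j f) z = pd j (pd i f) z := by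
  have hs : IsSymmSndFDerivAt ℝ f z := hf.isSymmSndFDerivAt (by simp)
  have hd : DifferentiableAt ℝ (fderiv ℝ f) z :=
    (hf.fderiv_right (m := 1) (by norm_num)).differentiableAt (by norm_num)
  have key : ∀ a b : Fin (n + 1), pd a (pd b f) z =
      fderiv ℝ (fderiv ℝ f) z (EuclideanSpace.single a 1) (EuclideanSpace.single b 1) := by
    intro a b
    change fderiv ℝ (fun y => fderiv ℝ f y (EuclideanSpace.single b 1)) z _ = _
    rw [fderiv_clm_apply hd (differentiableAt_const _)]
    simp
  rw [key, key]
  exact hs.eq _ _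

end PartialDerivatives

/-! ### The Levi-Civita connection in coordinates -/

/-- `G` is a nondegenerate symmetric tensor of class `C²` near `z`. -/
structure RegularAt (G : MatField n) (z : Coord n) : Prop where
  contDiffAt : ∀ i j, ContDiffAt ℝ 2 (fun y => G y i j) z
  symm : ∀ᶠ y in 𝓝 z, ∀ i j, G y i j = G y j i
  det_ne : (Matrix.of (G z)).det ≠ 0

theorem contDiffAt_det {G : MatField n} {z : Coord n} {m : WithTop ℕ∞}
    (h : ∀ i j, ContDiffAt ℝ m (fun y => G y i j) z) :
    ContDiffAt ℝ m (fun y => (Matrix.of (G y)).det) z := by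
  simp only [Matrix.det_apply']
  refine ContDiffAt.sum fun σ _ => contDiffAt_const.mul (contDiffAt_prod fun i _ => ?_)
  exact h _ _

/-- Cramer's rule: it shows the inverse as a rational function of the entries, so that smoothness
and Hölder bounds for sums, products and reciprocals suffice. -/
theorem invMetric_eq (G : MatField n) (z : Coord n) (i j : Fin (n + 1)) :
    invMetric G z i j = (Matrix.of (G z)).det⁻¹ *
      (Matrix.of fun a b => if a = j then (if b = i then 1 else 0) else G z a b).det := by
  rw [invMetric, Matrix.inv_def, Matrix.smul_apply, Matrix.adjugate_apply, Ring.inverse_eq_inv',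
    smul_eq_mul]
  congr 2
  ext a b
  by_cases h : a = j
  · subst h; simp [Pi.single_apply]
  · simp [h]

theorem contDiffAt_invMetric {G : MatField n} {z : Coord n} {m : WithTop ℕ∞}
    (h : ∀ i j, ContDiffAt ℝ m (fun y => G y i j) z) (hdet : (Matrix.of (G z)).det ≠ 0)
    (i j : Fin (n + 1)) : ContDiffAt ℝ m (fun y => invMetric G y i j) z := by
  simp only [invMetric_eq]
  refine ((contDiffAt_det h).inv hdet).mul
    (contDiffAt_det (G := fun y a b => if a = j then (if b = i then 1 else 0) else G y a b) ?_)
  intro a b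
  by_cases ha : a = j
  · simpa [ha] using contDiffAt_const
  · simpa [ha] using h a b

theorem det_cofactor_eq (G : MatField n) (z : Coord n) (hdet : (Matrix.of (G z)).det ≠ 0)
    (i j : Fin (n + 1)) :
    ∑ k, invMetric G z i k * G z k j = if i = j then 1 else 0 := by
  have h := congrFun (congrFun (Matrix.nonsing_inv_mul (Matrix.of (G z)) hdet.isUnit) i) j
  simpa [Matrix.mul_apply, Matrix.one_apply, invMetric] using h

theorem sum_mul_invMetric (G : MatField n) (z : Coord n) (hdet : (Matrix.of (G z)).det ≠ 0)
    (i j : Fin (n + 1)) :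
    ∑ k, G z i k * invMetric G z k j = if i = j then 1 else 0 := by
  have h := congrFun (congrFun (Matrix.mul_nonsing_inv (Matrix.of (G z)) hdet.isUnit) i) j
  simpa [Matrix.mul_apply, Matrix.one_apply, invMetric] using h

namespace RegularAt

variable {G : MatField n} {z : Coord n}

theorem eventually (h : RegularAt G z) : ∀ᶠ y in 𝓝 z, RegularAt G y := by
  have h1 : ∀ᶠ y in 𝓝 z, ∀ i j, ContDiffAt ℝ 2 (fun y => G y i j) y := by
    rw [eventually_all]; intro i
    rw [eventually_all]; intro j
    exact (h.contDiffAt i j).eventually (by simp)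
  have h2 : ∀ᶠ y in 𝓝 z, (Matrix.of (G y)).det ≠ 0 :=
    (contDiffAt_det h.contDiffAt).continuousAt.eventually_ne h.det_ne
  filter_upwards [h1, h2, eventually_eventually_nhds.2 h.symm] with y a b c using ⟨a, c, b⟩

theorem symm' (h : RegularAt G z) (i j : Fin (n + 1)) : G z i j = G z j i :=
  h.symm.self_of_nhds i j

theorem diff (h : RegularAt G z) (i j : Fin (n + 1)) :
    DifferentiableAt ℝ (fun y => G y i j) z :=
  (h.contDiffAt i j).differentiableAt (by norm_num)

theorem diff_pd (h : RegularAt G z) (a i j : Fin (n + 1)) :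
    DifferentiableAt ℝ (pd a (fun y => G y i j)) z :=
  (contDiffAt_pd (m := 1) (h.contDiffAt i j) (by norm_num) a).differentiableAt (by norm_num)

theorem contDiffAt_inv (h : RegularAt G z) (i j : Fin (n + 1)) :
    ContDiffAt ℝ 2 (fun y => invMetric G y i j) z :=
  contDiffAt_invMetric h.contDiffAt h.det_ne i j

theorem diff_inv (h : RegularAt G z) (i j : Fin (n + 1)) :
    DifferentiableAt ℝ (fun y => invMetric G y i j) z :=
  (h.contDiffAt_inv i j).differentiableAt (by norm_num)

theorem inv_mul (h : RegularAt G z) (i j : Fin (n + 1)) :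
    ∑ k, invMetric G z i k * G z k j = if i = j then 1 else 0 :=
  det_cofactor_eq G z h.det_ne i j

theorem mul_inv (h : RegularAt G z) (i j : Fin (n + 1)) :
    ∑ k, G z i k * invMetric G z k j = if i = j then 1 else 0 :=
  sum_mul_invMetric G z h.det_ne i j

theorem pd_symm (h : RegularAt G z) (a i j : Fin (n + 1)) :
    pd a (fun y => G y i j) z = pd a (fun y => G y j i) z := by
  refine pd_congr ?_ a
  filter_upwards [h.symm] with y hy using hy i j

theorem christoffel_symm (h : RegularAt G z) (k i j : Fin (n + 1)) :
    christoffel G k i j z = christoffel G k j i z := by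
  simp only [christoffel]
  congr 1
  refine Finset.sum_congr rfl fun l _ => ?_
  rw [h.pd_symm l i j]
  ring

/-- Lowering the upper index cancels the inverse metric and leaves the Christoffel symbols of the
first kind. -/
theorem sum_mul_christoffel (h : RegularAt G z) (m i j : Fin (n + 1)) :
    ∑ k, G z m k * christoffel G k i j z =
      (1 / 2) * (pd i (fun y => G y j m) z + pd j (fun y => G y i m) z
        - pd m (fun y => G y i j) z) := by
  simp only [christoffel, Finset.mul_sum]
  rw [Finset.sum_comm]
  have : ∀ l, ∑ k, G z m k * (1 / 2 * (invMetric G z k l *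
      (pd i (fun y => G y j l) z + pd j (fun y => G y i l) z - pd l (fun y => G y i j) z))) =
      (if m = l then 1 else 0) * (1 / 2 *
      (pd i (fun y => G y j l) z + pd j (fun y => G y i l) z - pd l (fun y => G y i j) z)) := by
    intro l
    rw [← h.mul_inv m l, Finset.sum_mul]
    exact Finset.sum_congr rfl fun k _ => by ring
  simp only [this]
  simp

/-- The Levi-Civita connection is compatible with the metric. -/
theorem pd_metric (h : RegularAt G z) (a i j : Fin (n + 1)) :
    pd a (fun y => G y i j) z =
      ∑ l, (G z l j * christoffel G l a i z + G z i l * christoffel G l a j z) := by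
  have : ∀ l, G z l j = G z j l := fun l => h.symm' l j
  simp only [Finset.sum_add_distrib, this, h.sum_mul_christoffel]
  rw [h.pd_symm a j i, h.pd_symm j a i, h.pd_symm i a j]
  ring

/-- Differentiate `G⁻¹ G = 1`, then multiply by `G⁻¹` on the right. -/
theorem pd_invMetric (h : RegularAt G z) (a i j : Fin (n + 1)) :
    pd a (fun y => invMetric G y i j) z =
      -∑ k, ∑ l, invMetric G z i k * pd a (fun y => G y k l) z * invMetric G z l j := by
  have key : ∀ l, ∑ k, pd a (fun y => invMetric G y i k) z * G z k l =
      -∑ k, invMetric G z i k * pd a (fun y => G y k l) z := by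
    intro l
    have h0 : pd a (fun y => ∑ k, invMetric G y i k * G y k l) z = 0 := by
      rw [← pd_const (z := z) a (if i = l then (1 : ℝ) else 0)]
      refine pd_congr ?_ a
      filter_upwards [h.eventually] with y hy using hy.inv_mul i l
    rw [pd_sum _ fun k _ => (h.diff_inv i k).fun_mul (h.diff k l)] at h0
    simp only [pd_mul (h.diff_inv _ _) (h.diff _ _), Finset.sum_add_distrib] at h0
    linarith
  have h1 : pd a (fun y => invMetric G y i j) z =
      ∑ k, pd a (fun y => invMetric G y i k) z * (if k = j then 1 else 0) := by simp
  rw [h1]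
  simp only [← h.mul_inv, Finset.mul_sum]
  rw [Finset.sum_comm]
  have h2 : ∀ l, ∑ k, pd a (fun y => invMetric G y i k) z * (G z k l * invMetric G z l j) =
      -∑ k, invMetric G z i k * pd a (fun y => G y k l) z * invMetric G z l j := by
    intro l
    rw [← Finset.sum_mul, ← neg_mul, ← key, Finset.sum_mul]
    exact Finset.sum_congr rfl fun k _ => by ring
  simp only [h2, Finset.sum_neg_distrib]
  rw [Finset.sum_comm]

/-- The inverse metric is parallel: insert `pd_metric` into the previous formula and contract. -/
theorem pd_invMetric_eq_christoffel (h : RegularAt G z) (a i j : Fin (n + 1)) :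
    pd a (fun y => invMetric G y i j) z =
      -∑ l, (christoffel G i a l z * invMetric G z l j
        + christoffel G j a l z * invMetric G z i l) := by
  rw [h.pd_invMetric a i j]
  congr 1
  have h1 : ∀ k l, invMetric G z i k * pd a (fun y => G y k l) z * invMetric G z l j =
      ∑ m, invMetric G z i k * christoffel G m a k z * (G z m l * invMetric G z l j) +
      ∑ m, (invMetric G z i k * G z k m) * (christoffel G m a l z * invMetric G z l j) := by
    intro k l
    rw [h.pd_metric, Finset.mul_sum, Finset.sum_mul, ← Finset.sum_add_distrib]
    exact Finset.sum_congr rfl fun m _ => by ring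
  simp only [h1, Finset.sum_add_distrib]
  rw [add_comm]
  congr 1
  · rw [Finset.sum_comm]
    refine Finset.sum_congr rfl fun l _ => ?_
    rw [Finset.sum_comm]
    simp only [← Finset.sum_mul, h.inv_mul]
    simp
  · refine Finset.sum_congr rfl fun k _ => ?_
    rw [Finset.sum_comm]
    simp only [← Finset.mul_sum, h.mul_inv]
    simp [mul_comm]

/-- The divergence of the vector field dual to a covector field `φ`. -/
theorem divergence_raise (h : RegularAt G z) {φ : Fin (n + 1) → Coord n → ℝ}
    (hφ : ∀ i, DifferentiableAt ℝ (φ i) z) :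
    divergence G (fun y i => ∑ l, invMetric G y i l * φ l y) z =
      ∑ i, ∑ j, invMetric G z i j * (pd i (φ j) z - ∑ k, christoffel G k i j z * φ k z) := by
  have h1 : ∀ i, pd i (fun y => ∑ l, invMetric G y i l * φ l y) z =
      ∑ l, invMetric G z i l * pd i (φ l) z -
      ∑ l, ∑ m, (christoffel G i i m z * (invMetric G z m l * φ l z) +
        invMetric G z i m * (christoffel G l i m z * φ l z)) := by
    intro i
    rw [pd_sum _ fun l _ => (h.diff_inv i l).fun_mul (hφ l), ← Finset.sum_sub_distrib]
    refine Finset.sum_congr rfl fun l _ => ?_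
    rw [pd_mul (h.diff_inv i l) (hφ l), h.pd_invMetric_eq_christoffel, neg_mul, Finset.sum_mul,
      neg_add_eq_sub]
    congr 1
    exact Finset.sum_congr rfl fun m _ => by ring
  simp only [divergence, h1, mul_sub, Finset.sum_add_distrib, Finset.sum_sub_distrib,
    Finset.mul_sum]
  have h2 : ∀ i, ∑ l, ∑ m, christoffel G i i m z * (invMetric G z m l * φ l z) =
      ∑ k, ∑ l, christoffel G i i k z * (invMetric G z k l * φ l z) :=
    fun i => Finset.sum_comm
  have h3 : ∀ i, ∑ l, ∑ m, invMetric G z i m * (christoffel G l i m z * φ l z) =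
      ∑ j, ∑ k, invMetric G z i j * (christoffel G k i j z * φ k z) :=
    fun i => Finset.sum_comm
  simp only [h2, h3]
  ring

end RegularAt

/-! ### Covectors, gradients and the conformal Killing operator -/

/-- The inner product of two covectors with respect to `G`. -/
def innerD (G : MatField n) (z : Coord n) (u v : Fin (n + 1) → ℝ) : ℝ :=
  ∑ i, ∑ j, invMetric G z i j * u i * v j

/-- The squared norm `|df|²`. -/
def sqNorm (G : MatField n) (f : Coord n → ℝ) (z : Coord n) : ℝ :=
  innerD G z (fun i => pd i f z) fun j => pd j f z

theorem normD_eq_sqrt (G : MatField n) (f : Coord n → ℝ) (z : Coord n) :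
    normD G f z = Real.sqrt (sqNorm G f z) := rfl

theorem innerD_smul_left (G : MatField n) (z : Coord n) (c : ℝ) (u v : Fin (n + 1) → ℝ) :
    innerD G z (fun i => c * u i) v = c * innerD G z u v := by
  simp only [innerD, Finset.mul_sum]
  exact Finset.sum_congr rfl fun i _ => Finset.sum_congr rfl fun j _ => by ring

theorem innerD_sub_left (G : MatField n) (z : Coord n) (u u' v : Fin (n + 1) → ℝ) :
    innerD G z (fun i => u i - u' i) v = innerD G z u v - innerD G z u' v := by
  simp only [innerD, ← Finset.sum_sub_distrib]
  exact Finset.sum_congr rfl fun i _ => Finset.sum_congr rfl fun j _ => by ring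

theorem innerD_self (G : MatField n) (z : Coord n) (u : Fin (n + 1) → ℝ) :
    innerD G z u u = u ⬝ᵥ ((Matrix.of (G z))⁻¹).mulVec u := by
  simp only [innerD, dotProduct, Matrix.mulVec, Finset.mul_sum]
  exact Finset.sum_congr rfl fun i _ => Finset.sum_congr rfl fun j _ => by
    rw [invMetric]; ring

theorem innerD_self_pos {G : MatField n} {z : Coord n} (h : (Matrix.of (G z)).PosDef)
    {u : Fin (n + 1) → ℝ} (hu : u ≠ 0) : 0 < innerD G z u u := by
  rw [innerD_self]
  simpa using h.inv.dotProduct_mulVec_pos hu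

theorem sqNorm_nonneg {G : MatField n} {z : Coord n} (h : (Matrix.of (G z)).PosDef)
    (f : Coord n → ℝ) : 0 ≤ sqNorm G f z := by
  rw [sqNorm, innerD_self]
  simpa using h.inv.posSemidef.dotProduct_mulVec_nonneg fun i => pd i f z

theorem normD_sq {G : MatField n} {z : Coord n} (h : (Matrix.of (G z)).PosDef)
    (f : Coord n → ℝ) : normD G f z ^ 2 = sqNorm G f z :=
  Real.sq_sqrt (sqNorm_nonneg h f)

/-- The vector field dual to a covector field. -/
def raise (G : MatField n) (φ : Fin (n + 1) → Coord n → ℝ) : VecField n := fun y i =>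
  ∑ l, invMetric G y i l * φ l y

namespace RegularAt

variable {G : MatField n} {z : Coord n}

theorem sum_inv_mul_metric (h : RegularAt G z) :
    ∑ i, ∑ j, invMetric G z i j * G z i j = (n : ℝ) + 1 := by
  have : ∀ i, ∑ j, invMetric G z i j * G z i j = 1 := fun i => by
    rw [← (h.inv_mul i i).trans (if_pos rfl)]
    exact Finset.sum_congr rfl fun j _ => by rw [h.symm' i j]
  simp [this]

theorem lower_raise (h : RegularAt G z) (φ : Fin (n + 1) → Coord n → ℝ) (j : Fin (n + 1)) :
    ∑ k, G z k j * raise G φ z k = φ j z := by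
  simp only [raise, Finset.mul_sum]
  rw [Finset.sum_comm]
  have : ∀ l, ∑ k, G z k j * (invMetric G z k l * φ l z) = (if j = l then 1 else 0) * φ l z := by
    intro l
    rw [← h.mul_inv j l, Finset.sum_mul]
    exact Finset.sum_congr rfl fun k _ => by rw [h.symm' k j]; ring
  simp [this]

theorem diff_raise (h : RegularAt G z) {φ : Fin (n + 1) → Coord n → ℝ}
    (hφ : ∀ i, DifferentiableAt ℝ (φ i) z) (i : Fin (n + 1)) :
    DifferentiableAt ℝ (fun y => raise G φ y i) z := by
  unfold raise
  exact DifferentiableAt.fun_sum fun l _ => (h.diff_inv i l).fun_mul (hφ l)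

/-- Differentiating the identity `lower_raise` moves the derivative from the raised vector to `φ`
without differentiating the inverse metric. -/
theorem sum_metric_pd_raise (h : RegularAt G z) {φ : Fin (n + 1) → Coord n → ℝ}
    (hφ : ∀ i, DifferentiableAt ℝ (φ i) z) (i j : Fin (n + 1)) :
    ∑ k, G z k j * pd i (fun y => raise G φ y k) z =
      pd i (φ j) z - ∑ k, pd i (fun y => G y k j) z * raise G φ z k := by
  have h0 : pd i (fun y => ∑ k, G y k j * raise G φ y k) z = pd i (φ j) z := by
    refine pd_congr ?_ i
    filter_upwards [h.eventually] with y hy using hy.lower_raise φ j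
  rw [pd_sum _ fun k _ => (h.diff k j).fun_mul (h.diff_raise hφ k)] at h0
  simp only [pd_mul (h.diff _ _) (h.diff_raise hφ _), Finset.sum_add_distrib] at h0
  linarith

theorem sum_christoffel_mul (h : RegularAt G z) (φ : Fin (n + 1) → Coord n → ℝ)
    (i j : Fin (n + 1)) :
    ∑ k, christoffel G k i j z * φ k z =
      ∑ m, (1 / 2) * (pd i (fun y => G y j m) z + pd j (fun y => G y i m) z
        - pd m (fun y => G y i j) z) * raise G φ z m := by
  simp only [← h.sum_mul_christoffel, Finset.sum_mul]
  rw [Finset.sum_comm]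
  refine Finset.sum_congr rfl fun k _ => ?_
  rw [← h.lower_raise φ k, Finset.mul_sum]
  exact Finset.sum_congr rfl fun m _ => by ring

/-- This is `(𝓛_X G)_{ij} = ∇_i φ_j + ∇_j φ_i` for `X` dual to `φ`. The transport term of the Lie
derivative supplies the third term of the Koszul formula. -/
theorem lieDeriv_raise (h : RegularAt G z) {φ : Fin (n + 1) → Coord n → ℝ}
    (hφ : ∀ i, DifferentiableAt ℝ (φ i) z) (i j : Fin (n + 1)) :
    lieDeriv (raise G φ) G z i j =
      pd i (φ j) z + pd j (φ i) z - 2 * ∑ k, christoffel G k i j z * φ k z := by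
  have h1 := h.sum_metric_pd_raise hφ i j
  have h2 := h.sum_metric_pd_raise hφ j i
  have h3 : ∀ k, G z i k = G z k i := fun k => h.symm' i k
  rw [h.sum_christoffel_mul, lieDeriv]
  simp only [h3, Finset.sum_add_distrib]
  rw [h1, h2, Finset.mul_sum]
  have h4 : ∑ k, 2 * (1 / 2 * (pd i (fun y => G y j k) z + pd j (fun y => G y i k) z
        - pd k (fun y => G y i j) z) * raise G φ z k) =
      ∑ k, pd i (fun y => G y k j) z * raise G φ z k +
      ∑ k, pd j (fun y => G y k i) z * raise G φ z k -
      ∑ k, raise G φ z k * pd k (fun y => G y i j) z := by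
    rw [← Finset.sum_add_distrib, ← Finset.sum_sub_distrib]
    refine Finset.sum_congr rfl fun k _ => ?_
    rw [h.pd_symm i j k, h.pd_symm j i k]
    ring
  rw [h4]
  ring

variable {f : Coord n → ℝ}

theorem _root_.AH.diff_pd_of_contDiffAt (hf : ContDiffAt ℝ 2 f z) (i : Fin (n + 1)) :
    DifferentiableAt ℝ (pd i f) z :=
  (contDiffAt_pd (m := 1) hf (by norm_num) i).differentiableAt (by norm_num)

/-- Presents a multiple of the gradient as a raised covector, so that the formulas for `raise`
apply. -/
theorem _root_.AH.smul_grad (G : MatField n) (f φ : Coord n → ℝ) :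
    (fun y i => φ y * grad G f y i) = raise G fun l y => φ y * pd l f y := by
  funext y i
  simp only [grad, raise, Finset.mul_sum]
  exact Finset.sum_congr rfl fun l _ => by ring

theorem lieDeriv_smul_grad (h : RegularAt G z) (hf : ContDiffAt ℝ 2 f z) {φ : Coord n → ℝ}
    (hφ : DifferentiableAt ℝ φ z) (i j : Fin (n + 1)) :
    lieDeriv (fun y i => φ y * grad G f y i) G z i j =
      pd i φ z * pd j f z + pd j φ z * pd i f z + 2 * (φ z * hess G f z i j) := by
  rw [smul_grad, h.lieDeriv_raise fun i => hφ.fun_mul (diff_pd_of_contDiffAt hf i),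
    pd_mul hφ (diff_pd_of_contDiffAt hf _), pd_mul hφ (diff_pd_of_contDiffAt hf _),
    pd_comm hf j i, hess]
  have : ∑ k, christoffel G k i j z * (φ z * pd k f z) =
      φ z * ∑ k, christoffel G k i j z * pd k f z := by
    rw [Finset.mul_sum]; exact Finset.sum_congr rfl fun k _ => by ring
  rw [this]
  ring

theorem divergence_smul_grad (h : RegularAt G z) (hf : ContDiffAt ℝ 2 f z) {φ : Coord n → ℝ}
    (hφ : DifferentiableAt ℝ φ z) :
    divergence G (fun y i => φ y * grad G f y i) z =
      innerD G z (fun i => pd i φ z) (fun j => pd j f z) + φ z * laplacian G f z := by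
  rw [smul_grad]
  refine (h.divergence_raise fun i => hφ.fun_mul (diff_pd_of_contDiffAt hf i)).trans ?_
  simp only [innerD, laplacian, Finset.mul_sum, ← Finset.sum_add_distrib, hess]
  refine Finset.sum_congr rfl fun i _ => Finset.sum_congr rfl fun j _ => ?_
  rw [pd_mul hφ (diff_pd_of_contDiffAt hf _)]
  have : ∑ k, christoffel G k i j z * (φ z * pd k f z) =
      φ z * ∑ k, christoffel G k i j z * pd k f z := by
    rw [Finset.mul_sum]; exact Finset.sum_congr rfl fun k _ => by ring
  rw [this]
  ring

/-- By the product rule the derivatives of `φ` enter only through the trace-free symmetric product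
of `dφ` and `df`. -/
theorem ahlfors_smul_grad (h : RegularAt G z) (hf : ContDiffAt ℝ 2 f z) {φ : Coord n → ℝ}
    (hφ : DifferentiableAt ℝ φ z) (i j : Fin (n + 1)) :
    ahlfors G (fun y i => φ y * grad G f y i) z i j =
      φ z * traceFreeHess G f z i j +
      ((1 / 2) * (pd i φ z * pd j f z + pd j φ z * pd i f z) -
        1 / ((n : ℝ) + 1) * innerD G z (fun i => pd i φ z) (fun j => pd j f z) * G z i j) := by
  rw [ahlfors, h.lieDeriv_smul_grad hf hφ, h.divergence_smul_grad hf hφ, traceFreeHess]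
  ring

theorem diff_sqNorm (h : RegularAt G z) (hf : ContDiffAt ℝ 2 f z) :
    DifferentiableAt ℝ (sqNorm G f) z := by
  unfold sqNorm innerD
  exact DifferentiableAt.fun_sum fun i _ => DifferentiableAt.fun_sum fun j _ =>
    ((h.diff_inv i j).fun_mul (diff_pd_of_contDiffAt hf i)).fun_mul (diff_pd_of_contDiffAt hf j)

end RegularAt

/-- The polynomial expression of `𝓗_G(f)` in the metric, its inverse, `df`, `∇df`. -/
theorem tensorH_eq (hn : 1 ≤ n) {G : MatField n} {z : Coord n} {f : Coord n → ℝ}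
    (h : RegularAt G z) (hpos : ∀ᶠ y in 𝓝 z, (Matrix.of (G y)).PosDef)
    (hf : ContDiffAt ℝ 2 f z) (i j : Fin (n + 1)) :
    tensorH G f z i j =
      sqNorm G f z ^ 2 * traceFreeHess G f z i j
      - sqNorm G f z * ((1 / 2) * (pd i (sqNorm G f) z * pd j f z
          + pd j (sqNorm G f) z * pd i f z) - 1 / ((n : ℝ) + 1) *
          innerD G z (fun i => pd i (sqNorm G f) z) (fun j => pd j f z) * G z i j)
      + 1 / (n : ℝ) * (sqNorm G f z * laplacian G f z + ((n : ℝ) - 1) / 2 *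
          innerD G z (fun i => pd i (sqNorm G f) z) (fun j => pd j f z)) *
        (pd i f z * pd j f z - 1 / ((n : ℝ) + 1) * sqNorm G f z * G z i j) := by
  have hp := hpos.self_of_nhds
  have hN2 := normD_sq hp f
  have hn0 : (n : ℝ) ≠ 0 := by positivity
  rw [tensorH, hN2]
  -- At a critical point both sides vanish. Elsewhere `N > 0`, and the square root and the integer
  -- powers of `|df|`, possibly negative, are differentiable.
  by_cases hcrit : ∀ i, pd i f z = 0
  · have hN : sqNorm G f z = 0 := by simp [sqNorm, innerD, hcrit]
    have hν : normD G f z = 0 := by rw [normD_eq_sqrt, hN, Real.sqrt_zero]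
    simp [hN, hν, hcrit]
  push Not at hcrit
  have hNpos : 0 < sqNorm G f z := by
    refine innerD_self_pos hp fun h0 => ?_
    obtain ⟨a, ha⟩ := hcrit
    exact ha (congrFun h0 a)
  have hνpos : 0 < normD G f z := Real.sqrt_pos.2 hNpos
  have hNd := h.diff_sqNorm hf
  have e1 : (fun y l => normD G f y ^ (-2 : ℤ) * grad G f y l) =ᶠ[𝓝 z]
      fun y l => (sqNorm G f y)⁻¹ * grad G f y l := by
    filter_upwards [hpos] with y hy
    funext l
    rw [← normD_sq hy f, zpow_neg]
    rfl
  have hνd : HasDerivAt Real.sqrt (1 / (2 * normD G f z)) (sqNorm G f z) :=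
    Real.hasDerivAt_sqrt hNpos.ne'
  have hA : ahlfors G (fun y l => normD G f y ^ (-2 : ℤ) * grad G f y l) z i j =
      ahlfors G (fun y l => (sqNorm G f y)⁻¹ * grad G f y l) z i j := by
    have e2 : ∀ l, (fun y => normD G f y ^ (-2 : ℤ) * grad G f y l) =ᶠ[𝓝 z]
      fun y => (sqNorm G f y)⁻¹ * grad G f y l := fun l => by
      filter_upwards [e1] with y hy using congrFun hy l
    simp only [ahlfors, lieDeriv, divergence, fun l i => pd_congr (e2 l) i,
      fun l => congrFun e1.self_of_nhds l]
  have hφ : ∀ a, pd a (fun y => normD G f y ^ ((n : ℤ) - 1)) z =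
      (((n : ℤ) - 1 : ℤ) : ℝ) * normD G f z ^ ((n : ℤ) - 1 - 1) *
        ((1 / (2 * normD G f z)) * pd a (sqNorm G f) z) := by
    intro a
    rw [← pd_comp Real.sqrt hνd hNd]
    exact pd_comp (fun t => t ^ ((n : ℤ) - 1))
      (hasDerivAt_zpow ((n : ℤ) - 1) (normD G f z) (Or.inl hνpos.ne'))
      (hνd.differentiableAt.comp z hNd) a
  have hφd : DifferentiableAt ℝ (fun y => normD G f y ^ ((n : ℤ) - 1)) z :=
    (hasDerivAt_zpow ((n : ℤ) - 1) (normD G f z) (Or.inl hνpos.ne')).differentiableAt.comp z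
      (hνd.differentiableAt.comp z hNd)
  have hcoef : coeffA G f z = 1 / (n : ℝ) * (sqNorm G f z * laplacian G f z +
      ((n : ℝ) - 1) / 2 * innerD G z (fun i => pd i (sqNorm G f) z) (fun j => pd j f z)) := by
    rw [coeffA, h.divergence_smul_grad hf hφd]
    simp only [hφ]
    have e3 : innerD G z (fun a => (((n : ℤ) - 1 : ℤ) : ℝ) * normD G f z ^ ((n : ℤ) - 1 - 1) *
        ((1 / (2 * normD G f z)) * pd a (sqNorm G f) z)) (fun j => pd j f z) =
        (((n : ℤ) - 1 : ℤ) : ℝ) * normD G f z ^ ((n : ℤ) - 1 - 1) * (1 / (2 * normD G f z)) *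
        innerD G z (fun a => pd a (sqNorm G f) z) (fun j => pd j f z) := by
      rw [← innerD_smul_left]; congr 1; funext a; ring
    -- The prefactor `|df|^(3-n)` is matched to the weight in the divergence: the exponents add up
    -- to 2 here and to 1 in `e5`, so the dependence on `n` stays only in the coefficients.
    have e4 : normD G f z ^ (3 - (n : ℤ)) * normD G f z ^ ((n : ℤ) - 1) = sqNorm G f z := by
      rw [← zpow_add₀ hνpos.ne', ← hN2, ← zpow_natCast]
      congr 1
      push_cast; ring
    have e5 : normD G f z ^ (3 - (n : ℤ)) * normD G f z ^ ((n : ℤ) - 1 - 1) = normD G f z := by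
      rw [← zpow_add₀ hνpos.ne']
      conv_rhs => rw [← zpow_one (normD G f z)]
      congr 1
      ring
    rw [e3, mul_assoc, mul_add]
    congr 1
    rw [add_comm]
    congr 1
    · rw [← mul_assoc, e4]
    · push_cast
      calc _ = (normD G f z ^ (3 - (n : ℤ)) * normD G f z ^ ((n : ℤ) - 1 - 1)) *
            (((n : ℝ) - 1) * (1 / (2 * normD G f z)) *
            innerD G z (fun a => pd a (sqNorm G f) z) (fun j => pd j f z)) := by ring
        _ = _ := by rw [e5]; field_simp
  have hψ : ∀ a, pd a (fun y => (sqNorm G f y)⁻¹) z =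
      -((sqNorm G f z)⁻¹ ^ 2) * pd a (sqNorm G f) z := fun a => by
    rw [pd_inv hNd hNpos.ne']; ring
  have h6 : normD G f z ^ 6 = sqNorm G f z ^ 3 := by rw [← hN2]; ring
  rw [hA, h.ahlfors_smul_grad hf (hNd.fun_inv hNpos.ne'), hcoef, h6]
  simp only [hψ]
  rw [innerD_smul_left]
  field_simp
  ring

/-- The covector field `d|df|² - (2/(n+1)) Δf df`. -/
def defectW (G : MatField n) (f : Coord n → ℝ) (i : Fin (n + 1)) (z : Coord n) : ℝ :=
  pd i (sqNorm G f) z - 2 / ((n : ℝ) + 1) * laplacian G f z * pd i f z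

/-- Substitute `dN = W + (2/(n+1)) Δf df` in `tensorH_eq`. The Laplacian terms outside the
trace-free Hessian have coefficients `-2/(n+1)` and `(1/n)(1 + (n-1)/(n+1)) = 2/(n+1)` and cancel,
so every remaining term contains `N - 1` or `W`. -/
theorem tensorH_sub_traceFreeHess (hn : 1 ≤ n) {G : MatField n} {z : Coord n} {f : Coord n → ℝ}
    (h : RegularAt G z) (hpos : ∀ᶠ y in 𝓝 z, (Matrix.of (G y)).PosDef)
    (hf : ContDiffAt ℝ 2 f z) (i j : Fin (n + 1)) :
    tensorH G f z i j - traceFreeHess G f z i j =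
      (sqNorm G f z - 1) * ((sqNorm G f z + 1) * traceFreeHess G f z i j)
      - (1 / 2) * sqNorm G f z * (defectW G f i z * pd j f z + defectW G f j z * pd i f z)
      + innerD G z (fun i => defectW G f i z) (fun j => pd j f z) *
        (1 / ((n : ℝ) + 1) * sqNorm G f z * G z i j + ((n : ℝ) - 1) / (2 * n) *
        (pd i f z * pd j f z - 1 / ((n : ℝ) + 1) * sqNorm G f z * G z i j)) := by
  have hn0 : (n : ℝ) ≠ 0 := by positivity
  have hn1 : (n : ℝ) + 1 ≠ 0 := by positivity
  rw [tensorH_eq hn h hpos hf]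
  have hW : innerD G z (fun i => defectW G f i z) (fun j => pd j f z) =
      innerD G z (fun i => pd i (sqNorm G f) z) (fun j => pd j f z)
        - 2 / ((n : ℝ) + 1) * laplacian G f z * sqNorm G f z := by
    simp only [defectW]
    rw [innerD_sub_left, innerD_smul_left]
    rfl
  rw [hW]
  simp only [defectW]
  field_simp
  ring

/-! ### The scalar curvature of a conformal metric -/

/-- The difference of the connections of `f⁻² G` and `G`, where `φ = -d log f` and `v` is dual
to `φ`. -/
def conformalDiff (g : Fin (n + 1) → Fin (n + 1) → ℝ) (φ v : Fin (n + 1) → ℝ)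
    (k i j : Fin (n + 1)) : ℝ :=
  (if k = i then 1 else 0) * φ j + (if k = j then 1 else 0) * φ i - g i j * v k

section Algebra

variable {g : Fin (n + 1) → Fin (n + 1) → ℝ} {φ v : Fin (n + 1) → ℝ}

theorem sum_mul_conformalDiff (a : Fin (n + 1) → ℝ) (j m : Fin (n + 1)) :
    ∑ p, a p * conformalDiff g φ v p j m = a j * φ m + a m * φ j - g j m * ∑ p, a p * v p := by
  have : ∀ p, a p * conformalDiff g φ v p j m =
      (if p = j then 1 else 0) * (a p * φ m) + (if p = m then 1 else 0) * (a p * φ j)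
        - g j m * (a p * v p) := fun p => by rw [conformalDiff]; ring
  simp only [this, Finset.sum_add_distrib, Finset.sum_sub_distrib, ← Finset.mul_sum]
  simp

/-- The second and third terms of the difference tensor have opposite traces; only the first, with
trace `n + 1` times `φ`, survives. -/
theorem trace_conformalDiff (hv : ∀ m, ∑ i, g i m * v i = φ m) (m : Fin (n + 1)) :
    ∑ i, conformalDiff g φ v i i m = ((n : ℝ) + 1) * φ m := by
  simp only [conformalDiff, Finset.sum_add_distrib, Finset.sum_sub_distrib, hv]
  simp

theorem sum_conformalDiff_mul (b : Fin (n + 1) → Fin (n + 1) → ℝ) (j : Fin (n + 1)) :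
    ∑ i, ∑ p, conformalDiff g φ v i j p * b p i =
      ∑ p, φ p * b p j + φ j * ∑ i, b i i - ∑ i, ∑ p, v i * (g j p * b p i) := by
  have : ∀ i p, conformalDiff g φ v i j p * b p i =
      (if i = j then 1 else 0) * (φ p * b p i) + (if i = p then 1 else 0) * (φ j * b p i)
        - v i * (g j p * b p i) := fun i p => by rw [conformalDiff]; ring
  simp only [this, Finset.sum_add_distrib, Finset.sum_sub_distrib, ← Finset.mul_sum]
  simp [Finset.mul_sum]

/-- The part of the Ricci tensor of a conformal metric that is quadratic in the difference of the
connections. -/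
theorem sum_conformalDiff_mul_self (hs : ∀ i j, g i j = g j i)
    (hv : ∀ m, ∑ i, g i m * v i = φ m) (j m : Fin (n + 1)) :
    ∑ i, ∑ p, conformalDiff g φ v i j p * conformalDiff g φ v p i m =
      ((n : ℝ) + 3) * (φ j * φ m) - 2 * (g j m * ∑ p, φ p * v p) := by
  have hv' : ∀ m, ∑ i, g m i * v i = φ m := fun m => by
    rw [← hv m]; exact Finset.sum_congr rfl fun i _ => by rw [hs]
  rw [sum_conformalDiff_mul (fun p i => conformalDiff g φ v p i m), sum_mul_conformalDiff,
    trace_conformalDiff hv]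
  have h1 : ∀ i, ∑ p, v i * (g j p * conformalDiff g φ v p i m) =
      v i * (g j i * φ m + g j m * φ i - g i m * φ j) := fun i => by
    rw [← Finset.mul_sum, sum_mul_conformalDiff, hv']
  have h2 : ∑ i, v i * (g j i * φ m + g j m * φ i - g i m * φ j) =
      (∑ i, g j i * v i) * φ m + g j m * (∑ i, φ i * v i) - (∑ i, g i m * v i) * φ j := by
    simp only [Finset.sum_mul, Finset.mul_sum, ← Finset.sum_add_distrib,
      ← Finset.sum_sub_distrib]
    exact Finset.sum_congr rfl fun i _ => by ring
  simp only [h1]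
  rw [h2, hv, hv']
  ring

end Algebra

/-! ### Ricci and scalar curvature under a conformal change -/

/-- The Ricci contraction of the curvature tensor. -/
def ricci (G : MatField n) (j m : Fin (n + 1)) (z : Coord n) : ℝ := ∑ i, curvature G i m i j z

theorem scalarCurv_eq (G : MatField n) (z : Coord n) :
    scalarCurv G z = ∑ j, ∑ m, invMetric G z j m * ricci G j m z := by
  simp only [scalarCurv, riemOp, ricci, Finset.mul_sum]
  rw [Finset.sum_comm]
  exact Finset.sum_congr rfl fun j _ => Finset.sum_comm

theorem ricci_eq (G : MatField n) (j m : Fin (n + 1)) (z : Coord n) :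
    ricci G j m z = ∑ i, pd i (christoffel G i j m) z - ∑ i, pd j (christoffel G i i m) z
      + ∑ p, (∑ i, christoffel G i i p z) * christoffel G p j m z
      - ∑ i, ∑ p, christoffel G i j p z * christoffel G p i m z := by
  simp only [ricci, curvature, Finset.sum_add_distrib, Finset.sum_sub_distrib, Finset.sum_mul]
  rw [Finset.sum_comm (f := fun i p => christoffel G i i p z * christoffel G p j m z)]
  ring

/-- The conformal metric `f⁻² G`. -/
def conformal (f : Coord n → ℝ) (G : MatField n) : MatField n := fun y i j =>
  (f y ^ 2)⁻¹ * G y i j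

/-- The components of `-d log f`. -/
def dlog (f : Coord n → ℝ) (i : Fin (n + 1)) (y : Coord n) : ℝ := -((f y)⁻¹ * pd i f y)

theorem diff_dlog {f : Coord n → ℝ} {z : Coord n} (hf : ContDiffAt ℝ 2 f z) (h0 : f z ≠ 0)
    (i : Fin (n + 1)) : DifferentiableAt ℝ (dlog f i) z :=
  (((hf.differentiableAt (by norm_num)).fun_inv h0).fun_mul (diff_pd_of_contDiffAt hf i)).fun_neg

theorem pd_dlog {f : Coord n → ℝ} {z : Coord n} (hf : ContDiffAt ℝ 2 f z) (h0 : f z ≠ 0)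
    (i j : Fin (n + 1)) :
    pd i (dlog f j) z = (f z)⁻¹ ^ 2 * (pd i f z * pd j f z) - (f z)⁻¹ * pd i (pd j f) z := by
  have hd := hf.differentiableAt (by norm_num)
  have : pd i (dlog f j) z = -pd i (fun y => (f y)⁻¹ * pd j f y) z := pd_neg i
  rw [this, pd_mul (hd.fun_inv h0) (diff_pd_of_contDiffAt hf j), pd_inv hd h0]
  ring

theorem invMetric_conformal {f : Coord n → ℝ} {G : MatField n} {z : Coord n}
    (hdet : (Matrix.of (G z)).det ≠ 0) (h0 : f z ≠ 0) (i j : Fin (n + 1)) :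
    invMetric (conformal f G) z i j = f z ^ 2 * invMetric G z i j := by
  have h1 : Matrix.of (conformal f G z) = (f z ^ 2)⁻¹ • Matrix.of (G z) := rfl
  have h2 : (Matrix.of (conformal f G z))⁻¹ = f z ^ 2 • (Matrix.of (G z))⁻¹ := by
    rw [h1]
    refine Matrix.inv_eq_left_inv ?_
    rw [Matrix.smul_mul, Matrix.mul_smul, Matrix.nonsing_inv_mul _ hdet.isUnit, smul_smul,
      mul_inv_cancel₀ (pow_ne_zero 2 h0), one_smul]
  rw [invMetric, h2]
  rfl

namespace RegularAt

variable {G : MatField n} {z : Coord n} {f : Coord n → ℝ}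

theorem pd_conformal (h : RegularAt G z) (hf : DifferentiableAt ℝ f z) (h0 : f z ≠ 0)
    (a i j : Fin (n + 1)) :
    pd a (fun y => conformal f G y i j) z =
      (f z ^ 2)⁻¹ * (pd a (fun y => G y i j) z + 2 * dlog f a z * G z i j) := by
  simp only [conformal]
  rw [pd_mul ((hf.fun_pow 2).fun_inv (pow_ne_zero 2 h0)) (h.diff i j),
    pd_inv (hf.fun_pow 2) (pow_ne_zero 2 h0)]
  have : pd a (fun y => f y ^ 2) z = 2 * f z * pd a f z := by
    rw [pd_comp (fun t => t ^ 2) (hasDerivAt_pow 2 (f z)) hf]; simp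
  rw [this, dlog]
  field_simp
  ring

/-- The factor `f²` of the inverse metric cancels the factor `f⁻²` of the derivatives, so only the
logarithmic derivative of the conformal factor remains. -/
theorem christoffel_conformal (h : RegularAt G z) (hf : DifferentiableAt ℝ f z) (h0 : f z ≠ 0)
    (k i j : Fin (n + 1)) :
    christoffel (conformal f G) k i j z = christoffel G k i j z +
      conformalDiff (G z) (fun l => dlog f l z) (raise G (dlog f) z) k i j := by
  have h1 : ∀ l, invMetric (conformal f G) z k l *
      (pd i (fun y => conformal f G y j l) z + pd j (fun y => conformal f G y i l) z
        - pd l (fun y => conformal f G y i j) z) =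
      invMetric G z k l * (pd i (fun y => G y j l) z + pd j (fun y => G y i l) z
        - pd l (fun y => G y i j) z) +
      2 * (invMetric G z k l * G z l j * dlog f i z + invMetric G z k l * G z l i * dlog f j z
        - G z i j * (invMetric G z k l * dlog f l z)) := by
    intro l
    rw [invMetric_conformal h.det_ne h0, h.pd_conformal hf h0, h.pd_conformal hf h0,
      h.pd_conformal hf h0, h.symm' j l, h.symm' i l]
    field_simp
    ring
  rw [christoffel, christoffel]
  simp only [h1, Finset.sum_add_distrib, Finset.sum_sub_distrib, ← Finset.mul_sum,
    ← Finset.sum_mul, h.inv_mul, conformalDiff, raise]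
  ring

theorem diff_christoffel (h : RegularAt G z) (k i j : Fin (n + 1)) :
    DifferentiableAt ℝ (christoffel G k i j) z := by
  unfold christoffel
  exact (DifferentiableAt.fun_sum fun l _ => (h.diff_inv k l).fun_mul
    (((h.diff_pd i j l).fun_add (h.diff_pd j i l)).fun_sub (h.diff_pd l i j))).const_mul _

theorem sum_metric_raise (h : RegularAt G z) (φ : Fin (n + 1) → Coord n → ℝ) (m : Fin (n + 1)) :
    ∑ i, G z i m * raise G φ z i = φ m z := h.lower_raise φ m

/-- Insert `Γ + C`, with `C` the difference tensor, in the contracted curvature formula. The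
derivatives of `C` and the mixed `Γ C` terms combine to the covariant derivative and the divergence
of `dlog f`; the `C C` terms are algebraic. -/
theorem ricci_conformal (h : RegularAt G z) (hf : ContDiffAt ℝ 2 f z) (h0 : f z ≠ 0)
    (j m : Fin (n + 1)) :
    ricci (conformal f G) j m z = ricci G j m z
      + (1 - (n : ℝ)) * (pd j (dlog f m) z - ∑ k, christoffel G k j m z * dlog f k z)
      - divergence G (raise G (dlog f)) z * G z j m
      + ((n : ℝ) - 1) * (dlog f j z * dlog f m z
        - (∑ p, dlog f p z * raise G (dlog f) z p) * G z j m) := by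
  have hd := hf.differentiableAt (by norm_num)
  have hφ := diff_dlog hf h0
  have hsymφ : ∀ a b, pd a (dlog f b) z = pd b (dlog f a) z := fun a b => by
    rw [pd_dlog hf h0, pd_dlog hf h0, pd_comm hf a b]; ring
  have hfne : ∀ᶠ y in 𝓝 z, f y ≠ 0 := hf.continuousAt.eventually_ne h0
  have hfd : ∀ᶠ y in 𝓝 z, DifferentiableAt ℝ f y := by
    filter_upwards [hf.eventually (by simp)] with y hy using hy.differentiableAt (by norm_num)
  have hΓ : ∀ k i l, christoffel (conformal f G) k i l =ᶠ[𝓝 z] fun y => christoffel G k i l y +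
      conformalDiff (G y) (fun l => dlog f l y) (raise G (dlog f) y) k i l := by
    intro k i l
    filter_upwards [h.eventually, hfne, hfd] with y h1 h2 h3
    exact h1.christoffel_conformal h3 h2 k i l
  have t1 : ∀ i, pd i (christoffel (conformal f G) i j m) z =
      pd i (christoffel G i j m) z + ((if i = j then 1 else 0) * pd i (dlog f m) z +
      (if i = m then 1 else 0) * pd i (dlog f j) z -
      (pd i (fun y => G y j m) z * raise G (dlog f) z i +
        G z j m * pd i (fun y => raise G (dlog f) y i) z)) := by
    intro i
    rw [pd_congr (hΓ i j m)]
    simp only [conformalDiff]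
    have d1 := (hφ m).const_mul (if i = j then (1 : ℝ) else 0)
    have d2 := (hφ j).const_mul (if i = m then (1 : ℝ) else 0)
    have d3 := (h.diff j m).fun_mul (h.diff_raise hφ i)
    rw [pd_add (h.diff_christoffel i j m) ((d1.fun_add d2).fun_sub d3), pd_sub (d1.fun_add d2) d3,
      pd_add d1 d2, pd_const_mul (hφ m), pd_const_mul (hφ j),
      pd_mul (h.diff j m) (h.diff_raise hφ i)]
  -- Trace first and differentiate afterwards: near `z` the trace of `C` is `(n+1) dlog f`, so no
  -- derivative of the raised covector appears here.
  have t2 : ∑ i, pd j (christoffel (conformal f G) i i m) z =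
      ∑ i, pd j (christoffel G i i m) z + ((n : ℝ) + 1) * pd j (dlog f m) z := by
    have e1 : ∀ i, DifferentiableAt ℝ (christoffel (conformal f G) i i m) z := by
      intro i
      refine DifferentiableAt.congr_of_eventuallyEq ?_ (hΓ i i m)
      simp only [conformalDiff]
      exact (h.diff_christoffel i i m).fun_add ((((hφ m).const_mul _).fun_add
        ((hφ i).const_mul _)).fun_sub ((h.diff i m).fun_mul (h.diff_raise hφ i)))
    rw [← pd_sum _ fun i _ => e1 i, ← pd_sum _ fun i _ => h.diff_christoffel i i m,
      ← pd_const_mul (hφ m), ← pd_add (DifferentiableAt.fun_sum fun i _ => h.diff_christoffel i i m)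
      ((hφ m).const_mul _)]
    refine pd_congr ?_ j
    filter_upwards [h.eventually, hfne, hfd] with y h1 h2 h3
    simp only [h1.christoffel_conformal h3 h2, Finset.sum_add_distrib]
    rw [trace_conformalDiff (h1.sum_metric_raise (dlog f))]
  have hc := fun k i l => h.christoffel_conformal hd h0 k i l
  have hv := h.sum_metric_raise (dlog f)
  have s1 : ∑ i, pd i (christoffel (conformal f G) i j m) z =
      ∑ i, pd i (christoffel G i j m) z + (pd j (dlog f m) z + pd m (dlog f j) z
        - ∑ i, pd i (fun y => G y j m) z * raise G (dlog f) z i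
        - G z j m * ∑ i, pd i (fun y => raise G (dlog f) y i) z) := by
    simp only [t1, Finset.sum_add_distrib, Finset.sum_sub_distrib, Finset.mul_sum]
    simp
    ring
  have q1 : ∑ p, (∑ i, christoffel (conformal f G) i i p z) *
      christoffel (conformal f G) p j m z =
      ∑ p, (∑ i, christoffel G i i p z) * christoffel G p j m z
      + ((∑ i, christoffel G i i j z) * dlog f m z + (∑ i, christoffel G i i m z) * dlog f j z
        - G z j m * ∑ p, (∑ i, christoffel G i i p z) * raise G (dlog f) z p)
      + ((n : ℝ) + 1) * (∑ p, christoffel G p j m z * dlog f p z)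
      + ((n : ℝ) + 1) * (2 * (dlog f j z * dlog f m z)
        - G z j m * ∑ p, dlog f p z * raise G (dlog f) z p) := by
    have e1 : ∀ p, (∑ i, christoffel (conformal f G) i i p z) *
        christoffel (conformal f G) p j m z =
        (∑ i, christoffel G i i p z) * christoffel G p j m z + (∑ i, christoffel G i i p z) *
          conformalDiff (G z) (fun l => dlog f l z) (raise G (dlog f) z) p j m
        + ((n : ℝ) + 1) * (christoffel G p j m z * dlog f p z)
        + ((n : ℝ) + 1) * (dlog f p z *
          conformalDiff (G z) (fun l => dlog f l z) (raise G (dlog f) z) p j m) := by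
      intro p
      simp only [hc, Finset.sum_add_distrib]
      rw [trace_conformalDiff hv]
      ring
    simp only [e1, Finset.sum_add_distrib, ← Finset.mul_sum, sum_mul_conformalDiff]
    ring
  have q2 : ∑ i, ∑ p, christoffel (conformal f G) i j p z *
      christoffel (conformal f G) p i m z =
      ∑ i, ∑ p, christoffel G i j p z * christoffel G p i m z
      + (∑ i, christoffel G i i j z) * dlog f m z + (∑ i, christoffel G i i m z) * dlog f j z
      + 2 * ∑ p, christoffel G p j m z * dlog f p z
      - ∑ i, pd i (fun y => G y j m) z * raise G (dlog f) z i
      + (((n : ℝ) + 3) * (dlog f j z * dlog f m z) -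
        2 * (G z j m * ∑ p, dlog f p z * raise G (dlog f) z p)) := by
    have e1 : ∀ i p, christoffel (conformal f G) i j p z *
        christoffel (conformal f G) p i m z =
        christoffel G i j p z * christoffel G p i m z + christoffel G i j p z *
          conformalDiff (G z) (fun l => dlog f l z) (raise G (dlog f) z) p i m +
        conformalDiff (G z) (fun l => dlog f l z) (raise G (dlog f) z) i j p *
          christoffel G p i m z +
        conformalDiff (G z) (fun l => dlog f l z) (raise G (dlog f) z) i j p *
        conformalDiff (G z) (fun l => dlog f l z) (raise G (dlog f) z) p i m := by
      intro i p
      rw [hc, hc]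
      ring
    have e2 : ∀ i, ∑ p, christoffel G i j p z *
          conformalDiff (G z) (fun l => dlog f l z) (raise G (dlog f) z) p i m =
        christoffel G i i j z * dlog f m z + christoffel G i j m z * dlog f i z -
          ∑ p, G z i m * christoffel G i p j z * raise G (dlog f) z p := by
      intro i
      rw [sum_mul_conformalDiff (fun p => christoffel G i j p z), h.christoffel_symm i j i,
        Finset.mul_sum]
      congr 1
      exact Finset.sum_congr rfl fun p _ => by rw [h.christoffel_symm i j p]; ring
    -- Metric compatibility splits this derivative of `G` into exactly the two mixed sums left over
    -- by the cross terms.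
    have e3 : ∑ i, pd i (fun y => G y j m) z * raise G (dlog f) z i =
        ∑ i, ∑ p, G z i m * christoffel G i p j z * raise G (dlog f) z p +
        ∑ i, ∑ p, raise G (dlog f) z i * (G z j p * christoffel G p i m z) := by
      rw [Finset.sum_comm, ← Finset.sum_add_distrib]
      refine Finset.sum_congr rfl fun i _ => ?_
      rw [h.pd_metric, Finset.sum_mul, ← Finset.sum_add_distrib]
      exact Finset.sum_congr rfl fun p _ => by ring
    simp only [e1, Finset.sum_add_distrib, sum_conformalDiff_mul_self h.symm' hv]
    rw [sum_conformalDiff_mul (fun p i => christoffel G p i m z), e3]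
    simp only [e2, Finset.sum_add_distrib, Finset.sum_sub_distrib, ← Finset.sum_mul]
    have e4 : ∑ p, dlog f p z * christoffel G p j m z =
        ∑ p, christoffel G p j m z * dlog f p z :=
      Finset.sum_congr rfl fun p _ => mul_comm _ _
    rw [e4]
    ring
  have hdiv : divergence G (raise G (dlog f)) z =
      ∑ i, pd i (fun y => raise G (dlog f) y i) z +
        ∑ p, (∑ i, christoffel G i i p z) * raise G (dlog f) z p := by
    simp only [divergence, Finset.sum_add_distrib, Finset.sum_mul]
    rw [Finset.sum_comm (f := fun i k => christoffel G i i k z * raise G (dlog f) z k)]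
  rw [ricci_eq, ricci_eq, t2, s1, q1, q2, hdiv, hsymφ m j]
  ring

theorem divergence_raise_dlog (h : RegularAt G z) (hf : ContDiffAt ℝ 2 f z) (h0 : f z ≠ 0) :
    divergence G (raise G (dlog f)) z =
      (f z)⁻¹ ^ 2 * sqNorm G f z - (f z)⁻¹ * laplacian G f z := by
  refine (h.divergence_raise (diff_dlog hf h0)).trans ?_
  simp only [sqNorm, innerD, laplacian, hess, Finset.mul_sum, ← Finset.sum_sub_distrib]
  refine Finset.sum_congr rfl fun i _ => Finset.sum_congr rfl fun j _ => ?_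
  have : ∑ k, christoffel G k i j z * dlog f k z =
      -((f z)⁻¹ * ∑ k, christoffel G k i j z * pd k f z) := by
    rw [Finset.mul_sum, ← Finset.sum_neg_distrib]
    exact Finset.sum_congr rfl fun k _ => by rw [dlog]; ring
  rw [this, pd_dlog hf h0]
  ring

theorem sum_dlog_mul_raise : ∑ p, dlog f p z * raise G (dlog f) z p =
    (f z)⁻¹ ^ 2 * sqNorm G f z := by
  simp only [sqNorm, innerD, raise, dlog, Finset.mul_sum]
  exact Finset.sum_congr rfl fun i _ => Finset.sum_congr rfl fun j _ => by ring

/-- The scalar curvature of the conformal metric `f⁻² G`. -/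
theorem scalarCurv_conformal (h : RegularAt G z) (hf : ContDiffAt ℝ 2 f z) (h0 : f z ≠ 0) :
    scalarCurv (conformal f G) z = f z ^ 2 * scalarCurv G z + 2 * n * f z * laplacian G f z
      - n * ((n : ℝ) + 1) * sqNorm G f z := by
  have e1 : ∑ i, ∑ j, invMetric G z i j * (pd i (dlog f j) z -
      ∑ k, christoffel G k i j z * dlog f k z) =
      (f z)⁻¹ ^ 2 * sqNorm G f z - (f z)⁻¹ * laplacian G f z := by
    rw [← h.divergence_raise_dlog hf h0]
    exact (h.divergence_raise (diff_dlog hf h0)).symm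
  have e2 : ∑ i, ∑ j, invMetric G z i j * (dlog f i z * dlog f j z) =
      (f z)⁻¹ ^ 2 * sqNorm G f z := by
    simp only [sqNorm, innerD, dlog, Finset.mul_sum]
    exact Finset.sum_congr rfl fun i _ => Finset.sum_congr rfl fun j _ => by ring
  have e3 : ∀ j m, invMetric (conformal f G) z j m * ricci (conformal f G) j m z =
      f z ^ 2 * (invMetric G z j m * ricci G j m z) +
      f z ^ 2 * (1 - (n : ℝ)) * (invMetric G z j m * (pd j (dlog f m) z -
        ∑ k, christoffel G k j m z * dlog f k z)) +
      f z ^ 2 * ((n : ℝ) - 1) * (invMetric G z j m * (dlog f j z * dlog f m z)) -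
      f z ^ 2 * ((f z)⁻¹ ^ 2 * sqNorm G f z - (f z)⁻¹ * laplacian G f z +
        ((n : ℝ) - 1) * ((f z)⁻¹ ^ 2 * sqNorm G f z)) * (invMetric G z j m * G z j m) := by
    intro j m
    rw [invMetric_conformal h.det_ne h0, h.ricci_conformal hf h0,
      h.divergence_raise_dlog hf h0, sum_dlog_mul_raise]
    ring
  rw [scalarCurv_eq, scalarCurv_eq]
  simp only [e3, Finset.sum_add_distrib, Finset.sum_sub_distrib, ← Finset.mul_sum]
  rw [e1, e2, h.sum_inv_mul_metric]
  field_simp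
  ring

end RegularAt

/-! ### Curvature depends only on the germ of the metric -/

section Germs

variable {G G' : MatField n} {z : Coord n}

theorem invMetric_congr (h : G z = G' z) : invMetric G z = invMetric G' z := by
  funext i j; rw [invMetric, invMetric, h]

theorem christoffel_congr (h : G =ᶠ[𝓝 z] G') (k i j : Fin (n + 1)) :
    christoffel G k i j z = christoffel G' k i j z := by
  have h1 : ∀ a b, (fun y => G y a b) =ᶠ[𝓝 z] fun y => G' y a b := fun a b => by
    filter_upwards [h] with y hy using by rw [hy]
  simp only [christoffel, invMetric_congr h.self_of_nhds, fun a b c => pd_congr (h1 a b) c]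

theorem scalarCurv_congr (h : G =ᶠ[𝓝 z] G') : scalarCurv G z = scalarCurv G' z := by
  have h1 : ∀ k i j, christoffel G k i j =ᶠ[𝓝 z] christoffel G' k i j := fun k i j => by
    filter_upwards [h.eventuallyEq_nhds] with y hy using christoffel_congr hy k i j
  simp only [scalarCurv, riemOp, curvature, invMetric_congr h.self_of_nhds,
    christoffel_congr h, fun k i j a => pd_congr (h1 k i j) a]

end Germs

/-! ### Uniform Hölder bounds for families of functions -/

/-- Bounded convex open sets. -/
structure NiceDomain (Ω : Set (Coord n)) : Prop where
  isOpen : IsOpen Ω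
  convex : Convex ℝ Ω
  isBounded : Bornology.IsBounded Ω

/-- A family of functions is uniformly bounded on `Ω`. -/
def UBound {ι : Type*} (Ω : Set (Coord n)) (U : ι → Coord n → ℝ) : Prop :=
  ∃ C : ℝ, ∀ p, ∀ x ∈ Ω, |U p x| ≤ C

/-- A family of functions is uniformly bounded in `C^{j,α}(Ω)`, in terms of iterated partial
derivatives. -/
def UB {ι : Type*} (Ω : Set (Coord n)) (α : ℝ) : ℕ → (ι → Coord n → ℝ) → Prop
  | 0, U => (∀ p, ContinuousOn (U p) Ω) ∧ UBound Ω U ∧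
      ∃ C : ℝ, ∀ p, ∀ x ∈ Ω, ∀ y ∈ Ω, |U p x - U p y| ≤ C * ‖x - y‖ ^ α
  | j + 1, U => (∀ p, DifferentiableOn ℝ (U p) Ω) ∧ UBound Ω U ∧ ∀ i, UB Ω α j fun p => pd i (U p)

section UniformBounds

variable {ι : Type*} {Ω : Set (Coord n)} {α : ℝ} {U V : ι → Coord n → ℝ}

theorem UBound.exists_pos (h : UBound Ω U) : ∃ C : ℝ, 0 < C ∧ ∀ p, ∀ x ∈ Ω, |U p x| ≤ C := by
  obtain ⟨C, hC⟩ := h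
  exact ⟨|C| + 1, by positivity, fun p x hx => (hC p x hx).trans (by linarith [le_abs_self C])⟩

theorem UBound.congr (h : UBound Ω U) (he : ∀ p, EqOn (U p) (V p) Ω) : UBound Ω V := by
  obtain ⟨C, hC⟩ := h
  exact ⟨C, fun p x hx => by rw [← he p hx]; exact hC p x hx⟩

theorem UBound.add (hU : UBound Ω U) (hV : UBound Ω V) : UBound Ω fun p x => U p x + V p x := by
  obtain ⟨C, hC⟩ := hU
  obtain ⟨D, hD⟩ := hV
  exact ⟨C + D, fun p x hx => (abs_add_le _ _).trans (add_le_add (hC p x hx) (hD p x hx))⟩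

theorem UBound.mul (hU : UBound Ω U) (hV : UBound Ω V) : UBound Ω fun p x => U p x * V p x := by
  obtain ⟨C, h0, hC⟩ := hU.exists_pos
  obtain ⟨D, hD⟩ := hV
  exact ⟨C * D, fun p x hx => by
    rw [abs_mul]
    exact mul_le_mul (hC p x hx) (hD p x hx) (abs_nonneg _) h0.le⟩

theorem UBound.const {c : ι → ℝ} {C : ℝ} (hc : ∀ p, |c p| ≤ C) :
    UBound Ω fun p (_ : Coord n) => c p :=
  ⟨C, fun p _ _ => hc p⟩

theorem UBound.inv {c : ℝ} (hc : 0 < c) (hU : ∀ p, ∀ x ∈ Ω, c ≤ |U p x|) :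
    UBound Ω fun p x => (U p x)⁻¹ :=
  ⟨c⁻¹, fun p x hx => by rw [abs_inv]; exact inv_anti₀ hc (hU p x hx)⟩

theorem pd_eqOn (ho : IsOpen Ω) {f g : Coord n → ℝ} (h : EqOn f g Ω) (i : Fin (n + 1)) :
    EqOn (pd i f) (pd i g) Ω := fun _ hx =>
  pd_congr (h.eventuallyEq_of_mem (ho.mem_nhds hx)) i

theorem UB.congr (ho : IsOpen Ω) {j : ℕ} (h : UB Ω α j U) (he : ∀ p, EqOn (U p) (V p) Ω) :
    UB Ω α j V := by
  induction j generalizing U V with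
  | zero =>
    obtain ⟨h1, h2, C, h3⟩ := h
    refine ⟨fun p => (h1 p).congr (he p).symm, h2.congr he, C, fun p x hx y hy => ?_⟩
    rw [← he p hx, ← he p hy]
    exact h3 p x hx y hy
  | succ j ih =>
    obtain ⟨h1, h2, h3⟩ := h
    exact ⟨fun p => (h1 p).congr fun x hx => (he p hx).symm, h2.congr he,
      fun i => ih (h3 i) fun p => pd_eqOn ho (he p) i⟩

theorem UB.bound {j : ℕ} (h : UB Ω α j U) : UBound Ω U := by
  cases j with
  | zero => exact h.2.1
  | succ j => exact h.2.1

theorem UB.pd {j : ℕ} (h : UB Ω α (j + 1) U) (i : Fin (n + 1)) :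
    UB Ω α j fun p => pd i (U p) := h.2.2 i

theorem fderiv_apply_eq_sum (f : Coord n → ℝ) (x v : Coord n) :
    fderiv ℝ f x v = ∑ i, v i * pd i f x := by
  have hv : v = ∑ i, v i • EuclideanSpace.single i (1 : ℝ) := by
    ext j
    simp [Pi.single_apply]
  conv_lhs => rw [hv]
  simp [map_sum, pd]

theorem norm_fderiv_le (f : Coord n → ℝ) (x : Coord n) : ‖fderiv ℝ f x‖ ≤ ∑ i, |pd i f x| := by
  refine ContinuousLinearMap.opNorm_le_bound _ (Finset.sum_nonneg fun _ _ => abs_nonneg _) ?_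
  intro v
  rw [fderiv_apply_eq_sum, Finset.sum_mul]
  refine (norm_sum_le _ _).trans (Finset.sum_le_sum fun i _ => ?_)
  rw [norm_mul, mul_comm]
  exact mul_le_mul_of_nonneg_left (PiLp.norm_apply_le v i) (abs_nonneg _)

/-- Uniform Lipschitz bounds from uniform bounds of the partial derivatives. -/
theorem exists_lipschitz (hΩ : NiceDomain Ω) (hd : ∀ p, DifferentiableOn ℝ (U p) Ω)
    (hb : ∀ i, UBound Ω fun p => pd i (U p)) :
    ∃ C : ℝ, 0 ≤ C ∧ ∀ p, ∀ x ∈ Ω, ∀ y ∈ Ω, |U p x - U p y| ≤ C * ‖x - y‖ := by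
  choose C hC0 hC using fun i => (hb i).exists_pos
  refine ⟨∑ i, C i, Finset.sum_nonneg fun i _ => (hC0 i).le, fun p x hx y hy => ?_⟩
  refine hΩ.convex.norm_image_sub_le_of_norm_fderiv_le (𝕜 := ℝ) (f := U p)
    (fun w hw => (hd p).differentiableAt (hΩ.isOpen.mem_nhds hw)) (fun w hw => ?_) hy hx
  exact (norm_fderiv_le _ _).trans (Finset.sum_le_sum fun i _ => hC i p w hw)

/-- A Lipschitz function on a bounded set is `α`-Hölder for `α ≤ 1`; the excess `‖x - y‖^(1-α)` is
bounded by a power of the diameter. -/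
theorem UB.zero_of_ubound_pd (hΩ : NiceDomain Ω) (hα : α ≤ 1)
    (h1 : ∀ p, DifferentiableOn ℝ (U p) Ω) (h2 : UBound Ω U)
    (h3 : ∀ i, UBound Ω fun p => AH.pd i (U p)) : UB Ω α 0 U := by
  refine ⟨fun p => (h1 p).continuousOn, h2, ?_⟩
  obtain ⟨C, hC0, hC⟩ := exists_lipschitz hΩ h1 h3
  obtain ⟨R, hR⟩ := hΩ.isBounded.exists_norm_le
  refine ⟨C * (2 * |R|) ^ (1 - α), fun p x hx y hy => ?_⟩
  rcases eq_or_ne x y with rfl | hne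
  · simp only [sub_self, abs_zero]
    positivity
  refine (hC p x hx y hy).trans ?_
  have hpos : 0 < ‖x - y‖ := norm_pos_iff.2 (sub_ne_zero.2 hne)
  have h2R : ‖x - y‖ ≤ 2 * |R| := by
    have := norm_sub_le x y
    linarith [hR x hx, hR y hy, le_abs_self R]
  rw [mul_assoc]
  refine mul_le_mul_of_nonneg_left ?_ hC0
  calc ‖x - y‖ = ‖x - y‖ ^ (1 - α) * ‖x - y‖ ^ α := by
        rw [← Real.rpow_add hpos]; simp
    _ ≤ _ := by
        gcongr

/-- Only the bottom order has content: there the bounded first derivatives have to produce the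
Hölder seminorm. -/
theorem UB.of_succ (hΩ : NiceDomain Ω) (hα : α ≤ 1) {j : ℕ}
    (h : UB Ω α (j + 1) U) : UB Ω α j U := by
  induction j generalizing U with
  | zero => exact UB.zero_of_ubound_pd hΩ hα h.1 h.2.1 fun i => (h.2.2 i).bound
  | succ j ih => exact ⟨h.1, h.2.1, fun i => ih (h.2.2 i)⟩

theorem UB.const {c : ι → ℝ} {C : ℝ} (hc : ∀ p, |c p| ≤ C) (j : ℕ) :
    UB Ω α j fun p (_ : Coord n) => c p := by
  induction j generalizing c C with
  | zero =>
    refine ⟨fun p => continuousOn_const, UBound.const hc, 0, fun p x _ y _ => ?_⟩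
    simp
  | succ j ih =>
    refine ⟨fun p => differentiableOn_const _, UBound.const hc, fun i => ?_⟩
    have : (fun p => AH.pd i (fun _ : Coord n => c p)) = fun (p : ι) (_ : Coord n) => (0 : ℝ) := by
      funext p x
      exact pd_const i _
    rw [this]
    exact ih (c := fun _ => 0) (C := 0) (by simp)

theorem UB.fixed_const (c : ℝ) (j : ℕ) : UB Ω α j fun (_ : ι) (_ : Coord n) => c :=
  UB.const (fun _ => le_rfl) j

theorem UB.add (ho : IsOpen Ω) {j : ℕ} (hU : UB Ω α j U) (hV : UB Ω α j V) :
    UB Ω α j fun p x => U p x + V p x := by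
  induction j generalizing U V with
  | zero =>
    obtain ⟨h1, h2, C, h3⟩ := hU
    obtain ⟨k1, k2, D, k3⟩ := hV
    refine ⟨fun p => (h1 p).add (k1 p), h2.add k2, C + D, fun p x hx y hy => ?_⟩
    calc |U p x + V p x - (U p y + V p y)| = |(U p x - U p y) + (V p x - V p y)| := by ring_nf
      _ ≤ _ := (abs_add_le _ _).trans (add_le_add (h3 p x hx y hy) (k3 p x hx y hy))
      _ = _ := by ring
  | succ j ih =>
    obtain ⟨h1, h2, h3⟩ := hU
    obtain ⟨k1, k2, k3⟩ := hV
    refine ⟨fun p => (h1 p).fun_add (k1 p), h2.add k2, fun i => ?_⟩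
    refine (ih (h3 i) (k3 i)).congr ho fun p x hx => ?_
    exact (pd_add ((h1 p).differentiableAt (ho.mem_nhds hx))
      ((k1 p).differentiableAt (ho.mem_nhds hx)) i).symm

/-- Induction by the Leibniz rule; the undifferentiated factors are needed in one order less, which
`UB.of_succ` supplies. -/
theorem UB.mul (hΩ : NiceDomain Ω) (hα : α ≤ 1) {j : ℕ} (hU : UB Ω α j U)
    (hV : UB Ω α j V) : UB Ω α j fun p x => U p x * V p x := by
  induction j generalizing U V with
  | zero =>
    obtain ⟨C', hC0', hC'⟩ := hU.bound.exists_pos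
    obtain ⟨D', hD0', hD'⟩ := hV.bound.exists_pos
    obtain ⟨h1, h2, C, h3⟩ := hU
    obtain ⟨k1, k2, D, k3⟩ := hV
    refine ⟨fun p => (h1 p).mul (k1 p), h2.mul k2, C' * D + D' * C, fun p x hx y hy => ?_⟩
    calc |U p x * V p x - U p y * V p y|
        = |U p x * (V p x - V p y) + V p y * (U p x - U p y)| := by ring_nf
      _ ≤ |U p x| * |V p x - V p y| + |V p y| * |U p x - U p y| := by
          rw [← abs_mul, ← abs_mul]; exact abs_add_le _ _
      _ ≤ C' * (D * ‖x - y‖ ^ α) + D' * (C * ‖x - y‖ ^ α) := by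
          gcongr
          · exact hC' p x hx
          · exact k3 p x hx y hy
          · exact hD' p y hy
          · exact h3 p x hx y hy
      _ = _ := by ring
  | succ j ih =>
    have hU' := hU.of_succ hΩ hα
    have hV' := hV.of_succ hΩ hα
    obtain ⟨h1, h2, h3⟩ := hU
    obtain ⟨k1, k2, k3⟩ := hV
    refine ⟨fun p => (h1 p).fun_mul (k1 p), h2.mul k2, fun i => ?_⟩
    refine ((ih (h3 i) hV').add hΩ.isOpen (ih hU' (k3 i))).congr hΩ.isOpen fun p x hx => ?_
    exact (pd_mul ((h1 p).differentiableAt (hΩ.isOpen.mem_nhds hx))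
      ((k1 p).differentiableAt (hΩ.isOpen.mem_nhds hx)) i).symm

theorem UB.const_mul (hΩ : NiceDomain Ω) (hα : α ≤ 1) {j : ℕ} (c : ℝ)
    (hU : UB Ω α j U) : UB Ω α j fun p x => c * U p x :=
  (UB.fixed_const c j).mul hΩ hα hU

theorem UB.neg (hΩ : NiceDomain Ω) (hα : α ≤ 1) {j : ℕ}
    (hU : UB Ω α j U) : UB Ω α j fun p x => -U p x := by
  simpa using hU.const_mul hΩ hα (-1)

/-- Induction on the order through `∂(1/U) = -∂U · (1/U)²`, where `1/U` is already bounded in one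
order less. -/
theorem UB.inv (hΩ : NiceDomain Ω) (hα : α ≤ 1) {j : ℕ} (hU : UB Ω α j U)
    {c : ℝ} (hc : 0 < c) (hUc : ∀ p, ∀ x ∈ Ω, c ≤ |U p x|) :
    UB Ω α j fun p x => (U p x)⁻¹ := by
  have hne : ∀ p, ∀ x ∈ Ω, U p x ≠ 0 := fun p x hx => abs_pos.1 (hc.trans_le (hUc p x hx))
  induction j with
  | zero =>
    obtain ⟨h1, h2, C, h3⟩ := hU
    refine ⟨fun p => (h1 p).inv₀ (hne p), UBound.inv hc hUc, c⁻¹ * c⁻¹ * C,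
      fun p x hx y hy => ?_⟩
    have : (U p x)⁻¹ - (U p y)⁻¹ = (U p x)⁻¹ * (U p y)⁻¹ * (U p y - U p x) := by
      field_simp [hne p x hx, hne p y hy]
    rw [this, abs_mul, abs_mul, abs_inv, abs_inv, abs_sub_comm, mul_assoc _ C]
    have e1 := inv_anti₀ hc (hUc p x hx)
    have e2 := inv_anti₀ hc (hUc p y hy)
    gcongr
    exact h3 p x hx y hy
  | succ j ih =>
    have hI := ih (hU.of_succ hΩ hα)
    obtain ⟨h1, h2, h3⟩ := hU
    refine ⟨fun p => (h1 p).fun_inv (hne p), UBound.inv hc hUc, fun i => ?_⟩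
    refine (((h3 i).neg hΩ hα).mul hΩ hα
      (hI.mul hΩ hα hI)).congr hΩ.isOpen fun p x hx => ?_
    rw [pd_inv ((h1 p).differentiableAt (hΩ.isOpen.mem_nhds hx)) (hne p x hx)]
    ring

theorem UB.coord (hΩ : NiceDomain Ω) (i : Fin (n + 1)) (j : ℕ) :
    UB Ω α (j + 1) fun (_ : ι) (x : Coord n) => x i := by
  refine ⟨fun p => (EuclideanSpace.proj (𝕜 := ℝ) i).differentiableOn, ?_, fun a => ?_⟩
  · obtain ⟨R, hR⟩ := hΩ.isBounded.exists_norm_le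
    exact ⟨R, fun p x hx => (PiLp.norm_apply_le x i).trans (hR x hx)⟩
  · refine (UB.fixed_const (if a = i then 1 else 0) j).congr hΩ.isOpen fun p x _ => ?_
    exact (pd_coord a i).symm

end UniformBounds

/-! ### Comparison with `HolderBound` -/

section Comparison

variable {Ω : Set (Coord n)} {α : ℝ} {V W : Type*} [NormedAddCommGroup V] [NormedSpace ℝ V]
  [NormedAddCommGroup W] [NormedSpace ℝ W]

theorem HolderBound.mono_const {j : ℕ} {C D : ℝ} {f : Coord n → V} (h : HolderBound j α C Ω f)
    (hCD : C ≤ D) : HolderBound j α D Ω f :=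
  ⟨h.contDiffOn, fun i hi x hx => (h.norm_le i hi x hx).trans hCD, fun x hx y hy =>
    (h.holder x hx y hy).trans (mul_le_mul_of_nonneg_right hCD (by positivity))⟩

theorem HolderBound.clm_comp (ho : IsOpen Ω) {j : ℕ} {C : ℝ} {f : Coord n → V}
    (h : HolderBound j α C Ω f) (L : V →L[ℝ] W) :
    HolderBound j α (‖L‖ * C) Ω fun x => L (f x) := by
  have hc : ∀ x ∈ Ω, ContDiffAt ℝ j f x := fun x hx => h.contDiffOn.contDiffAt (ho.mem_nhds hx)
  have he : ∀ x ∈ Ω, ∀ i ≤ j, iteratedFDeriv ℝ i (fun x => L (f x)) x =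
      L.compContinuousMultilinearMap (iteratedFDeriv ℝ i f x) := fun x hx i hi =>
    L.iteratedFDeriv_comp_left (hc x hx) (by exact_mod_cast hi)
  refine ⟨L.contDiff.comp_contDiffOn h.contDiffOn, fun i hi x hx => ?_, fun x hx y hy => ?_⟩
  · rw [he x hx i hi]
    exact (L.norm_compContinuousMultilinearMap_le _).trans
      (mul_le_mul_of_nonneg_left (h.norm_le i hi x hx) (norm_nonneg _))
  · rw [he x hx j le_rfl, he y hy j le_rfl]
    have : L.compContinuousMultilinearMap (iteratedFDeriv ℝ j f x) -
        L.compContinuousMultilinearMap (iteratedFDeriv ℝ j f y) =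
        L.compContinuousMultilinearMap (iteratedFDeriv ℝ j f x - iteratedFDeriv ℝ j f y) := by
      ext m; simp
    rw [this, mul_assoc]
    exact (L.norm_compContinuousMultilinearMap_le _).trans
      (mul_le_mul_of_nonneg_left (h.holder x hx y hy) (norm_nonneg _))

theorem HolderBound.add (ho : IsOpen Ω) {j : ℕ} {C D : ℝ} {f g : Coord n → V}
    (hf : HolderBound j α C Ω f) (hg : HolderBound j α D Ω g) :
    HolderBound j α (C + D) Ω fun x => f x + g x := by
  have he : ∀ x ∈ Ω, ∀ i ≤ j, iteratedFDeriv ℝ i (fun x => f x + g x) x =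
      iteratedFDeriv ℝ i f x + iteratedFDeriv ℝ i g x := fun x hx i hi => by
    have hij : (i : WithTop ℕ∞) ≤ j := by exact_mod_cast hi
    exact iteratedFDeriv_add_apply ((hf.contDiffOn.contDiffAt (ho.mem_nhds hx)).of_le hij)
      ((hg.contDiffOn.contDiffAt (ho.mem_nhds hx)).of_le hij)
  refine ⟨hf.contDiffOn.add hg.contDiffOn, fun i hi x hx => ?_, fun x hx y hy => ?_⟩
  · rw [he x hx i hi]
    exact (norm_add_le _ _).trans (add_le_add (hf.norm_le i hi x hx) (hg.norm_le i hi x hx))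
  · rw [he x hx j le_rfl, he y hy j le_rfl, add_sub_add_comm, add_mul]
    exact (norm_add_le _ _).trans (add_le_add (hf.holder x hx y hy) (hg.holder x hx y hy))

theorem HolderBound.zero (j : ℕ) : HolderBound j α 0 Ω fun _ : Coord n => (0 : V) := by
  have : ∀ i x, iteratedFDeriv ℝ i (fun _ : Coord n => (0 : V)) x = 0 := fun i x => by
    have := iteratedFDeriv_fun_zero (𝕜 := ℝ) (E := Coord n) (F := V) (n := i)
    exact congrFun this x
  exact ⟨contDiffOn_const, fun i _ x _ => by simp [this], fun x _ y _ => by simp [this]⟩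

theorem HolderBound.sum (ho : IsOpen Ω) {j : ℕ} {β : Type*} (s : Finset β) {C : β → ℝ}
    {F : β → Coord n → V} (hF : ∀ b ∈ s, HolderBound j α (C b) Ω (F b)) :
    HolderBound j α (∑ b ∈ s, C b) Ω fun x => ∑ b ∈ s, F b x := by
  classical
  induction s using Finset.induction_on with
  | empty => simpa using HolderBound.zero j
  | insert b s hb ih =>
    simp only [Finset.sum_insert hb]
    exact (hF b (Finset.mem_insert_self b s)).add ho
      (ih fun c hc => hF c (Finset.mem_insert_of_mem hc))

theorem HolderBound.congr (ho : IsOpen Ω) {j : ℕ} {C : ℝ} {f g : Coord n → V}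
    (h : HolderBound j α C Ω f) (he : EqOn f g Ω) : HolderBound j α C Ω g := by
  have hi : ∀ i, ∀ x ∈ Ω, iteratedFDeriv ℝ i f x = iteratedFDeriv ℝ i g x := fun i x hx =>
    ((he.eventuallyEq_of_mem (ho.mem_nhds hx)).iteratedFDeriv ℝ i).self_of_nhds
  refine ⟨h.contDiffOn.congr he.symm, fun i hij x hx => ?_, fun x hx y hy => ?_⟩
  · rw [← hi i x hx]; exact h.norm_le i hij x hx
  · rw [← hi j x hx, ← hi j y hy]; exact h.holder x hx y hy

theorem norm_iteratedFDeriv_succ_sub (f : Coord n → V) (j : ℕ) (x y : Coord n) :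
    ‖iteratedFDeriv ℝ (j + 1) f x - iteratedFDeriv ℝ (j + 1) f y‖ =
      ‖iteratedFDeriv ℝ j (fderiv ℝ f) x - iteratedFDeriv ℝ j (fderiv ℝ f) y‖ := by
  rw [iteratedFDeriv_succ_eq_comp_right, iteratedFDeriv_succ_eq_comp_right, ← dist_eq_norm,
    ← dist_eq_norm]
  exact LinearIsometryEquiv.dist_map _ _ _

theorem norm_iteratedFDeriv_zero_sub (f : Coord n → V) (x y : Coord n) :
    ‖iteratedFDeriv ℝ 0 f x - iteratedFDeriv ℝ 0 f y‖ = ‖f x - f y‖ := by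
  simp only [iteratedFDeriv_zero_eq_comp]
  rw [← dist_eq_norm, ← dist_eq_norm]
  exact LinearIsometryEquiv.dist_map _ _ _

theorem HolderBound.fderiv (ho : IsOpen Ω) {j : ℕ} {C : ℝ} {f : Coord n → V}
    (h : HolderBound (j + 1) α C Ω f) : HolderBound j α C Ω (fderiv ℝ f) := by
  refine ⟨((contDiffOn_succ_iff_fderiv_of_isOpen ho).1 (by exact_mod_cast h.contDiffOn)).2.2,
    fun i hi x hx => ?_, fun x hx y hy => ?_⟩
  · rw [norm_iteratedFDeriv_fderiv]
    exact h.norm_le (i + 1) (by omega) x hx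
  · have := h.holder x hx y hy
    rwa [norm_iteratedFDeriv_succ_sub] at this

theorem HolderBound.of_fderiv (ho : IsOpen Ω) {j : ℕ} {C : ℝ} {f : Coord n → V}
    (hd : DifferentiableOn ℝ f Ω) (hb : ∀ x ∈ Ω, ‖f x‖ ≤ C)
    (h : HolderBound j α C Ω (_root_.fderiv ℝ f)) : HolderBound (j + 1) α C Ω f := by
  refine ⟨?_, fun i hi x hx => ?_, fun x hx y hy => ?_⟩
  · exact_mod_cast (contDiffOn_succ_iff_fderiv_of_isOpen ho).2 ⟨hd, by simp, h.contDiffOn⟩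
  · cases i with
    | zero => simpa using hb x hx
    | succ i =>
      rw [← norm_iteratedFDeriv_fderiv]
      exact h.norm_le i (by omega) x hx
  · rw [norm_iteratedFDeriv_succ_sub]
    exact h.holder x hx y hy

variable {ι : Type*}

theorem UB.of_holderBound (ho : IsOpen Ω) {j : ℕ} {U : ι → Coord n → ℝ} {C : ℝ}
    (h : ∀ p, HolderBound j α C Ω (U p)) : UB Ω α j U := by
  induction j generalizing U C with
  | zero =>
    refine ⟨fun p => (h p).contDiffOn.continuousOn, ⟨C, fun p x hx => ?_⟩, C, fun p x hx y hy => ?_⟩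
    · simpa using (h p).norm_le 0 le_rfl x hx
    · have := (h p).holder x hx y hy
      rwa [norm_iteratedFDeriv_zero_sub, Real.norm_eq_abs] at this
  | succ j ih =>
    refine ⟨fun p => (h p).contDiffOn.differentiableOn (by simp),
      ⟨C, fun p x hx => by simpa using (h p).norm_le 0 (by omega) x hx⟩, fun i => ?_⟩
    exact ih fun p => ((h p).fderiv ho).clm_comp ho
      (ContinuousLinearMap.apply ℝ ℝ (EuclideanSpace.single i (1 : ℝ) : Coord n))

/-- The differential is a sum of the partial derivatives times fixed covectors, so its bounds can be
reassembled from theirs. -/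
theorem UB.exists_holderBound (ho : IsOpen Ω) {j : ℕ} {U : ι → Coord n → ℝ} (h : UB Ω α j U) :
    ∃ C : ℝ, ∀ p, HolderBound j α C Ω (U p) := by
  induction j generalizing U with
  | zero =>
    obtain ⟨h1, ⟨C, h2⟩, D, h3⟩ := h
    refine ⟨max C D, fun p => ⟨contDiffOn_zero.2 (h1 p), fun i hi x hx => ?_, fun x hx y hy => ?_⟩⟩
    · obtain rfl : i = 0 := by omega
      simpa using Or.inl (h2 p x hx)
    · rw [norm_iteratedFDeriv_zero_sub, Real.norm_eq_abs]
      exact (h3 p x hx y hy).trans (mul_le_mul_of_nonneg_right (le_max_right _ _) (by positivity))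
  | succ j ih =>
    obtain ⟨h1, ⟨C, h2⟩, h3⟩ := h
    choose D hD using fun i => ih (h3 i)
    let L : Fin (n + 1) → ℝ →L[ℝ] (Coord n →L[ℝ] ℝ) := fun i =>
      (ContinuousLinearMap.id ℝ ℝ).smulRight (EuclideanSpace.proj (𝕜 := ℝ) i)
    have h4 : ∀ p, HolderBound j α (∑ i, ‖L i‖ * D i) Ω (_root_.fderiv ℝ (U p)) := fun p => by
      refine (HolderBound.sum ho Finset.univ fun i _ => (hD i p).clm_comp ho (L i)).congr ho
        fun x _ => ?_
      ext v
      rw [fderiv_apply_eq_sum]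
      simp [L, mul_comm]
    refine ⟨max C (∑ i, ‖L i‖ * D i), fun p => HolderBound.of_fderiv ho (h1 p) (fun x hx => ?_)
      ((h4 p).mono_const (le_max_right _ _))⟩
    exact (h2 p x hx).trans (le_max_left _ _)

/-- The components of a family of 2-tensor fields inherit uniform Hölder bounds. -/
theorem UB.of_holderBound_matField (ho : IsOpen Ω) {j : ℕ} {U : ι → MatField n} {C : ℝ}
    (h : ∀ p, HolderBound j α C Ω (U p)) (a b : Fin (n + 1)) :
    UB Ω α j fun p x => U p x a b :=
  UB.of_holderBound ho fun p => (h p).clm_comp ho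
    ((ContinuousLinearMap.proj (R := ℝ) (φ := fun _ : Fin (n + 1) => ℝ) b).comp
      (ContinuousLinearMap.proj (R := ℝ) (φ := fun _ : Fin (n + 1) => Fin (n + 1) → ℝ) a))

theorem exists_holderBound_matField (ho : IsOpen Ω) {j : ℕ} {U : ι → MatField n}
    (h : ∀ a b, UB Ω α j fun p x => U p x a b) :
    ∃ C : ℝ, ∀ p, HolderBound j α C Ω (U p) := by
  choose D hD using fun a b => (h a b).exists_holderBound ho
  let L : Fin (n + 1) → Fin (n + 1) → ℝ →L[ℝ] (Fin (n + 1) → Fin (n + 1) → ℝ) := fun a b =>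
    (ContinuousLinearMap.id ℝ ℝ).smulRight (Pi.single a (Pi.single b 1))
  refine ⟨∑ a, ∑ b, ‖L a b‖ * D a b, fun p => ?_⟩
  refine (HolderBound.sum ho Finset.univ fun a _ => HolderBound.sum ho Finset.univ
    fun b _ => (hD a b p).clm_comp ho (L a b)).congr ho fun x _ => ?_
  funext c d
  simp [L, Finset.sum_apply, Pi.single_apply, ite_apply, Finset.sum_ite_eq]

end Comparison

/-! ### Functions with uniform bounds along a family of dilations -/

/-- A family of maps `Φ p` from `Ω` into an open set `D`, each of which is a dilation by the factor
`lam p`, where the factors are bounded. -/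
structure ScaledFamily {ι : Type*} (Φ : ι → Coord n → Coord n) (lam : ι → ℝ)
    (Ω D : Set (Coord n)) : Prop where
  nice : NiceDomain Ω
  isOpen : IsOpen D
  lam_pos : ∀ p, 0 < lam p
  lam_le : ∃ C, ∀ p, lam p ≤ C
  hasFDerivAt : ∀ p w, HasFDerivAt (Φ p) (lam p • ContinuousLinearMap.id ℝ (Coord n)) w
  mapsTo : ∀ p, MapsTo (Φ p) Ω D

/-- The function `u` on `D` is uniformly in `C^{j+1,α}` along the family `Φ`, and its partial
derivatives are uniformly in `C^{j,α}` (without a gain from the dilation factors). -/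
structure Adm {ι : Type*} (Φ : ι → Coord n → Coord n) (Ω D : Set (Coord n)) (α : ℝ) (j : ℕ)
    (u : Coord n → ℝ) : Prop where
  diff : DifferentiableOn ℝ u D
  ub : UB Ω α (j + 1) fun p w => u (Φ p w)
  ub_pd : ∀ i, UB Ω α j fun p w => pd i u (Φ p w)

section Scaled

variable {ι : Type*} {Φ : ι → Coord n → Coord n} {lam : ι → ℝ} {Ω D : Set (Coord n)} {α : ℝ}
  {j : ℕ} {u v : Coord n → ℝ}

/-- The factor `lam p` is the source of every gain: a weight `(lam p)⁻¹` is paid for by one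
background derivative. -/
theorem ScaledFamily.pd_comp (S : ScaledFamily Φ lam Ω D) (hu : DifferentiableOn ℝ u D) (p : ι)
    {w : Coord n} (hw : w ∈ Ω) (i : Fin (n + 1)) :
    pd i (fun w => u (Φ p w)) w = lam p * pd i u (Φ p w) := by
  have h := (hu.differentiableAt (S.isOpen.mem_nhds (S.mapsTo p hw))).hasFDerivAt.comp w
    (S.hasFDerivAt p w)
  have h' := h.fderiv
  simp only [pd]
  erw [h']
  simp

theorem ScaledFamily.differentiableOn_comp (S : ScaledFamily Φ lam Ω D)
    (hu : DifferentiableOn ℝ u D) (p : ι) : DifferentiableOn ℝ (fun w => u (Φ p w)) Ω :=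
  hu.comp (fun w _ => (S.hasFDerivAt p w).differentiableAt.differentiableWithinAt) (S.mapsTo p)

namespace Adm

theorem ub_self (S : ScaledFamily Φ lam Ω D) (hα : α ≤ 1) (hu : Adm Φ Ω D α j u) :
    UB Ω α j fun p w => u (Φ p w) := hu.ub.of_succ S.nice hα

theorem congr (S : ScaledFamily Φ lam Ω D) (hu : Adm Φ Ω D α j u) (h : EqOn u v D) :
    Adm Φ Ω D α j v where
  diff := hu.diff.congr h.symm
  ub := hu.ub.congr S.nice.isOpen fun p _ hw => h (S.mapsTo p hw)
  ub_pd i := (hu.ub_pd i).congr S.nice.isOpen fun p _ hw => pd_eqOn S.isOpen h i (S.mapsTo p hw)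

theorem const (c : ℝ) : Adm Φ Ω D α j fun _ => c where
  diff := differentiableOn_const c
  ub := UB.fixed_const c (j + 1)
  ub_pd i := by
    have : ∀ z, pd i (fun _ : Coord n => c) z = 0 := fun z => pd_const i c
    simpa only [this] using UB.fixed_const 0 j

theorem add (S : ScaledFamily Φ lam Ω D) (hu : Adm Φ Ω D α j u) (hv : Adm Φ Ω D α j v) :
    Adm Φ Ω D α j fun z => u z + v z where
  diff := hu.diff.fun_add hv.diff
  ub := hu.ub.add S.nice.isOpen hv.ub
  ub_pd i := ((hu.ub_pd i).add S.nice.isOpen (hv.ub_pd i)).congr S.nice.isOpen fun p w hw => by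
    have hz := S.isOpen.mem_nhds (S.mapsTo p hw)
    exact (pd_add (hu.diff.differentiableAt hz) (hv.diff.differentiableAt hz) i).symm

theorem mul (S : ScaledFamily Φ lam Ω D) (hα : α ≤ 1) (hu : Adm Φ Ω D α j u)
    (hv : Adm Φ Ω D α j v) : Adm Φ Ω D α j fun z => u z * v z where
  diff := hu.diff.fun_mul hv.diff
  ub := hu.ub.mul S.nice hα hv.ub
  ub_pd i := (((hu.ub_pd i).mul S.nice hα (hv.ub_self S hα)).add S.nice.isOpen
    ((hu.ub_self S hα).mul S.nice hα (hv.ub_pd i))).congr S.nice.isOpen fun p w hw => by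
    have hz := S.isOpen.mem_nhds (S.mapsTo p hw)
    exact (pd_mul (hu.diff.differentiableAt hz) (hv.diff.differentiableAt hz) i).symm

theorem neg (S : ScaledFamily Φ lam Ω D) (hα : α ≤ 1) (hu : Adm Φ Ω D α j u) :
    Adm Φ Ω D α j fun z => -u z := by
  simpa using (const (-1)).mul S hα hu

theorem sub (S : ScaledFamily Φ lam Ω D) (hα : α ≤ 1) (hu : Adm Φ Ω D α j u)
    (hv : Adm Φ Ω D α j v) : Adm Φ Ω D α j fun z => u z - v z := by
  simpa only [sub_eq_add_neg] using hu.add S (hv.neg S hα)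

theorem sum (S : ScaledFamily Φ lam Ω D) {β : Type*} (s : Finset β) {F : β → Coord n → ℝ}
    (hF : ∀ b, Adm Φ Ω D α j (F b)) : Adm Φ Ω D α j fun z => ∑ b ∈ s, F b z := by
  classical
  induction s using Finset.induction_on with
  | empty => simpa using const 0
  | insert b s hb ih =>
    simp only [Finset.sum_insert hb]
    exact (hF b).add S ih

theorem prod (S : ScaledFamily Φ lam Ω D) (hα : α ≤ 1) {β : Type*} (s : Finset β)
    {F : β → Coord n → ℝ} (hF : ∀ b, Adm Φ Ω D α j (F b)) :
    Adm Φ Ω D α j fun z => ∏ b ∈ s, F b z := by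
  classical
  induction s using Finset.induction_on with
  | empty => simpa using const 1
  | insert b s hb ih =>
    simp only [Finset.prod_insert hb]
    exact (hF b).mul S hα ih

theorem inv (S : ScaledFamily Φ lam Ω D) (hα : α ≤ 1) (hu : Adm Φ Ω D α j u)
    (h0 : ∀ z ∈ D, u z ≠ 0) {c : ℝ} (hc : 0 < c) (hcu : ∀ p, ∀ w ∈ Ω, c ≤ |u (Φ p w)|) :
    Adm Φ Ω D α j fun z => (u z)⁻¹ where
  diff := hu.diff.fun_inv h0
  ub := hu.ub.inv S.nice hα hc hcu
  ub_pd i := by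
    have h := (hu.ub_self S hα).inv S.nice hα hc hcu
    refine (((hu.ub_pd i).neg S.nice hα).mul S.nice hα (h.mul S.nice hα h)).congr S.nice.isOpen
      fun p w hw => ?_
    have hz := S.mapsTo p hw
    rw [pd_inv (hu.diff.differentiableAt (S.isOpen.mem_nhds hz)) (h0 _ hz)]
    ring

theorem det (S : ScaledFamily Φ lam Ω D) (hα : α ≤ 1) {G : MatField n}
    (hG : ∀ a b, Adm Φ Ω D α j fun z => G z a b) :
    Adm Φ Ω D α j fun z => (Matrix.of (G z)).det := by
  simp only [Matrix.det_apply']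
  exact sum S _ fun σ => (const _).mul S hα (prod S hα _ fun i => hG (σ i) i)

theorem invMetric (S : ScaledFamily Φ lam Ω D) (hα : α ≤ 1) {G : MatField n}
    (hG : ∀ a b, Adm Φ Ω D α j fun z => G z a b) (h0 : ∀ z ∈ D, (Matrix.of (G z)).det ≠ 0)
    {c : ℝ} (hc : 0 < c) (hcG : ∀ p, ∀ w ∈ Ω, c ≤ |(Matrix.of (G (Φ p w))).det|)
    (a b : Fin (n + 1)) : Adm Φ Ω D α j fun z => invMetric G z a b := by
  simp only [invMetric_eq]
  refine ((det S hα hG).inv S hα h0 hc hcG).mul S hα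
    (det S hα (G := fun y i k => if i = b then (if k = a then 1 else 0) else G y i k) ?_)
  intro i k
  by_cases hi : i = b
  · simpa [hi] using const _
  · simpa [hi] using hG i k

/-- A function that is `O(lam)` gains a full power of the dilation factors. -/
theorem ub_inv_mul (S : ScaledFamily Φ lam Ω D) (hu : Adm Φ Ω D α j u)
    (hb : UBound Ω fun p w => (lam p)⁻¹ * u (Φ p w)) :
    UB Ω α (j + 1) fun p w => (lam p)⁻¹ * u (Φ p w) := by
  refine ⟨fun p => (S.differentiableOn_comp hu.diff p).const_mul _, hb, fun i => ?_⟩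
  refine (hu.ub_pd i).congr S.nice.isOpen fun p w hw => ?_
  rw [pd_const_mul ((S.differentiableOn_comp hu.diff p).differentiableAt
    (S.nice.isOpen.mem_nhds hw)), S.pd_comp hu.diff p hw, inv_mul_cancel_left₀ (S.lam_pos p).ne']

/-- The oscillation of an admissible function is `O(lam)`. -/
theorem ubound_sub (S : ScaledFamily Φ lam Ω D) (hu : Adm Φ Ω D α j u) {c : Coord n}
    (hc : c ∈ Ω) : UBound Ω fun p w => (lam p)⁻¹ * (u (Φ p w) - u (Φ p c)) := by
  have hd : ∀ p, DifferentiableOn ℝ (fun w => (lam p)⁻¹ * u (Φ p w)) Ω := fun p =>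
    (S.differentiableOn_comp hu.diff p).const_mul _
  obtain ⟨C, hC0, hC⟩ := exists_lipschitz (U := fun p w => (lam p)⁻¹ * u (Φ p w)) S.nice hd
    fun i => (hu.ub_pd i).bound.congr fun p w hw => by
      rw [pd_const_mul ((S.differentiableOn_comp hu.diff p).differentiableAt
        (S.nice.isOpen.mem_nhds hw)), S.pd_comp hu.diff p hw,
        inv_mul_cancel_left₀ (S.lam_pos p).ne']
  obtain ⟨R, hR⟩ := S.nice.isBounded.exists_norm_le
  refine ⟨C * (R + R), fun p w hw => ?_⟩
  simp only [mul_sub]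
  refine (hC p w hw c hc).trans (mul_le_mul_of_nonneg_left ?_ hC0)
  exact (norm_sub_le _ _).trans (add_le_add (hR w hw) (hR c hc))

end Adm

/-- Interpolation: bounds for a function and its second derivatives give bounds for the first
derivatives. -/
theorem ubound_pd_of_interpolation {U : ι → Coord n → ℝ} (hΩ : NiceDomain Ω) {c : Coord n}
    (hc : c ∈ Ω) (hd : ∀ p, DifferentiableOn ℝ (U p) Ω) (b : Fin (n + 1))
    (hd' : ∀ p, DifferentiableOn ℝ (pd b (U p)) Ω) (hU : UBound Ω U)
    (h2 : ∀ a, UBound Ω fun p => pd a (pd b (U p))) : UBound Ω fun p => pd b (U p) := by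
  obtain ⟨r, hr, hrΩ⟩ := Metric.isOpen_iff.1 hΩ.isOpen c hc
  obtain ⟨C, hC0, hC⟩ := exists_lipschitz (U := fun p => pd b (U p)) hΩ hd' h2
  obtain ⟨B, hB⟩ := hU
  obtain ⟨R, hR⟩ := hΩ.isBounded.exists_norm_le
  have ht : 0 < r / 2 := by positivity
  -- The step `r / 2` stays inside the ball of radius `r` about `c`, uniformly in the family.
  have hc' : c + (r / 2) • EuclideanSpace.single b (1 : ℝ) ∈ Ω := by
    refine hrΩ ?_
    rw [Metric.mem_ball, dist_eq_norm, add_sub_cancel_left, norm_smul, PiLp.norm_single]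
    simp only [Real.norm_eq_abs, abs_of_pos ht, norm_one, mul_one]
    linarith
  refine ⟨(r / 2)⁻¹ * (B + B) + C * (R + R), fun p w hw => ?_⟩
  -- The mean value theorem yields one point where the derivative is a difference quotient, hence
  -- bounded; the second derivatives then carry the bound to all of `Ω`.
  obtain ⟨ξ, hξ, hξ'⟩ := domain_mvt (f := U p) (s := Ω) (f' := fun z => fderiv ℝ (U p) z)
    (fun z hz => ((hd p).differentiableAt (hΩ.isOpen.mem_nhds hz)).hasFDerivAt.hasFDerivWithinAt)
    hΩ.convex hc hc'
  have hξΩ : ξ ∈ Ω := hΩ.convex.segment_subset hc hc' hξ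
  have e1 : pd b (U p) ξ =
      (r / 2)⁻¹ * (U p (c + (r / 2) • EuclideanSpace.single b (1 : ℝ)) - U p c) := by
    rw [hξ', add_sub_cancel_left, map_smul, smul_eq_mul, inv_mul_cancel_left₀ ht.ne']
    rfl
  have e2 : |pd b (U p) ξ| ≤ (r / 2)⁻¹ * (B + B) := by
    rw [e1, abs_mul, abs_of_pos (inv_pos.2 ht)]
    exact mul_le_mul_of_nonneg_left ((abs_sub _ _).trans (add_le_add (hB p _ hc') (hB p _ hc)))
      (inv_pos.2 ht).le
  have e3 := (hC p w hw ξ hξΩ).trans (mul_le_mul_of_nonneg_left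
    ((norm_sub_le w ξ).trans (add_le_add (hR w hw) (hR ξ hξΩ))) hC0)
  calc |pd b (U p) w| = |pd b (U p) ξ + (pd b (U p) w - pd b (U p) ξ)| := by ring_nf
    _ ≤ _ := (abs_add_le _ _).trans (add_le_add e2 e3)

end Scaled

/-! ### Estimates for the geometry of an admissible metric -/

/-- A metric `G` and a function `f` with uniform bounds along a family of dilations. -/
structure AdmGeometry {ι : Type*} (Φ : ι → Coord n → Coord n) (lam : ι → ℝ)
    (Ω D : Set (Coord n)) (α : ℝ) (j : ℕ) (G : MatField n) (f : Coord n → ℝ) : Prop where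
  family : ScaledFamily Φ lam Ω D
  exponent : α ≤ 1
  regular : ∀ z ∈ D, RegularAt G z
  posDef : ∀ z ∈ D, (Matrix.of (G z)).PosDef
  smooth : ∀ z ∈ D, ContDiffAt ℝ 2 f z
  adm : ∀ a b, Adm Φ Ω D α j fun z => G z a b
  adm_pd : ∀ i a b, Adm Φ Ω D α j (pd i fun z => G z a b)
  adm_df : ∀ i, Adm Φ Ω D α j (pd i f)
  adm_ddf : ∀ i k, Adm Φ Ω D α j (pd i (pd k f))
  det_ge : ∃ c > 0, ∀ p, ∀ w ∈ Ω, c ≤ |(Matrix.of (G (Φ p w))).det|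

namespace AdmGeometry

variable {ι : Type*} {Φ : ι → Coord n → Coord n} {lam : ι → ℝ} {Ω D : Set (Coord n)} {α : ℝ}
  {j : ℕ} {G : MatField n} {f : Coord n → ℝ}

theorem adm_inv (A : AdmGeometry Φ lam Ω D α j G f) (a b : Fin (n + 1)) :
    Adm Φ Ω D α j fun z => invMetric G z a b := by
  obtain ⟨c, hc, hcG⟩ := A.det_ge
  exact Adm.invMetric A.family A.exponent A.adm (fun z hz => (A.regular z hz).det_ne) hc hcG a b

/-- Admissibility of a function does not pass to its derivatives; the formula for `∂G⁻¹` involves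
only `G⁻¹` and `∂G`, which are admissible. -/
theorem adm_pd_inv (A : AdmGeometry Φ lam Ω D α j G f) (i a b : Fin (n + 1)) :
    Adm Φ Ω D α j (pd i fun z => invMetric G z a b) := by
  have S := A.family
  refine Adm.congr S (u := fun z => -∑ k, ∑ l, invMetric G z a k *
    pd i (fun y => G y k l) z * invMetric G z l b) ?_ fun z hz =>
      ((A.regular z hz).pd_invMetric i a b).symm
  exact (Adm.sum S _ fun k => Adm.sum S _ fun l => ((A.adm_inv a k).mul S A.exponent
    (A.adm_pd i k l)).mul S A.exponent (A.adm_inv l b)).neg S A.exponent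

theorem adm_christoffel (A : AdmGeometry Φ lam Ω D α j G f) (k a b : Fin (n + 1)) :
    Adm Φ Ω D α j (christoffel G k a b) := by
  have S := A.family
  unfold christoffel
  exact (Adm.const _).mul S A.exponent (Adm.sum S _ fun l => (A.adm_inv k l).mul S A.exponent
    (((A.adm_pd a b l).add S (A.adm_pd b a l)).sub S A.exponent (A.adm_pd l a b)))

theorem adm_hess (A : AdmGeometry Φ lam Ω D α j G f) (a b : Fin (n + 1)) :
    Adm Φ Ω D α j fun z => hess G f z a b := by
  have S := A.family
  unfold hess
  exact (A.adm_ddf a b).sub S A.exponent (Adm.sum S _ fun k =>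
    (A.adm_christoffel k a b).mul S A.exponent (A.adm_df k))

theorem adm_laplacian (A : AdmGeometry Φ lam Ω D α j G f) : Adm Φ Ω D α j (laplacian G f) := by
  have S := A.family
  unfold laplacian
  exact Adm.sum S _ fun a => Adm.sum S _ fun b =>
    (A.adm_inv a b).mul S A.exponent (A.adm_hess a b)

theorem adm_traceFreeHess (A : AdmGeometry Φ lam Ω D α j G f) (a b : Fin (n + 1)) :
    Adm Φ Ω D α j fun z => traceFreeHess G f z a b := by
  have S := A.family
  unfold traceFreeHess
  exact (A.adm_hess a b).sub S A.exponent
    (((Adm.const _).mul S A.exponent A.adm_laplacian).mul S A.exponent (A.adm a b))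

theorem adm_sqNorm (A : AdmGeometry Φ lam Ω D α j G f) : Adm Φ Ω D α j (sqNorm G f) := by
  have S := A.family
  unfold sqNorm innerD
  exact Adm.sum S _ fun a => Adm.sum S _ fun b =>
    ((A.adm_inv a b).mul S A.exponent (A.adm_df a)).mul S A.exponent (A.adm_df b)

/-- The product rule writes `dN` in terms of `∂G⁻¹`, `df` and `∂df`. Its admissibility controls two
background derivatives of `N`, as the interpolation requires. -/
theorem adm_pd_sqNorm (A : AdmGeometry Φ lam Ω D α j G f) (i : Fin (n + 1)) :
    Adm Φ Ω D α j (pd i (sqNorm G f)) := by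
  have S := A.family
  have hα := A.exponent
  refine Adm.congr S (u := fun z => ∑ a, ∑ b,
    ((pd i (fun y => invMetric G y a b) z * pd a f z + invMetric G z a b * pd i (pd a f) z) *
      pd b f z + invMetric G z a b * pd a f z * pd i (pd b f) z)) ?_ fun z hz => ?_
  · exact Adm.sum S _ fun a => Adm.sum S _ fun b =>
      ((((A.adm_pd_inv i a b).mul S hα (A.adm_df a)).add S ((A.adm_inv a b).mul S hα
        (A.adm_ddf i a))).mul S hα (A.adm_df b)).add S (((A.adm_inv a b).mul S hα
          (A.adm_df a)).mul S hα (A.adm_ddf i b))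
  · have h := A.regular z hz
    have d := fun a => diff_pd_of_contDiffAt (A.smooth z hz) a
    have d2 := fun a b => (h.diff_inv a b).fun_mul (d a)
    have d3 := fun a b => (d2 a b).fun_mul (d b)
    have hN : sqNorm G f = fun y =>
        ∑ a, ∑ b, invMetric G y a b * pd a f y * pd b f y := rfl
    rw [hN, pd_sum _ fun a _ => DifferentiableAt.fun_sum fun b _ => d3 a b]
    refine Finset.sum_congr rfl fun a _ => ?_
    rw [pd_sum _ fun b _ => d3 a b]
    refine Finset.sum_congr rfl fun b _ => ?_
    rw [pd_mul (d2 a b) (d b), pd_mul (h.diff_inv a b) (d a)]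

theorem adm_defectW (A : AdmGeometry Φ lam Ω D α j G f) (i : Fin (n + 1)) :
    Adm Φ Ω D α j (defectW G f i) := by
  have S := A.family
  unfold defectW
  exact (A.adm_pd_sqNorm i).sub S A.exponent
    (((Adm.const _).mul S A.exponent A.adm_laplacian).mul S A.exponent (A.adm_df i))

/-- The curvature contains `∂Γ`, for which admissibility of `Γ` gives bounds. A sup bound is enough,
since this curvature enters with a factor `ρ²`. -/
theorem ubound_scalarCurv (A : AdmGeometry Φ lam Ω D α j G f) :
    UBound Ω fun p w => scalarCurv G (Φ p w) := by
  have hsum : ∀ {F : Fin (n + 1) → ι → Coord n → ℝ}, (∀ i, UBound Ω (F i)) →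
      UBound Ω fun p w => ∑ i, F i p w := by
    intro F hF
    choose C hC using hF
    exact ⟨∑ i, C i, fun p w hw => (Finset.abs_sum_le_sum_abs _ _).trans
      (Finset.sum_le_sum fun i _ => hC i p w hw)⟩
  have hneg : ∀ {F : ι → Coord n → ℝ}, UBound Ω F → UBound Ω fun p w => -F p w := by
    rintro F ⟨C, hC⟩
    exact ⟨C, fun p w hw => by rw [abs_neg]; exact hC p w hw⟩
  have hΓ := fun k a b => (A.adm_christoffel k a b).ub.bound
  have hdΓ := fun k a b i => ((A.adm_christoffel k a b).ub_pd i).bound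
  simp only [scalarCurv, riemOp, curvature, sub_eq_add_neg]
  exact hsum fun a => hsum fun b => hsum fun m => (A.adm_inv b m).ub.bound.mul
    (((hdΓ _ _ _ _).add (hneg (hdΓ _ _ _ _))).add
      (hsum fun p => ((hΓ _ _ _).mul (hΓ _ _ _)).add (hneg ((hΓ _ _ _).mul (hΓ _ _ _)))))

theorem posDef_nhds (A : AdmGeometry Φ lam Ω D α j G f) {z : Coord n} (hz : z ∈ D) :
    ∀ᶠ y in 𝓝 z, (Matrix.of (G y)).PosDef := by
  filter_upwards [A.family.isOpen.mem_nhds hz] with y hy using A.posDef y hy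

theorem adm_sqNorm_sub_one (A : AdmGeometry Φ lam Ω D α j G f) :
    Adm Φ Ω D α j fun z => sqNorm G f z - 1 :=
  A.adm_sqNorm.sub A.family A.exponent (Adm.const 1)

/-- Bounds of `𝓗_G(f)` minus the trace-free Hessian, where the weight `c` is absorbed by the
factors `|df|² - 1` and `W`. -/
theorem ub_tensorH_sub_of_weight (hn : 1 ≤ n) (A : AdmGeometry Φ lam Ω D α j G f) (c : ι → ℝ)
    (hN : UB Ω α (j + 1) fun p w => c p * (sqNorm G f (Φ p w) - 1))
    (hW : ∀ i, UB Ω α (j + 1) fun p w => c p * defectW G f i (Φ p w)) (a b : Fin (n + 1)) :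
    UB Ω α (j + 1) fun p w =>
      c p * (tensorH G f (Φ p w) a b - traceFreeHess G f (Φ p w) a b) := by
  have S := A.family
  have hα := A.exponent
  have ho := S.nice.isOpen
  have hI : UB Ω α (j + 1) fun p w =>
      ∑ i, ∑ k, invMetric G (Φ p w) i k * (c p * defectW G f i (Φ p w)) * pd k f (Φ p w) := by
    have hsum : ∀ {F : Fin (n + 1) → ι → Coord n → ℝ}, (∀ i, UB Ω α (j + 1) (F i)) →
        UB Ω α (j + 1) fun p w => ∑ i, F i p w := by
      intro F hF
      have : ∀ s : Finset (Fin (n + 1)), UB Ω α (j + 1) fun p w => ∑ i ∈ s, F i p w := by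
        intro s
        induction s using Finset.induction_on with
        | empty => simpa using UB.fixed_const 0 (j + 1)
        | insert i s hi ih =>
          simp only [Finset.sum_insert hi]
          exact (hF i).add ho ih
      exact this _
    exact hsum fun i => hsum fun k => ((A.adm_inv i k).ub.mul S.nice hα (hW i)).mul S.nice hα
      (A.adm_df k).ub
  have hT := (A.adm_sqNorm.add S (Adm.const 1)).mul S hα (A.adm_traceFreeHess a b)
  have hQ := (((Adm.const (1 / ((n : ℝ) + 1))).mul S hα A.adm_sqNorm).mul S hα (A.adm a b)).add S
    ((Adm.const (((n : ℝ) - 1) / (2 * n))).mul S hα (((A.adm_df a).mul S hα (A.adm_df b)).sub S hα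
      (((Adm.const (1 / ((n : ℝ) + 1))).mul S hα A.adm_sqNorm).mul S hα (A.adm a b))))
  have hP := ((Adm.const (-(1 / 2))).mul S hα A.adm_sqNorm).ub.mul S.nice hα
    (((hW a).mul S.nice hα (A.adm_df b).ub).add ho ((hW b).mul S.nice hα (A.adm_df a).ub))
  refine (((hN.mul S.nice hα hT.ub).add ho hP).add ho (hI.mul S.nice hα hQ.ub)).congr ho
    fun p w hw => ?_
  have hz := S.mapsTo p hw
  have e1 : ∑ i, ∑ k, invMetric G (Φ p w) i k * (c p * defectW G f i (Φ p w)) * pd k f (Φ p w) =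
      c p * innerD G (Φ p w) (fun i => defectW G f i (Φ p w)) fun k => pd k f (Φ p w) := by
    rw [← innerD_smul_left]
    rfl
  simp only
  rw [e1, tensorH_sub_traceFreeHess hn (A.regular _ hz) (A.posDef_nhds hz) (A.smooth _ hz)]
  ring

/-- The case of trivial weight, where no decay is required; it serves the regularity in the
interior. -/
theorem ub_tensorH_sub (hn : 1 ≤ n) (A : AdmGeometry Φ lam Ω D α j G f) (a b : Fin (n + 1)) :
    UB Ω α (j + 1) fun p w => tensorH G f (Φ p w) a b - traceFreeHess G f (Φ p w) a b := by
  have := A.ub_tensorH_sub_of_weight hn (fun _ => 1)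
    (by simpa using A.adm_sqNorm_sub_one.ub) (fun i => by simpa using (A.adm_defectW i).ub) a b
  simpa using this

/-! ### Decay at the boundary from the scalar curvature -/

section Boundary

variable (A : AdmGeometry Φ lam Ω D α j G f) (hn : 1 ≤ n) (hf : ∀ z ∈ D, f z = z 0)
  (hf0 : ∀ z ∈ D, f z ≠ 0) (hΦ : ∀ p w, Φ p w 0 = lam p * w 0)
  (hR : UBound Ω fun p w => (lam p)⁻¹ ^ 2 *
    (scalarCurv (conformal f G) (Φ p w) + n * ((n : ℝ) + 1)))

include A hn hf hf0 hΦ hR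

/-- Solve the conformal formula for `N`: with `ρ = lam p * w 0`, the quantity is `(w₀² R[ḡ] - lam⁻²
(R[g] + n(n+1))) / (n(n+1))`, and both terms are bounded. -/
theorem ubound_expansion : UBound Ω fun p w => (lam p)⁻¹ ^ 2 * (sqNorm G f (Φ p w) - 1
    - 2 / ((n : ℝ) + 1) * (lam p * w 0 * laplacian G f (Φ p w))) := by
  have hw : UBound Ω fun (_ : ι) (w : Coord n) => w 0 :=
    (UB.coord (α := α) A.family.nice 0 0).bound
  have h := (UBound.const (Ω := Ω) (c := fun _ : ι => (n * ((n : ℝ) + 1))⁻¹) fun _ => le_rfl).mul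
    (((hw.mul hw).mul A.ubound_scalarCurv).add
      ((UBound.const (Ω := Ω) (c := fun _ : ι => (-1 : ℝ)) fun _ => le_rfl).mul hR))
  refine h.congr fun p w hw => ?_
  have hz := A.family.mapsTo p hw
  have hn0 : (n : ℝ) ≠ 0 := by positivity
  have hn1 : (n : ℝ) + 1 ≠ 0 := by positivity
  have hl := (A.family.lam_pos p).ne'
  simp only
  rw [(A.regular _ hz).scalarCurv_conformal (A.smooth _ hz) (hf0 _ hz), hf _ hz, hΦ]
  field_simp
  ring

/-- Multiply the expansion by the bounded factor `lam p` and use that the Laplacian is bounded. -/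
theorem ubound_sqNorm_sub_one : UBound Ω fun p w => (lam p)⁻¹ * (sqNorm G f (Φ p w) - 1) := by
  have hw : UBound Ω fun (_ : ι) (w : Coord n) => w 0 :=
    (UB.coord (α := α) A.family.nice 0 0).bound
  obtain ⟨C, hC⟩ := A.family.lam_le
  have hlam : UBound Ω fun p (_ : Coord n) => lam p :=
    UBound.const fun p => by rw [abs_of_pos (A.family.lam_pos p)]; exact hC p
  have h := (hlam.mul (A.ubound_expansion hn hf hf0 hΦ hR)).add
    ((UBound.const (Ω := Ω) (c := fun _ : ι => 2 / ((n : ℝ) + 1)) fun _ => le_rfl).mul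
      (hw.mul A.adm_laplacian.ub.bound))
  refine h.congr fun p w hw => ?_
  have hl := (A.family.lam_pos p).ne'
  simp only
  field_simp
  ring

omit hn hf0 hΦ hR in
theorem pd_eq_of_coord (i : Fin (n + 1)) {z : Coord n} (hz : z ∈ D) :
    pd i f z = if i = 0 then 1 else 0 := by
  rw [← pd_coord (z := z) i 0]
  exact pd_eqOn A.family.isOpen (fun y hy => hf y hy) i hz

/-- The remainder of the expansion is only known to be bounded, so it cannot be differentiated;
interpolation against the second derivatives of `N` bounds the gradient instead. -/
theorem ubound_defectW {c : Coord n} (hc : c ∈ Ω) (b : Fin (n + 1)) :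
    UBound Ω fun p w => (lam p)⁻¹ * defectW G f b (Φ p w) := by
  have S := A.family
  have hw : UBound Ω fun (_ : ι) (w : Coord n) => w 0 :=
    (UB.coord (α := α) A.family.nice 0 0).bound
  have hosc := A.adm_laplacian.ubound_sub S hc
  -- The slope freezes the Laplacian at the image of `c`. A linear correction disappears under two
  -- derivatives, and the error of freezing is bounded by `hosc`.
  let s : ι → ℝ := fun p => 2 / ((n : ℝ) + 1) * (lam p)⁻¹ * laplacian G f (Φ p c)
  let U : ι → Coord n → ℝ := fun p w =>
    (lam p)⁻¹ ^ 2 * (sqNorm G f (Φ p w) - 1) - s p * w 0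
  have hU : UBound Ω U := by
    refine ((A.ubound_expansion hn hf hf0 hΦ hR).add
      ((UBound.const (Ω := Ω) (c := fun _ : ι => 2 / ((n : ℝ) + 1)) fun _ => le_rfl).mul
        (hw.mul hosc))).congr fun p w hw => ?_
    have hl := (S.lam_pos p).ne'
    simp only [U, s]
    field_simp
    ring
  have hdN : ∀ p, ∀ w ∈ Ω, DifferentiableAt ℝ (fun w => sqNorm G f (Φ p w) - 1) w := fun p w hw =>
    ((S.differentiableOn_comp A.adm_sqNorm_sub_one.diff p).differentiableAt
      (S.nice.isOpen.mem_nhds hw))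
  have hdc : ∀ w : Coord n, DifferentiableAt ℝ (fun w : Coord n => w 0) w := fun w =>
    (EuclideanSpace.proj (𝕜 := ℝ) (0 : Fin (n + 1))).differentiableAt
  have hdU : ∀ p, DifferentiableOn ℝ (U p) Ω := fun p w hw =>
    (((hdN p w hw).const_mul _).fun_sub ((hdc w).const_mul _)).differentiableWithinAt
  have hpd : ∀ a p, EqOn (pd a (U p)) (fun w => (lam p)⁻¹ * pd a (sqNorm G f) (Φ p w) -
      s p * (if a = 0 then 1 else 0)) Ω := by
    intro a p w hw
    have hz := S.isOpen.mem_nhds (S.mapsTo p hw)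
    simp only [U]
    rw [pd_sub ((hdN p w hw).const_mul _) ((hdc w).const_mul _), pd_const_mul (hdN p w hw),
      pd_const_mul (hdc w), pd_coord, S.pd_comp A.adm_sqNorm_sub_one.diff p hw,
      pd_sub (A.adm_sqNorm.diff.differentiableAt hz) (differentiableAt_const 1), pd_const, sub_zero,
      pow_two, mul_assoc, inv_mul_cancel_left₀ (S.lam_pos p).ne']
  have hd2 : ∀ p, DifferentiableOn ℝ (fun w => (lam p)⁻¹ * pd b (sqNorm G f) (Φ p w) -
      s p * (if b = 0 then 1 else 0)) Ω := fun p =>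
    ((S.differentiableOn_comp (A.adm_pd_sqNorm b).diff p).const_mul _).sub_const _
  -- The second derivatives of `U` are the background second derivatives of `N`: two factors `lam p`
  -- from the chain rule cancel the weight.
  have h1 := ubound_pd_of_interpolation S.nice hc hdU b
    (fun p => (hd2 p).congr (hpd b p)) hU fun a => by
      refine ((A.adm_pd_sqNorm b).ub_pd a).bound.congr fun p w hw => ?_
      have hd3 := (S.differentiableOn_comp (A.adm_pd_sqNorm b).diff p).differentiableAt
        (S.nice.isOpen.mem_nhds hw)
      rw [pd_eqOn S.nice.isOpen (hpd b p) a hw,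
        pd_sub (hd3.const_mul _) (differentiableAt_const _), pd_const, sub_zero, pd_const_mul hd3,
        S.pd_comp (A.adm_pd_sqNorm b).diff p hw, inv_mul_cancel_left₀ (S.lam_pos p).ne']
  -- Replacing the frozen Laplacian by its actual value costs the oscillation `hosc`, and only for
  -- `b = 0`, because `df = dz₀`.
  refine (h1.add ((UBound.const (Ω := Ω)
    (c := fun _ : ι => -(2 / ((n : ℝ) + 1) * (if b = 0 then 1 else 0))) fun _ => le_rfl).mul
      hosc)).congr fun p w hw => ?_
  simp only
  rw [hpd b p hw, defectW, A.pd_eq_of_coord hf b (S.mapsTo p hw)]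
  simp only [s]
  ring

/-- `𝓗_G(f)` agrees to first order with the trace-free Hessian. -/
theorem ub_inv_mul_tensorH_sub {c : Coord n} (hc : c ∈ Ω) (a b : Fin (n + 1)) :
    UB Ω α (j + 1) fun p w =>
      (lam p)⁻¹ * (tensorH G f (Φ p w) a b - traceFreeHess G f (Φ p w) a b) :=
  A.ub_tensorH_sub_of_weight hn _
    (A.adm_sqNorm_sub_one.ub_inv_mul A.family (A.ubound_sqNorm_sub_one hn hf hf0 hΦ hR))
    (fun i => (A.adm_defectW i).ub_inv_mul A.family (A.ubound_defectW hn hf hf0 hΦ hR hc i)) a b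

end Boundary

end AdmGeometry

/-! ### Möbius parametrizations -/

/-- Multiply the distance inequality by `2 w₀` and complete the square with `cosh² - sinh² = 1`. The
point is that the ball is convex and bounded in the Euclidean sense. -/
theorem hypBall_eq_ball (n : ℕ) (r : ℝ) (hr : 0 ≤ r) : hypBall n r =
    Metric.ball (EuclideanSpace.single 0 (Real.cosh r) : Coord n) (Real.sinh r) := by
  have hnorm : ∀ (w : Coord n) (c : ℝ),
      ‖w - EuclideanSpace.single 0 c‖ ^ 2 = ‖w‖ ^ 2 - 2 * (c * w 0) + c ^ 2 := fun w c => by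
    rw [norm_sub_sq_real, EuclideanSpace.inner_single_right, PiLp.norm_single]
    simp
  have hsinh : 0 ≤ Real.sinh r := Real.sinh_nonneg_iff.2 hr
  have hcs := Real.cosh_sq r
  ext w
  rw [Metric.mem_ball, dist_eq_norm, ← sq_lt_sq₀ (norm_nonneg _) hsinh, hnorm]
  constructor
  · rintro ⟨h0, h⟩
    rw [hnorm] at h
    have h1 : (‖w‖ ^ 2 - 2 * (1 * w 0) + 1 ^ 2) / (2 * w 0) < Real.cosh r - 1 := by linarith
    rw [div_lt_iff₀ (by positivity)] at h1
    nlinarith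
  · intro h
    -- Membership in the Euclidean ball reads `‖w‖² + 1 < 2 w₀ cosh r`, which is impossible for `w₀
    -- ≤ 0`.
    have h0 : 0 < w 0 := by
      have h1 : 0 ≤ ‖w‖ ^ 2 := by positivity
      have h2 := Real.cosh_pos r
      by_contra hneg
      push Not at hneg
      nlinarith
    refine ⟨h0, ?_⟩
    have h1 : (‖w‖ ^ 2 - 2 * (1 * w 0) + 1 ^ 2) / (2 * w 0) < Real.cosh r - 1 := by
      rw [div_lt_iff₀ (by positivity)]
      nlinarith
    rw [hnorm]
    linarith

theorem niceDomain_ball (z : Coord n) (s : ℝ) : NiceDomain (Metric.ball z s) :=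
  ⟨Metric.isOpen_ball, convex_ball z s, Metric.isBounded_ball⟩

theorem niceDomain_hypBall : NiceDomain (hypBall n 2) := by
  rw [hypBall_eq_ball n 2 zero_le_two]
  exact niceDomain_ball _ _

theorem center_mem_hypBall : (EuclideanSpace.single 0 1 : Coord n) ∈ hypBall n 2 := by
  refine ⟨by simp, ?_⟩
  simp only [sub_self, norm_zero]
  simp

/-- The lowest height of the Euclidean ball is `cosh 2 - sinh 2 = exp (-2)`; hence powers of `w₀`
are harmless in the norms. -/
theorem exp_neg_le_of_mem_hypBall {w : Coord n} (hw : w ∈ hypBall n 2) :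
    Real.exp (-2) ≤ w 0 := by
  rw [hypBall_eq_ball n 2 zero_le_two, Metric.mem_ball, dist_eq_norm] at hw
  have h1 := (PiLp.norm_apply_le (w - EuclideanSpace.single 0 (Real.cosh 2)) 0).trans hw.le
  simp only [PiLp.sub_apply, PiLp.single_apply, if_true, Real.norm_eq_abs] at h1
  have h2 := (abs_le.1 h1).1
  have h3 := Real.cosh_sub_sinh 2
  linarith

theorem mobius_eq (p w : Coord n) :
    mobius p w = p 0 • w + WithLp.toLp 2 (fun i => if i = 0 then 0 else p i) := by
  ext i
  by_cases hi : i = 0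
  · subst hi; simp [mobius]
  · simp [mobius, hi, add_comm]

theorem mobius_apply_zero (p w : Coord n) : mobius p w 0 = p 0 * w 0 := by simp [mobius]

/-- Allows uniform bounds along the family to be read as pointwise bounds at `p`. -/
theorem mobius_center (p : Coord n) : mobius p (EuclideanSpace.single 0 1) = p := by
  ext i
  by_cases hi : i = 0
  · subst hi; simp [mobius]
  · simp [mobius, hi]

theorem mobius_sub (p w : Coord n) :
    mobius p w - p = p 0 • (w - EuclideanSpace.single 0 1) := by
  nth_rewrite 2 [← mobius_center p]
  rw [mobius_eq, mobius_eq p (EuclideanSpace.single 0 1), smul_sub]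
  abel

theorem hasFDerivAt_mobius (p w : Coord n) :
    HasFDerivAt (mobius p) (p 0 • ContinuousLinearMap.id ℝ (Coord n)) w := by
  have : mobius p = fun w => p 0 • w + WithLp.toLp 2 (fun i => if i = 0 then 0 else p i) :=
    funext (mobius_eq p)
  rw [this]
  exact ((hasFDerivAt_id w).const_smul (p 0)).add_const _

theorem scaledFamily_mobius {D : Set (Coord n)} (hD : IsOpen D) {P : Coord n → Prop}
    (hpos : ∀ p, P p → 0 < p 0) (hle : ∃ C, ∀ p : Coord n, P p → p 0 ≤ C)
    (hmaps : ∀ p, P p → MapsTo (mobius p) (hypBall n 2) D) :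
    ScaledFamily (fun p : Subtype P => mobius (p : Coord n)) (fun p => (p : Coord n) 0)
      (hypBall n 2) D where
  nice := niceDomain_hypBall
  isOpen := hD
  lam_pos p := hpos p p.2
  lam_le := hle.imp fun _ h p => h p p.2
  hasFDerivAt p w := hasFDerivAt_mobius p w
  mapsTo p := hmaps p p.2

theorem scaledFamily_id {D : Set (Coord n)} (hD : IsOpen D) {z : Coord n} {s : ℝ}
    (h : Metric.ball z s ⊆ D) :
    ScaledFamily (fun _ : Unit => (id : Coord n → Coord n)) (fun _ => (1 : ℝ))
      (Metric.ball z s) D where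
  nice := niceDomain_ball z s
  isOpen := hD
  lam_pos _ := one_pos
  lam_le := ⟨1, fun _ => le_rfl⟩
  hasFDerivAt _ w := by simpa using hasFDerivAt_id w
  mapsTo _ := h

/-! ### Charts of a manifold with boundary -/

section Charts

variable {M : Type*} [TopologicalSpace M]

theorem target_eq (e : Chart n M) : (e.extend (𝓡∂ (n + 1))).target =
    (𝓡∂ (n + 1)).symm ⁻¹' e.target ∩ {z : Coord n | 0 ≤ z 0} := by
  rw [e.extend_target, range_modelWithCornersEuclideanHalfSpace]

theorem symm_mem_source {e : Chart n M} {z : Coord n}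
    (hz : z ∈ (e.extend (𝓡∂ (n + 1))).target) :
    (e.extend (𝓡∂ (n + 1))).symm z ∈ e.source := by
  rw [← e.extend_source (I := 𝓡∂ (n + 1))]
  exact (e.extend (𝓡∂ (n + 1))).map_target hz

theorem isInteriorPoint_halfSpace_iff (y : EuclideanHalfSpace (n + 1)) :
    (𝓡∂ (n + 1)).IsInteriorPoint y ↔ 0 < ((𝓡∂ (n + 1)) y : Coord n) 0 := by
  rw [ModelWithCorners.IsInteriorPoint, interior_range_modelWithCornersEuclideanHalfSpace]
  rfl

variable {e : Chart n M}

theorem target_mem_nhdsWithin {z : Coord n} (hz : z ∈ (e.extend (𝓡∂ (n + 1))).target) :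
    (e.extend (𝓡∂ (n + 1))).target ∈ 𝓝[range (𝓡∂ (n + 1))] z := by
  have := e.extend_target_mem_nhdsWithin (I := 𝓡∂ (n + 1)) (symm_mem_source hz)
  rwa [(e.extend (𝓡∂ (n + 1))).right_inv hz] at this

theorem uniqueMDiffOn_target :
    UniqueMDiffOn 𝓘(ℝ, Coord n) (e.extend (𝓡∂ (n + 1))).target := by
  rw [uniqueMDiffOn_iff_uniqueDiffOn, e.extend_target]
  exact (𝓡∂ (n + 1)).uniqueDiffOn_preimage e.open_target

variable [ChartedSpace (EuclideanHalfSpace (n + 1)) M]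

theorem mdifferentiable_chart (he : e ∈ IsManifold.maximalAtlas (𝓡∂ (n + 1)) ∞ M) :
    e.MDifferentiable (𝓡∂ (n + 1)) (𝓡∂ (n + 1)) :=
  ⟨(contMDiffOn_of_mem_maximalAtlas he).mdifferentiableOn (by simp),
    (contMDiffOn_symm_of_mem_maximalAtlas he).mdifferentiableOn (by simp)⟩

theorem contMDiffOn_symm (he : e ∈ IsManifold.maximalAtlas (𝓡∂ (n + 1)) ∞ M) :
    ContMDiffOn 𝓘(ℝ, Coord n) (𝓡∂ (n + 1)) ∞ (e.extend (𝓡∂ (n + 1))).symm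
      (e.extend (𝓡∂ (n + 1))).target := by
  rw [e.extend_target']
  exact contMDiffOn_extend_symm he

/-- A map with surjective differential sends interior points to interior points; apply this to the
chart and to its inverse. -/
theorem isInteriorPoint_iff_of_mem_maximalAtlas
    (he : e ∈ IsManifold.maximalAtlas (𝓡∂ (n + 1)) ∞ M) {x : M} (hx : x ∈ e.source) :
    (𝓡∂ (n + 1)).IsInteriorPoint x ↔ 0 < (e.extend (𝓡∂ (n + 1)) x) 0 := by
  have hd := mdifferentiable_chart he
  refine Iff.trans ?_ (isInteriorPoint_halfSpace_iff (e x))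
  refine ⟨fun h => (hd.mdifferentiableAt hx).isInteriorPoint_of_surjective_mfderiv
    (hd.mfderiv_surjective hx) h, fun h => ?_⟩
  have hy : e x ∈ e.target := e.map_source hx
  have := (hd.symm.mdifferentiableAt hy).isInteriorPoint_of_surjective_mfderiv
    (hd.symm.mfderiv_surjective hy) h
  rwa [e.left_inv hx] at this

theorem chartInterior_eq (he : e ∈ IsManifold.maximalAtlas (𝓡∂ (n + 1)) ∞ M) :
    chartInterior e = (e.extend (𝓡∂ (n + 1))).target ∩ {z : Coord n | 0 < z 0} := by
  ext z
  refine and_congr_right fun hz => ?_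
  refine (isInteriorPoint_iff_of_mem_maximalAtlas he (symm_mem_source hz)).trans ?_
  rw [(e.extend (𝓡∂ (n + 1))).right_inv hz]
  rfl

theorem isOpen_chartInterior (he : e ∈ IsManifold.maximalAtlas (𝓡∂ (n + 1)) ∞ M) :
    IsOpen (chartInterior e) := by
  have : chartInterior e = (𝓡∂ (n + 1)).symm ⁻¹' e.target ∩ {z : Coord n | 0 < z 0} := by
    rw [chartInterior_eq he, target_eq]
    ext z
    exact ⟨fun h => ⟨h.1.1, h.2⟩, fun h => ⟨⟨h.1, le_of_lt (show 0 < z 0 from h.2)⟩, h.2⟩⟩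
  rw [this]
  refine (e.open_target.preimage (𝓡∂ (n + 1)).continuous_symm).inter ?_
  exact isOpen_lt continuous_const (EuclideanSpace.proj (𝕜 := ℝ) (0 : Fin (n + 1))).continuous

theorem mdifferentiableWithinAt_symm (he : e ∈ IsManifold.maximalAtlas (𝓡∂ (n + 1)) ∞ M)
    {z : Coord n} (hz : z ∈ (e.extend (𝓡∂ (n + 1))).target) :
    MDifferentiableWithinAt 𝓘(ℝ, Coord n) (𝓡∂ (n + 1)) (e.extend (𝓡∂ (n + 1))).symm
      (range (𝓡∂ (n + 1))) z :=
  ((contMDiffOn_symm he).mdifferentiableOn (by simp) z hz).mono_of_mem_nhdsWithin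
    (target_mem_nhdsWithin hz)

/-- The range of the model and the chart target have the same germ at `z`. Coordinate vectors use
the former, smoothness statements the latter. -/
theorem mfderivWithin_symm_eq {z : Coord n} (hz : z ∈ (e.extend (𝓡∂ (n + 1))).target) :
    mfderivWithin 𝓘(ℝ, Coord n) (𝓡∂ (n + 1)) (e.extend (𝓡∂ (n + 1))).symm
      (range (𝓡∂ (n + 1))) z =
    mfderivWithin 𝓘(ℝ, Coord n) (𝓡∂ (n + 1)) (e.extend (𝓡∂ (n + 1))).symm
      (e.extend (𝓡∂ (n + 1))).target z :=
by
  refine mfderivWithin_congr_set (EventuallyEq.symm ?_)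
  have := e.extend_target_eventuallyEq (I := 𝓡∂ (n + 1)) (symm_mem_source hz)
  rwa [(e.extend (𝓡∂ (n + 1))).right_inv hz] at this

theorem mfderiv_comp_mfderivWithin_symm (he : e ∈ IsManifold.maximalAtlas (𝓡∂ (n + 1)) ∞ M)
    {z : Coord n} (hz : z ∈ (e.extend (𝓡∂ (n + 1))).target) :
    (mfderiv (𝓡∂ (n + 1)) 𝓘(ℝ, Coord n) (e.extend (𝓡∂ (n + 1)))
      ((e.extend (𝓡∂ (n + 1))).symm z)) ∘L
    (mfderivWithin 𝓘(ℝ, Coord n) (𝓡∂ (n + 1)) (e.extend (𝓡∂ (n + 1))).symm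
      (range (𝓡∂ (n + 1))) z) = ContinuousLinearMap.id ℝ (Coord n) := by
  have U : UniqueMDiffWithinAt 𝓘(ℝ, Coord n) (range (𝓡∂ (n + 1))) z :=
    (𝓡∂ (n + 1)).uniqueMDiffOn _ (e.extend_target_subset_range hz)
  rw [← mfderiv_comp_mfderivWithin]; rotate_left
  · exact (e.contMDiffAt_extend he (symm_mem_source hz)).mdifferentiableAt (by simp)
  · exact mdifferentiableWithinAt_symm he hz
  · exact U
  refine Eq.trans ?_ (mfderivWithin_id U)
  apply Filter.EventuallyEq.mfderivWithin_eq
  · filter_upwards [target_mem_nhdsWithin hz] with y hy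
    simp only [Function.comp_def, PartialEquiv.right_inv _ hy, id_eq]
  · simp only [Function.comp_def, PartialEquiv.right_inv _ hz, id_eq]

theorem mfderiv_coordVec (he : e ∈ IsManifold.maximalAtlas (𝓡∂ (n + 1)) ∞ M)
    {z : Coord n} (hz : z ∈ (e.extend (𝓡∂ (n + 1))).target) (i : Fin (n + 1)) :
    (show Coord n from mfderiv (𝓡∂ (n + 1)) 𝓘(ℝ, Coord n) (e.extend (𝓡∂ (n + 1)))
      ((e.extend (𝓡∂ (n + 1))).symm z) (coordVec e i z)) = EuclideanSpace.single i 1 :=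
  congrArg (fun L : Coord n →L[ℝ] Coord n => L (EuclideanSpace.single i 1))
    (mfderiv_comp_mfderivWithin_symm he hz)

/-- The coordinate vectors are linearly independent, because the differential of the chart maps them
to the standard basis. -/
theorem posDef_tensorComp (he : e ∈ IsManifold.maximalAtlas (𝓡∂ (n + 1)) ∞ M)
    {z : Coord n} (hz : z ∈ (e.extend (𝓡∂ (n + 1))).target) (T : TwoTensor n M)
    (hs : ∀ v w, T ((e.extend (𝓡∂ (n + 1))).symm z) v w =
      T ((e.extend (𝓡∂ (n + 1))).symm z) w v)
    (hpos : ∀ v, v ≠ 0 → 0 < T ((e.extend (𝓡∂ (n + 1))).symm z) v v) :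
    (Matrix.of (tensorComp T e z)).PosDef := by
  refine Matrix.PosDef.of_dotProduct_mulVec_pos ?_ fun v hv => ?_
  · ext i j
    exact hs _ _
  · let V := ∑ i, v i • coordVec e i z
    have hV : V ≠ 0 := by
      intro h0
      apply hv
      have h1 := congrArg (fun w => (show Coord n from mfderiv (𝓡∂ (n + 1)) 𝓘(ℝ, Coord n)
        (e.extend (𝓡∂ (n + 1))) ((e.extend (𝓡∂ (n + 1))).symm z) w)) h0
      have h2 : (∑ i, v i • (EuclideanSpace.single i 1 : Coord n)) = 0 := by
        simp only [V, map_sum, map_smul] at h1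
        simp only [← mfderiv_coordVec he hz]
        exact h1.trans (map_zero _)
      funext j
      have h3 := congrArg (fun w : Coord n => w j) h2
      simpa [Pi.single_apply] using h3
    have := hpos V hV
    have h4 : star v ⬝ᵥ (Matrix.of (tensorComp T e z)).mulVec v =
        T ((e.extend (𝓡∂ (n + 1))).symm z) V V := by
      simp only [V, map_sum, map_smul, sum_apply,
        smul_apply, smul_eq_mul, dotProduct, Matrix.mulVec, Finset.mul_sum]
      refine Finset.sum_congr rfl fun i _ => Finset.sum_congr rfl fun j _ => ?_
      simp only [Matrix.of_apply, tensorComp, star_trivial, Pi.star_apply]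
      rw [hs]
      ring
    rw [h4]
    exact this

end Charts

/-! ### Coordinate vector fields as smooth sections -/

section CoordinateFields

variable {M : Type*} [TopologicalSpace M] [ChartedSpace (EuclideanHalfSpace (n + 1)) M]
  [IsManifold (𝓡∂ (n + 1)) ∞ M] {e : Chart n M}

/-- The coordinate field is the tangent map of the inverse chart composed with a constant section.
-/
theorem contMDiffOn_coordVec (he : e ∈ IsManifold.maximalAtlas (𝓡∂ (n + 1)) ∞ M)
    (i : Fin (n + 1)) :
    ContMDiffOn 𝓘(ℝ, Coord n) (𝓡∂ (n + 1)).tangent ∞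
      (fun z => (⟨(e.extend (𝓡∂ (n + 1))).symm z, coordVec e i z⟩ :
        TangentBundle (𝓡∂ (n + 1)) M)) (e.extend (𝓡∂ (n + 1))).target := by
  have h1 := (contMDiffOn_symm he).contMDiffOn_tangentMapWithin (m := ∞) (by simp)
    uniqueMDiffOn_target
  have h2 : ContMDiff 𝓘(ℝ, Coord n) 𝓘(ℝ, Coord n).tangent ∞
      (fun z : Coord n => (⟨z, EuclideanSpace.single i (1 : ℝ)⟩ :
        TangentBundle 𝓘(ℝ, Coord n) (Coord n))) :=
    contMDiff_vectorSpace_iff_contDiff.2 contDiff_const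
  refine (h1.comp h2.contMDiffOn fun z hz => hz).congr fun z hz => ?_
  simp only [Function.comp_apply, tangentMapWithin, coordVec]
  rw [mfderivWithin_symm_eq hz]

theorem continuousOn_tensorComp (he : e ∈ IsManifold.maximalAtlas (𝓡∂ (n + 1)) ∞ M)
    (G : Bundle.ContinuousRiemannianMetric (Coord n)
        (fun x : M => TangentSpace (𝓡∂ (n + 1)) x)) (i j : Fin (n + 1)) :
    ContinuousOn (fun z => tensorComp (fun x => G.inner x) e z i j)
      (e.extend (𝓡∂ (n + 1))).target := by
  have h1 : ContinuousOn (e.extend (𝓡∂ (n + 1))).symm (e.extend (𝓡∂ (n + 1))).target :=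
    e.continuousOn_extend_symm
  have h2 := G.continuous.comp_continuousOn h1
  have h3 := ContinuousOn.clm_bundle_apply₂ (F₁ := Coord n) (F₂ := Coord n) (F₃ := ℝ)
    (E₁ := fun x : M => TangentSpace (𝓡∂ (n + 1)) x)
    (E₂ := fun x : M => TangentSpace (𝓡∂ (n + 1)) x) (E₃ := Bundle.Trivial M ℝ)
    (b := (e.extend (𝓡∂ (n + 1))).symm)
    (ψ := fun z => G.inner ((e.extend (𝓡∂ (n + 1))).symm z)) h2
    (contMDiffOn_coordVec he i).continuousOn (contMDiffOn_coordVec he j).continuousOn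
  exact fun z hz => ((FiberBundle.continuousWithinAt_totalSpace ℝ (E := Bundle.Trivial M ℝ) _).1 (h3 z hz)).2

/-- A chart gives a smooth vector field that equals the coordinate vector field near a compact
set. -/
theorem exists_coordinateField [T2Space M] [CompactSpace M]
    (he : e ∈ IsManifold.maximalAtlas (𝓡∂ (n + 1)) ∞ M) {K : Set M} (hK : IsCompact K)
    (hKe : K ⊆ e.source) (i : Fin (n + 1)) :
    ∃ (X : SmoothVecField n M) (U : Set M), IsOpen U ∧ K ⊆ U ∧
      ∀ z ∈ (e.extend (𝓡∂ (n + 1))).target, (e.extend (𝓡∂ (n + 1))).symm z ∈ U →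
        vecComp (fun x => X x) e z = fun l => if l = i then 1 else 0 := by
  obtain ⟨L, hL, hKL, hLe⟩ := exists_compact_between hK e.open_source hKe
  obtain ⟨ψ, hψ1, hψ0, -⟩ := exists_contMDiffMap_one_nhds_of_subset_interior (n := (⊤ : ℕ∞))
    (𝓡∂ (n + 1)) hK.isClosed hKL
  have hts : tsupport ψ ⊆ e.source := by
    refine Subset.trans (closure_minimal (fun x hx => ?_) hL.isClosed) hLe
    by_contra hxL
    exact hx (hψ0 x hxL)
  let Y : (x : M) → TangentSpace (𝓡∂ (n + 1)) x := fun x =>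
    mfderivWithin 𝓘(ℝ, Coord n) (𝓡∂ (n + 1)) (e.extend (𝓡∂ (n + 1))).symm
      (range (𝓡∂ (n + 1))) (e.extend (𝓡∂ (n + 1)) x) (EuclideanSpace.single i (1 : ℝ) : Coord n)
  have hY : ContMDiffOn (𝓡∂ (n + 1)) (𝓡∂ (n + 1)).tangent ∞
      (fun x => (⟨x, Y x⟩ : TangentBundle (𝓡∂ (n + 1)) M)) e.source := by
    refine ((contMDiffOn_coordVec he i).comp (e.contMDiffOn_extend he) fun x hx => ?_).congr
      fun x hx => ?_
    · rw [← e.extend_source (I := 𝓡∂ (n + 1))] at hx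
      exact (e.extend (𝓡∂ (n + 1))).map_source hx
    · have := e.extend_left_inv (I := 𝓡∂ (n + 1)) hx
      refine Bundle.TotalSpace.ext this.symm ?_
      simp only [Function.comp_apply, Y, coordVec]
      rfl
  -- The cutoff is supported in the chart domain, so the product is smooth on all of `M` although
  -- `Y` is only smooth on that domain.
  have hX := ContMDiffOn.smul_section_of_tsupport (ψ.contMDiff.contMDiffOn) e.open_source hts hY
  obtain ⟨U, hU, hKU, hU1⟩ := mem_nhdsSet_iff_exists.1 hψ1
  refine ⟨⟨_, hX⟩, U, hU, hKU, fun z hz hzU => ?_⟩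
  funext l
  have h1 : ψ ((e.extend (𝓡∂ (n + 1))).symm z) = 1 := hU1 hzU
  have h2 := mfderiv_coordVec he hz i
  have hYz : Y ((e.extend (𝓡∂ (n + 1))).symm z) = coordVec e i z := by
    simp only [Y, coordVec]
    rw [(e.extend (𝓡∂ (n + 1))).right_inv hz]
  have h3 : vecComp (fun x => (ψ : M → ℝ) x • Y x) e z l =
      (EuclideanSpace.single i 1 : Coord n) l := by
    rw [← h2]
    simp only [vecComp, h1, one_smul, hYz]
  refine h3.trans ?_
  rw [PiLp.single_apply]

end CoordinateFields

/-! ### Regularity in the interior -/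

/-- All derivatives are continuous on the compact closed ball, hence bounded. -/
theorem UB.of_contDiffOn {D : Set (Coord n)} (hD : IsOpen D) {z : Coord n} {s α : ℝ}
    (h : Metric.closedBall z s ⊆ D) (hα : α ≤ 1) {f : Coord n → ℝ} (hf : ContDiffOn ℝ ∞ f D)
    (m : ℕ) : UB (Metric.ball z s) α m fun _ : Unit => f := by
  have hsub : Metric.ball z s ⊆ D := Metric.ball_subset_closedBall.trans h
  have hbound : ∀ {u : Coord n → ℝ}, ContDiffOn ℝ ∞ u D →
      UBound (Metric.ball z s) fun _ : Unit => u := fun {u} hu => by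
    obtain ⟨C, hC⟩ := (isCompact_closedBall z s).exists_bound_of_continuousOn
      (hu.continuousOn.mono h)
    exact ⟨C, fun _ x hx => hC x (Metric.ball_subset_closedBall hx)⟩
  have hpd : ∀ {u : Coord n → ℝ}, ContDiffOn ℝ ∞ u D → ∀ i, ContDiffOn ℝ ∞ (AH.pd i u) D :=
    fun hu i => (hu.fderiv_of_isOpen hD le_rfl).clm_apply contDiffOn_const
  have hd : ∀ {u : Coord n → ℝ}, ContDiffOn ℝ ∞ u D → DifferentiableOn ℝ u (Metric.ball z s) :=
    fun hu => (hu.differentiableOn (by simp)).mono hsub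
  induction m generalizing f with
  | zero =>
    exact UB.zero_of_ubound_pd (niceDomain_ball z s) hα (fun _ => hd hf) (hbound hf)
      fun i => hbound (hpd hf i)
  | succ m ih => exact ⟨fun _ => hd hf, hbound hf, fun i => ih (hpd hf i)⟩

theorem Adm.of_ub_ball {z : Coord n} {s α : ℝ} {j : ℕ} {u : Coord n → ℝ}
    (h : UB (Metric.ball z s) α (j + 1) fun _ : Unit => u) :
    Adm (fun _ : Unit => (id : Coord n → Coord n)) (Metric.ball z s) (Metric.ball z s) α j u where
  diff := h.1 ()
  ub := h
  ub_pd i := h.pd i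

section Interior

variable {M : Type*} [TopologicalSpace M] [ChartedSpace (EuclideanHalfSpace (n + 1)) M]
  {ρ : M → ℝ} {k j : ℕ} {α : ℝ} {g : TwoTensor n M}
  {e : Chart n M}

theorem IsDefiningFunction.pos (hρ : IsDefiningFunction (n := n) ρ) {x : M}
    (hx : x ∈ (𝓡∂ (n + 1)).interior M) : 0 < ρ x := by
  refine (hρ.nonneg x).lt_of_ne fun h => ?_
  have h1 := (hρ.eq_zero_iff x).1 h.symm
  rw [← (𝓡∂ (n + 1)).compl_interior] at h1
  exact h1 hx

theorem exists_closedBall_subset (he : e ∈ IsManifold.maximalAtlas (𝓡∂ (n + 1)) ∞ M)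
    {z : Coord n} (hz : z ∈ chartInterior e) :
    ∃ s > 0, Metric.closedBall z s ⊆ chartInterior e :=
  Metric.nhds_basis_closedBall.mem_iff.1 ((isOpen_chartInterior he).mem_nhds hz)

theorem contDiffOn_funComp (hρ : IsDefiningFunction (n := n) ρ)
    (he : e ∈ IsManifold.maximalAtlas (𝓡∂ (n + 1)) ∞ M) :
    ContDiffOn ℝ ∞ (funComp ρ e) (chartInterior e) :=
  ((hρ.smooth.comp_contMDiffOn (contMDiffOn_symm he)).mono inter_subset_left).contDiffOn

variable [IsManifold (𝓡∂ (n + 1)) ∞ M]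

theorem posDef_rescale (hρ : IsDefiningFunction (n := n) ρ) (hg : MemMWeak ρ k α 2 g)
    (he : e ∈ IsManifold.maximalAtlas (𝓡∂ (n + 1)) ∞ M) {z : Coord n}
    (hz : z ∈ chartInterior e) : (Matrix.of (tensorComp (rescale ρ g) e z)).PosDef := by
  refine posDef_tensorComp he hz.1 _ (fun v w => ?_) fun v hv => ?_
  · simp only [rescale, smul_apply, hg.symm _ hz.2 v w]
  · exact mul_pos (pow_pos (hρ.pos hz.2) 2) (hg.pos _ hz.2 v hv)

theorem regularAt_rescale (hρ : IsDefiningFunction (n := n) ρ) (hk : 2 ≤ k)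
    (hg : MemMWeak ρ k α 2 g) (he : e ∈ IsManifold.maximalAtlas (𝓡∂ (n + 1)) ∞ M)
    {z : Coord n} (hz : z ∈ chartInterior e) : RegularAt (tensorComp (rescale ρ g) e) z where
  contDiffAt a b := by
    obtain ⟨s, hs, hsub⟩ := exists_closedBall_subset he hz
    obtain ⟨C, hC⟩ := (hg.regular [] (by simp)).2 e he z s hsub
    have h1 := (hC.contDiffOn.contDiffAt (Metric.ball_mem_nhds z hs)).of_le
      (by exact_mod_cast hk : ((2 : ℕ) : WithTop ℕ∞) ≤ _)
    exact contDiffAt_pi.1 (contDiffAt_pi.1 h1 a) b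
  symm := by
    filter_upwards [(isOpen_chartInterior he).mem_nhds hz] with y hy a b
    simp only [tensorComp, rescale, smul_apply, hg.symm _ hy.2]
  det_ne := (posDef_rescale hρ hg he hz).det_pos.ne'

/-- With trivial dilations admissibility is plain `C^{j+1,α}` regularity, which both `ḡ ∈ C^{j+2,α}`
and `∂ḡ` have. The lower determinant bound is compactness of the closed ball. -/
theorem admGeometry_ball (hρ : IsDefiningFunction (n := n) ρ) (hα : α ≤ 1)
    (hg : MemMWeak ρ (j + 2) α 2 g) (he : e ∈ IsManifold.maximalAtlas (𝓡∂ (n + 1)) ∞ M)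
    {z : Coord n} {s : ℝ} (hsub : Metric.closedBall z s ⊆ chartInterior e) :
    AdmGeometry (fun _ : Unit => (id : Coord n → Coord n)) (fun _ => (1 : ℝ)) (Metric.ball z s)
      (Metric.ball z s) α j (tensorComp (rescale ρ g) e) (funComp ρ e) := by
  have hsub' : Metric.ball z s ⊆ chartInterior e := Metric.ball_subset_closedBall.trans hsub
  have hN := niceDomain_ball z s
  have hf : ∀ m, UB (Metric.ball z s) α m fun _ : Unit => funComp ρ e := fun m =>
    UB.of_contDiffOn (isOpen_chartInterior he) hsub hα (contDiffOn_funComp hρ he) m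
  obtain ⟨C, hC⟩ := (hg.regular [] (by simp)).2 e he z s hsub
  have hG : ∀ a b, UB (Metric.ball z s) α (j + 2) fun _ : Unit =>
      fun y => tensorComp (rescale ρ g) e y a b := fun a b =>
    UB.of_holderBound_matField (U := fun _ : Unit => tensorComp (rescale ρ g) e) hN.isOpen
      (fun _ => hC) a b
  refine
    { family := scaledFamily_id Metric.isOpen_ball subset_rfl
      exponent := hα
      regular := fun y hy => regularAt_rescale hρ (by omega) hg he (hsub' hy)
      posDef := fun y hy => posDef_rescale hρ hg he (hsub' hy)
      smooth := fun y hy => ((contDiffOn_funComp hρ he).contDiffAt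
        ((isOpen_chartInterior he).mem_nhds (hsub' hy))).of_le (WithTop.coe_le_coe.2 (le_top : (2 : ℕ∞) ≤ ⊤))
      adm := fun a b => Adm.of_ub_ball ((hG a b).of_succ hN hα)
      adm_pd := fun i a b => Adm.of_ub_ball ((hG a b).pd i)
      adm_df := fun i => Adm.of_ub_ball ((hf (j + 2)).pd i)
      adm_ddf := fun i l => Adm.of_ub_ball (((hf (j + 3)).pd l).pd i)
      det_ge := ?_ }
  have hcont : ContinuousOn (fun y => (Matrix.of (tensorComp (rescale ρ g) e y)).det)
      (Metric.closedBall z s) := fun y hy =>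
    (contDiffAt_det (regularAt_rescale hρ (by omega) hg he
      (hsub hy)).contDiffAt).continuousAt.continuousWithinAt
  obtain ⟨c, hc, h⟩ := (isCompact_closedBall z s).exists_forall_le' hcont
    (a := 0) fun y hy => (posDef_rescale hρ hg he (hsub hy)).det_pos
  exact ⟨c, hc, fun _ y hy => (h y (Metric.ball_subset_closedBall hy)).trans (le_abs_self _)⟩

theorem holderBound_ball (hn : 1 ≤ n) (hρ : IsDefiningFunction (n := n) ρ) (hα : α ≤ 1)
    (hg : MemMWeak ρ (j + 2) α 2 g) (he : e ∈ IsManifold.maximalAtlas (𝓡∂ (n + 1)) ∞ M)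
    {z : Coord n} {s : ℝ} (hsub : Metric.closedBall z s ⊆ chartInterior e) :
    ∃ C : ℝ, HolderBound (j + 1) α C (Metric.ball z s)
      fun y => tensorHBar ρ g e y - traceFreeHessBar ρ g e y := by
  obtain ⟨C, hC⟩ := exists_holderBound_matField
    (U := fun _ : Unit => fun y => tensorHBar ρ g e y - traceFreeHessBar ρ g e y)
    Metric.isOpen_ball fun a b => (admGeometry_ball hρ hα hg he hsub).ub_tensorH_sub hn a b
  exact ⟨C, hC ()⟩

theorem continuousOn_traceFreeHessBar (hρ : IsDefiningFunction (n := n) ρ) (hα : α ≤ 1)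
    (hg : MemMWeak ρ (j + 2) α 2 g) (he : e ∈ IsManifold.maximalAtlas (𝓡∂ (n + 1)) ∞ M) :
    ContinuousOn (traceFreeHessBar ρ g e) (chartInterior e) := fun z hz => by
  obtain ⟨s, hs, hsub⟩ := exists_closedBall_subset he hz
  refine ContinuousAt.continuousWithinAt (continuousAt_pi.2 fun a => continuousAt_pi.2 fun b => ?_)
  exact ((admGeometry_ball hρ hα hg he hsub).adm_traceFreeHess a b).diff.continuousOn.continuousAt
    (Metric.ball_mem_nhds z hs)

theorem continuousOn_tensorHBar (hn : 1 ≤ n) (hρ : IsDefiningFunction (n := n) ρ) (hα : α ≤ 1)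
    (hg : MemMWeak ρ (j + 2) α 2 g) (he : e ∈ IsManifold.maximalAtlas (𝓡∂ (n + 1)) ∞ M) :
    ContinuousOn (tensorHBar ρ g e) (chartInterior e) := fun z hz => by
  obtain ⟨s, hs, hsub⟩ := exists_closedBall_subset he hz
  obtain ⟨C, hC⟩ := holderBound_ball hn hρ hα hg he hsub
  have h1 := hC.contDiffOn.continuousOn.continuousAt (Metric.ball_mem_nhds z hs)
  have h2 := (continuousOn_traceFreeHessBar hρ hα hg he).continuousAt
    ((isOpen_chartInterior he).mem_nhds hz)
  exact (h1.add h2).continuousWithinAt.congr (fun y _ => by simp) (by simp)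

end Interior

/-! ### Uniform bounds along Möbius parametrizations -/

/-- The components of a coordinate field are locally constant, so only the transport term of the Lie
derivative remains. -/
theorem lieDeriv_eq_pd {O : Set (Coord n)} (hO : IsOpen O) {X : VecField n} {i : Fin (n + 1)}
    (hX : ∀ z ∈ O, X z = fun l => if l = i then 1 else 0) (u : MatField n) {z : Coord n}
    (hz : z ∈ O) (a b : Fin (n + 1)) : lieDeriv X u z a b = pd i (fun y => u y a b) z := by
  have h : ∀ l m, pd l (fun y => X y m) z = 0 := fun l m => by
    rw [pd_eqOn hO (g := fun _ => if m = i then 1 else 0) (fun y hy => congrFun (hX y hy) m) l hz,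
      pd_const]
  simp [lieDeriv, h, hX z hz]

section Mobius

variable {M : Type*} [TopologicalSpace M] {e : Chart n M} {K : Set M}

/-- The Möbius parametrization centred at `p` has its image in the compact set `K`. -/
def MobiusIn (e : Chart n M) (K : Set M) (p : Coord n) : Prop :=
  0 < p 0 ∧ MapsTo (mobius p) (hypBall n 2) (e.extend (𝓡∂ (n + 1)) '' K)

theorem extend_image_subset_target (hKe : K ⊆ e.source) :
    e.extend (𝓡∂ (n + 1)) '' K ⊆ (e.extend (𝓡∂ (n + 1))).target := by
  rintro _ ⟨x, hx, rfl⟩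
  exact (e.extend (𝓡∂ (n + 1))).map_source (by rw [e.extend_source]; exact hKe hx)

theorem symm_mem_of_mem_image (hKe : K ⊆ e.source) {z : Coord n}
    (hz : z ∈ e.extend (𝓡∂ (n + 1)) '' K) : (e.extend (𝓡∂ (n + 1))).symm z ∈ K := by
  obtain ⟨x, hx, rfl⟩ := hz
  rwa [e.extend_left_inv (hKe hx)]

theorem isCompact_extend_image (hK : IsCompact K) (hKe : K ⊆ e.source) :
    IsCompact (e.extend (𝓡∂ (n + 1)) '' K) :=
  hK.image_of_continuousOn (e.continuousOn_extend.mono (by rwa [e.extend_source]))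

theorem MobiusIn.mem_image {p : Coord n} (hp : MobiusIn e K p) :
    p ∈ e.extend (𝓡∂ (n + 1)) '' K := by
  simpa [mobius_center] using hp.2 center_mem_hypBall

theorem exists_mobiusIn_le (hK : IsCompact K) (hKe : K ⊆ e.source) :
    ∃ C, ∀ p : Coord n, MobiusIn e K p → p 0 ≤ C := by
  obtain ⟨C, hC⟩ := (isCompact_extend_image hK hKe).isBounded.exists_norm_le
  exact ⟨C, fun p hp => (le_abs_self _).trans
    ((PiLp.norm_apply_le p 0).trans (hC p hp.mem_image))⟩

variable [ChartedSpace (EuclideanHalfSpace (n + 1)) M] {ρ : M → ℝ} {k j : ℕ} {α : ℝ}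
  {g : TwoTensor n M}

theorem IsBackgroundChart.funComp_eq (hb : IsBackgroundChart ρ e) {z : Coord n}
    (hz : z ∈ (e.extend (𝓡∂ (n + 1))).target) : funComp ρ e z = z 0 := by
  rw [funComp, ← hb.2 _ (symm_mem_source hz), (e.extend (𝓡∂ (n + 1))).right_inv hz]

/-- The weight `ρ^(-2)` of a covariant 2-tensor is neutral for Möbius parametrizations. -/
theorem MemHolder.ub {m : ℕ} {u : Chart n M → MatField n} (h : MemHolder ρ m α 2 2 u)
    (hα : α ≤ 1) (hb : IsBackgroundChart ρ e) (hK : IsCompact K) (hKe : K ⊆ e.source)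
    (a b : Fin (n + 1)) :
    UB (hypBall n 2) α m fun (p : Subtype (MobiusIn e K)) w => u e (mobius p w) a b := by
  have hN := niceDomain_hypBall (n := n)
  obtain ⟨C, hC⟩ := h.1 e hb K hK hKe
  have h1 := UB.of_holderBound_matField (U := fun (p : Subtype (MobiusIn e K)) w =>
    (((p : Coord n) 0 * w 0) ^ (-2 : ℝ) * ((p : Coord n) 0) ^ 2) • u e (mobius p w)) hN.isOpen
    (fun p => hC p p.2.1 p.2.2) a b
  have hw : UB (hypBall n 2) α m fun (_ : Subtype (MobiusIn e K)) (w : Coord n) => w 0 :=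
    (UB.coord hN 0 m).of_succ hN hα
  refine ((hw.mul hN hα hw).mul hN hα h1).congr hN.isOpen fun p w hw => ?_
  have hp := p.2.1
  have hw0 := hw.1
  simp only [Pi.smul_apply, smul_eq_mul]
  rw [Real.rpow_neg (by positivity), Real.rpow_ofNat]
  field_simp

/-- For rank 0 no factor `p₀^r` compensates the weight, so weight 2 is genuine `O(p₀²)` decay;
powers of `w₀` are absorbed. -/
theorem MemHolder.ubound_scalar {m : ℕ} {u : Chart n M → Coord n → ℝ}
    (h : MemHolder ρ m α 2 0 u) (hb : IsBackgroundChart ρ e) (hK : IsCompact K)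
    (hKe : K ⊆ e.source) :
    UBound (hypBall n 2) fun (p : Subtype (MobiusIn e K)) w =>
      ((p : Coord n) 0)⁻¹ ^ 2 * u e (mobius p w) := by
  have hN := niceDomain_hypBall (n := n)
  obtain ⟨C, hC⟩ := h.1 e hb K hK hKe
  have h1 := (UB.of_holderBound (U := fun (p : Subtype (MobiusIn e K)) w =>
    (((p : Coord n) 0 * w 0) ^ (-2 : ℝ) * ((p : Coord n) 0) ^ 0) • u e (mobius p w)) hN.isOpen
    (fun p => hC p p.2.1 p.2.2)).bound
  have hw : UBound (hypBall n 2) fun (_ : Subtype (MobiusIn e K)) (w : Coord n) => w 0 :=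
    (UB.coord (α := α) hN 0 0).bound
  refine ((hw.mul hw).mul h1).congr fun p w hw => ?_
  have hp := p.2.1
  have hw0 := hw.1
  simp only [smul_eq_mul]
  rw [Real.rpow_neg (by positivity), Real.rpow_ofNat]
  field_simp

theorem MobiusIn.mapsTo_chartInterior (he : e ∈ IsManifold.maximalAtlas (𝓡∂ (n + 1)) ∞ M)
    (hKe : K ⊆ e.source) {p : Coord n} (hp : MobiusIn e K p) :
    MapsTo (mobius p) (hypBall n 2) (chartInterior e) := fun w hw => by
  rw [chartInterior_eq he]
  refine ⟨extend_image_subset_target hKe (hp.2 hw), ?_⟩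
  simpa [mobius_apply_zero] using mul_pos hp.1 hw.1

theorem tensorComp_eventuallyEq_conformal (hρ : IsDefiningFunction (n := n) ρ)
    (he : e ∈ IsManifold.maximalAtlas (𝓡∂ (n + 1)) ∞ M) {z : Coord n} (hz : z ∈ chartInterior e) :
    conformal (funComp ρ e) (tensorComp (rescale ρ g) e) =ᶠ[𝓝 z] tensorComp g e := by
  filter_upwards [(isOpen_chartInterior he).mem_nhds hz] with y hy
  ext a b
  have h := (hρ.pos hy.2).ne'
  simp only [conformal, tensorComp, rescale, funComp, smul_apply, smul_eq_mul]
  field_simp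

variable [IsManifold (𝓡∂ (n + 1)) ∞ M]

theorem exists_coordinateFields [T2Space M] [CompactSpace M]
    (he : e ∈ IsManifold.maximalAtlas (𝓡∂ (n + 1)) ∞ M) (hK : IsCompact K)
    (hKe : K ⊆ e.source) :
    ∃ (X : Fin (n + 1) → SmoothVecField n M) (O : Set (Coord n)), IsOpen O ∧
      O ⊆ chartInterior e ∧ (∀ p, MobiusIn e K p → MapsTo (mobius p) (hypBall n 2) O) ∧
      ∀ i, ∀ z ∈ O, vecComp (fun x => X i x) e z = fun l => if l = i then 1 else 0 := by
  choose X U hU hKU hX using fun i => exists_coordinateField he hK hKe i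
  refine ⟨X, chartInterior e ∩ (e.extend (𝓡∂ (n + 1))).symm ⁻¹' ⋂ i, U i, ?_, inter_subset_left,
    fun p hp w hw => ⟨hp.mapsTo_chartInterior he hKe hw, ?_⟩, fun i z hz => ?_⟩
  · exact ((e.continuousOn_extend_symm).mono inter_subset_left).isOpen_inter_preimage
      (isOpen_chartInterior he) (isOpen_iInter_of_finite hU)
  · exact mem_iInter.2 fun i => hKU i (symm_mem_of_mem_image hKe (hp.2 hw))
  · exact hX i z hz.1.1 (mem_iInter.1 hz.2 i)

/-- `K` may touch the boundary, so the bound comes from the continuous metric extending `ḡ`, whose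
determinant is positive on the compact image of `K`. -/
theorem exists_le_det_rescale (hg : MemMWeak ρ k α 2 g)
    (he : e ∈ IsManifold.maximalAtlas (𝓡∂ (n + 1)) ∞ M) (hK : IsCompact K)
    (hKe : K ⊆ e.source) :
    ∃ c > 0, ∀ z ∈ chartInterior e, z ∈ e.extend (𝓡∂ (n + 1)) '' K →
      c ≤ (Matrix.of (tensorComp (rescale ρ g) e z)).det := by
  obtain ⟨G, hG⟩ := hg.extends_metric
  have hsub := extend_image_subset_target (K := K) hKe
  have hcont : ContinuousOn (fun z => (Matrix.of (tensorComp (fun x => G.inner x) e z)).det)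
      (e.extend (𝓡∂ (n + 1)) '' K) := by
    simp only [Matrix.det_apply']
    refine continuousOn_finsetSum _ fun σ _ => continuousOn_const.mul
      (continuousOn_finsetProd _ fun a _ => ?_)
    exact (continuousOn_tensorComp he G _ _).mono hsub
  obtain ⟨c, hc, h⟩ := (isCompact_extend_image hK hKe).exists_forall_le' hcont (a := 0)
    fun z hz => (posDef_tensorComp he (hsub hz) (fun x => G.inner x)
      (fun v w => G.symm _ v w) fun v hv => G.pos _ v hv).det_pos
  refine ⟨c, hc, fun z hz hzK => ?_⟩
  have h1 := h z hzK
  have h2 : tensorComp (fun x => G.inner x) e z = tensorComp (rescale ρ g) e z := by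
    ext a b
    simp only [tensorComp, hG _ hz.2]
  rwa [h2] at h1

/-- On `O` the cut-off coordinate fields are the actual ones, so zero, one and two Lie derivatives
of `ḡ` are its partial derivatives `h0`, `h1`, `h2`. In background coordinates `dρ` is constant and
all its partial derivatives vanish. -/
theorem exists_admGeometry_mobius [T2Space M] [CompactSpace M]
    (hρ : IsDefiningFunction (n := n) ρ) (hα : α ≤ 1) (hg : MemMWeak ρ (j + 2) α 2 g)
    (hb : IsBackgroundChart ρ e) (hK : IsCompact K) (hKe : K ⊆ e.source) :
    ∃ O ⊆ chartInterior e, AdmGeometry (fun p : Subtype (MobiusIn e K) => mobius (p : Coord n))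
      (fun p => (p : Coord n) 0) (hypBall n 2) O α j (tensorComp (rescale ρ g) e)
      (funComp ρ e) := by
  have he := hb.1
  have hN := niceDomain_hypBall (n := n)
  obtain ⟨X, O, hO, hOe, hmaps, hX⟩ := exists_coordinateFields he hK hKe
  have S := scaledFamily_mobius hO (P := MobiusIn e K) (fun p hp => hp.1)
    (exists_mobiusIn_le hK hKe) hmaps
  set G := tensorComp (rescale ρ g) e with hGdef
  have hreg : ∀ z ∈ O, RegularAt G z := fun z hz => regularAt_rescale hρ (by omega) hg he (hOe hz)
  have h0 : ∀ a b, UB (hypBall n 2) α (j + 2) fun (p : Subtype (MobiusIn e K)) w =>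
      G (mobius p w) a b := fun a b => (hg.regular [] (by simp)).ub hα hb hK hKe a b
  have h1 : ∀ i a b, UB (hypBall n 2) α (j + 1) fun (p : Subtype (MobiusIn e K)) w =>
      pd i (fun y => G y a b) (mobius p w) := fun i a b =>
    ((hg.regular [X i] (by simp)).ub hα hb hK hKe a b).congr hN.isOpen fun p w hw =>
      lieDeriv_eq_pd hO (hX i) G (hmaps p p.2 hw) a b
  have h2 : ∀ l i a b, UB (hypBall n 2) α j fun (p : Subtype (MobiusIn e K)) w =>
      pd l (pd i (fun y => G y a b)) (mobius p w) := fun l i a b =>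
    ((hg.regular [X l, X i] (by simp)).ub hα hb hK hKe a b).congr hN.isOpen fun p w hw =>
      (lieDeriv_eq_pd hO (hX l) _ (hmaps p p.2 hw) a b).trans
        (pd_eqOn hO (fun y hy => lieDeriv_eq_pd hO (hX i) G hy a b) l (hmaps p p.2 hw))
  have hf : ∀ i, EqOn (fun _ => if i = 0 then 1 else 0) (pd i (funComp ρ e)) O := fun i z hz => by
    rw [pd_eqOn hO (g := fun y => y 0) (fun y hy => hb.funComp_eq (hOe hy).1) i hz, pd_coord]
  obtain ⟨c, hc, hcG⟩ := exists_le_det_rescale hg he hK hKe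
  exact ⟨O, hOe,
    { family := S
      exponent := hα
      regular := hreg
      posDef := fun z hz => posDef_rescale hρ hg he (hOe hz)
      smooth := fun z hz => ((contDiffOn_funComp hρ he).contDiffAt
        ((isOpen_chartInterior he).mem_nhds (hOe hz))).of_le
          (WithTop.coe_le_coe.2 (le_top : (2 : ℕ∞) ≤ ⊤))
      adm := fun a b => ⟨fun z hz => (((hreg z hz).contDiffAt a b).differentiableAt
        (by norm_num)).differentiableWithinAt, (h0 a b).of_succ hN hα,
        fun i => (h1 i a b).of_succ hN hα⟩
      adm_pd := fun i a b => ⟨fun z hz => ((contDiffAt_pd (m := 1)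
        ((hreg z hz).contDiffAt a b) (by norm_num) i).differentiableAt (by norm_num)).differentiableWithinAt, h1 i a b, fun l => h2 l i a b⟩
      adm_df := fun i => (Adm.const _).congr S (hf i)
      adm_ddf := fun i l => (Adm.const 0).congr S fun z hz => by
        rw [← pd_eqOn hO (hf l) i hz, pd_const]
      det_ge := ⟨c, hc, fun p w hw => (hcG _ (hOe (hmaps p p.2 hw)) (p.2.2 hw)).trans
        (le_abs_self _)⟩ }⟩

theorem ub_inv_mul_tensorHBar_sub [T2Space M] [CompactSpace M] (hn : 1 ≤ n)
    (hρ : IsDefiningFunction (n := n) ρ) (hα : α ≤ 1) (hg : MemMWeak ρ (j + 2) α 2 g)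
    (hR : MemHolder ρ j α 2 0 fun e z => scalarCurvature g e z + (n : ℝ) * ((n : ℝ) + 1))
    (hb : IsBackgroundChart ρ e) (hK : IsCompact K) (hKe : K ⊆ e.source) (a b : Fin (n + 1)) :
    UB (hypBall n 2) α (j + 1) fun (p : Subtype (MobiusIn e K)) w => ((p : Coord n) 0)⁻¹ *
      (tensorHBar ρ g e (mobius p w) a b - traceFreeHessBar ρ g e (mobius p w) a b) := by
  obtain ⟨O, hOe, A⟩ := exists_admGeometry_mobius hρ hα hg hb hK hKe
  refine A.ub_inv_mul_tensorH_sub hn (fun z hz => hb.funComp_eq (hOe hz).1)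
    (fun z hz => (hρ.pos (hOe hz).2).ne') (fun p w => mobius_apply_zero _ _)
    ((hR.ubound_scalar hb hK hKe).congr fun p w hw => ?_) center_mem_hypBall a b
  simp only [scalarCurvature]
  rw [scalarCurv_congr (tensorComp_eventuallyEq_conformal hρ hb.1
    (hOe (A.family.mapsTo p hw)))]

/-- `𝓗(ρ)` minus the trace-free Hessian is in `C^{k-1,α}_3`. -/
theorem memHolder_tensorHBar_sub [T2Space M] [CompactSpace M] (hn : 1 ≤ n)
    (hρ : IsDefiningFunction (n := n) ρ) (hα : α ≤ 1) (hg : MemMWeak ρ (j + 2) α 2 g)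
    (hR : MemHolder ρ j α 2 0 fun e z => scalarCurvature g e z + (n : ℝ) * ((n : ℝ) + 1)) :
    MemHolder ρ (j + 1) α 3 2 fun e z => tensorHBar ρ g e z - traceFreeHessBar ρ g e z := by
  refine ⟨fun e hb K hK hKe => ?_, fun e he z s hsub => holderBound_ball hn hρ hα hg he hsub⟩
  have hN := niceDomain_hypBall (n := n)
  -- The weight is `(p₀ w₀)⁻³ p₀² = p₀⁻¹ w₀⁻³`: one factor `p₀⁻¹` is the gain already proved, and
  -- `w₀⁻¹` is bounded on the ball.
  have hw : UB (hypBall n 2) α (j + 1)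
      fun (_ : Subtype (MobiusIn e K)) (w : Coord n) => (w 0)⁻¹ :=
    (UB.coord hN 0 j).inv hN hα (Real.exp_pos (-2)) fun _ w hw =>
      (exp_neg_le_of_mem_hypBall hw).trans (le_abs_self _)
  obtain ⟨C, hC⟩ := exists_holderBound_matField hN.isOpen
    (U := fun (p : Subtype (MobiusIn e K)) w => (((p : Coord n) 0 * w 0) ^ (-3 : ℝ) *
      ((p : Coord n) 0) ^ 2) • (tensorHBar ρ g e (mobius p w) - traceFreeHessBar ρ g e (mobius p w)))
    (j := j + 1) (α := α) fun a b => by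
      refine ((hw.mul hN hα (hw.mul hN hα hw)).mul hN hα
        (ub_inv_mul_tensorHBar_sub hn hρ hα hg hR hb hK hKe a b)).congr hN.isOpen fun p w hw => ?_
      have hp := p.2.1
      have hw0 := hw.1
      simp only [Pi.smul_apply, smul_eq_mul, Pi.sub_apply]
      rw [Real.rpow_neg (by positivity), Real.rpow_ofNat]
      field_simp
  exact ⟨C, fun p hp hm => hC ⟨p, hp, hm⟩⟩

end Mobius

/-! ### Continuous extension to the boundary -/

section Extension

variable {M : Type*} [TopologicalSpace M] {e : Chart n M} {z : Coord n}

/-- Near a boundary point, all Möbius parametrizations have image in a fixed compact set. -/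
theorem exists_halfBall_mobiusIn (hz : z ∈ (e.extend (𝓡∂ (n + 1))).target) (hz0 : z 0 = 0) :
    ∃ K : Set M, IsCompact K ∧ K ⊆ e.source ∧
      ∃ s > 0, ∀ p ∈ Metric.ball z s, 0 < p 0 → MobiusIn e K p := by
  have hmem := target_mem_nhdsWithin hz
  rw [range_modelWithCornersEuclideanHalfSpace] at hmem
  obtain ⟨r, hr, hsub⟩ := (nhdsWithin_hasBasis Metric.nhds_basis_closedBall _).mem_iff.1 hmem
  set B : Set (Coord n) := Metric.closedBall z r ∩ {y | 0 ≤ y 0}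
  have hBc : IsCompact B := (isCompact_closedBall z r).inter_right
    (isClosed_le continuous_const (EuclideanSpace.proj (𝕜 := ℝ) (0 : Fin (n + 1))).continuous)
  obtain ⟨R, hR⟩ := (niceDomain_hypBall (n := n)).isBounded.exists_norm_le
  set R' := |R| + 1 with hR'
  have hR0 : 0 < R' := by positivity
  -- Since `z₀ = 0`, `p₀ ≤ ‖p - z‖`. Points of the ball are at distance at most `R'` from its
  -- center, so the image lies within `(1 + R') ‖p - z‖` of `z`, which explains the radius `r / (1 +
  -- R')`.
  refine ⟨(e.extend (𝓡∂ (n + 1))).symm '' B,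
    hBc.image_of_continuousOn (e.continuousOn_extend_symm.mono hsub), ?_,
    r / (1 + R'), by positivity, fun p hp hp0 => ⟨hp0, fun w hw => ?_⟩⟩
  · rintro _ ⟨y, hy, rfl⟩
    exact symm_mem_source (hsub hy)
  · have hB : mobius p w ∈ B := by
      refine ⟨?_, ?_⟩
      · have h1 : ‖p - z‖ < r / (1 + R') := by simpa [dist_eq_norm] using hp
        have h2 : p 0 ≤ ‖p - z‖ := by
          have := PiLp.norm_apply_le (p - z) (0 : Fin (n + 1))
          simp only [PiLp.sub_apply, hz0, sub_zero] at this
          exact (le_abs_self _).trans this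
        have h3 : ‖w - EuclideanSpace.single 0 1‖ ≤ R' := by
          refine (norm_sub_le _ _).trans ?_
          have := hR w hw
          simp only [PiLp.norm_single, norm_one]
          linarith [le_abs_self R]
        have h4 : mobius p w - z = p 0 • (w - EuclideanSpace.single 0 1) + (p - z) := by
          rw [← mobius_sub]
          abel
        rw [Metric.mem_closedBall, dist_eq_norm, h4]
        calc _ ≤ p 0 * R' + ‖p - z‖ := by
              refine (norm_add_le _ _).trans (add_le_add ?_ le_rfl)
              rw [norm_smul, Real.norm_of_nonneg hp0.le]
              gcongr
          _ ≤ r / (1 + R') * R' + r / (1 + R') := by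
              gcongr
              exact h2.trans h1.le
          _ = r := by field_simp; ring
      · simpa [mobius_apply_zero] using (mul_pos hp0 hw.1).le
    exact ⟨_, mem_image_of_mem _ hB, (e.extend (𝓡∂ (n + 1))).right_inv (hsub hB)⟩

variable [ChartedSpace (EuclideanHalfSpace (n + 1)) M] {ρ : M → ℝ} {j : ℕ} {α : ℝ}
  {g : TwoTensor n M}

theorem mem_closure_chartInterior (he : e ∈ IsManifold.maximalAtlas (𝓡∂ (n + 1)) ∞ M)
    (hz : z ∈ (e.extend (𝓡∂ (n + 1))).target) : z ∈ closure (chartInterior e) := by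
  have hmem := target_mem_nhdsWithin hz
  rw [range_modelWithCornersEuclideanHalfSpace] at hmem
  obtain ⟨r, hr, hsub⟩ := (nhdsWithin_hasBasis Metric.nhds_basis_closedBall _).mem_iff.1 hmem
  have hz0 : 0 ≤ z 0 := by
    rw [target_eq] at hz
    exact hz.2
  rw [Metric.mem_closure_iff]
  intro ε hε
  have hm : 0 < min r (ε / 2) := by positivity
  set q : Coord n := z + EuclideanSpace.single 0 (min r (ε / 2)) with hq
  have hd : dist z q = min r (ε / 2) := by
    rw [hq, dist_self_add_right, PiLp.norm_single, Real.norm_of_nonneg hm.le]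
  have hp : 0 < q 0 := by
    simp only [hq, PiLp.add_apply, PiLp.single_apply, if_true]
    linarith
  refine ⟨q, ?_, ?_⟩
  · rw [chartInterior_eq he]
    refine ⟨hsub ⟨?_, hp.le⟩, hp⟩
    rw [Metric.mem_closedBall, dist_comm, hd]
    exact min_le_left _ _
  · rw [hd]
    exact (min_le_right _ _).trans_lt (by linarith)

theorem halfBall_mem_nhdsWithin (he : e ∈ IsManifold.maximalAtlas (𝓡∂ (n + 1)) ∞ M) {s : ℝ}
    (hs : 0 < s) : Metric.ball z s ∩ {y | 0 < y 0} ∈ 𝓝[chartInterior e] z := by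
  filter_upwards [self_mem_nhdsWithin, nhdsWithin_le_nhds (Metric.ball_mem_nhds z hs)] with y hy hyb
  rw [chartInterior_eq he] at hy
  exact ⟨hyb, hy.2⟩

/-- The interior is dense in the chart target, so limits at the boundary points are all that is
needed for `extendFrom` to be continuous. -/
theorem exists_isExtension {u : Chart n M → MatField n}
    (he : e ∈ IsManifold.maximalAtlas (𝓡∂ (n + 1)) ∞ M)
    (hu : ContinuousOn (u e) (chartInterior e))
    (h : ∀ z ∈ (e.extend (𝓡∂ (n + 1))).target, z 0 = 0 →
      ∃ v, Tendsto (u e) (𝓝[chartInterior e] z) (𝓝 v)) : ∃ v, IsExtension u e v := by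
  refine ⟨extendFrom (chartInterior e) (u e),
    continuousOn_extendFrom (fun z hz => mem_closure_chartInterior he hz) fun z hz => ?_,
    fun z hz => extendFrom_extends hu z hz⟩
  rcases eq_or_ne (z 0) 0 with h0 | h0
  · exact h z hz h0
  · refine ⟨_, hu z ?_⟩
    have hz' := hz
    rw [target_eq] at hz'
    rw [chartInterior_eq he]
    exact ⟨hz, lt_of_le_of_ne hz'.2 h0.symm⟩

variable [IsManifold (𝓡∂ (n + 1)) ∞ M] [T2Space M] [CompactSpace M]

/-- Each point `p` of a half-ball centers its own Möbius parametrization, so the first derivatives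
are bounded there. The half-ball is convex, so the components are Lipschitz, and a Lipschitz
extension to the whole space provides the limit. -/
theorem exists_tendsto_traceFreeHessBar (hρ : IsDefiningFunction (n := n) ρ) (hα : α ≤ 1)
    (hg : MemMWeak ρ (j + 2) α 2 g) (hb : IsBackgroundChart ρ e)
    (hz : z ∈ (e.extend (𝓡∂ (n + 1))).target) (hz0 : z 0 = 0) :
    ∃ v, Tendsto (traceFreeHessBar ρ g e) (𝓝[chartInterior e] z) (𝓝 v) := by
  obtain ⟨K, hK, hKe, s, hs, hp⟩ := exists_halfBall_mobiusIn hz hz0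
  obtain ⟨O, hOe, A⟩ := exists_admGeometry_mobius hρ hα hg hb hK hKe
  set H : Set (Coord n) := Metric.ball z s ∩ {y | 0 < y 0}
  have hP : ∀ p ∈ H, MobiusIn e K p := fun p h => hp p h.1 h.2
  have hN : NiceDomain H :=
    { isOpen := Metric.isOpen_ball.inter
        (isOpen_lt continuous_const (EuclideanSpace.proj (𝕜 := ℝ) (0 : Fin (n + 1))).continuous)
      convex := (convex_ball z s).inter (convex_halfSpace_gt
        (EuclideanSpace.proj (𝕜 := ℝ) (0 : Fin (n + 1))).isLinear 0)
      isBounded := Metric.isBounded_ball.subset inter_subset_left }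
  have hHO : H ⊆ O := fun p h => by
    simpa [mobius_center] using A.family.mapsTo ⟨p, hP p h⟩ center_mem_hypBall
  have key : ∀ a b, ∃ c, Tendsto (fun y => traceFreeHessBar ρ g e y a b)
      (𝓝[chartInterior e] z) (𝓝 c) := fun a b => by
    have hT := A.adm_traceFreeHess a b
    obtain ⟨C, hC0, hC⟩ := exists_lipschitz hN
      (U := fun _ : Unit => fun y => traceFreeHessBar ρ g e y a b)
      (fun _ => hT.diff.mono hHO) fun i => by
        obtain ⟨C, hC⟩ := (hT.ub_pd i).bound
        refine ⟨C, fun _ p h => ?_⟩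
        have h1 := hC ⟨p, hP p h⟩ _ center_mem_hypBall
        simp only [mobius_center] at h1
        exact h1
    have hL : LipschitzOnWith C.toNNReal (fun y => traceFreeHessBar ρ g e y a b) H :=
      LipschitzOnWith.of_dist_le_mul fun x hx y hy => by
        rw [Real.dist_eq, dist_eq_norm, Real.coe_toNNReal _ hC0]
        exact hC () x hx y hy
    obtain ⟨F, hF, hFe⟩ := hL.extend_real
    refine ⟨F z, ((hF.continuous.tendsto z).mono_left nhdsWithin_le_nhds).congr' ?_⟩
    filter_upwards [halfBall_mem_nhdsWithin hb.1 hs] with y hy using (hFe hy).symm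
  choose v hv using key
  exact ⟨v, tendsto_pi_nhds.2 fun a => tendsto_pi_nhds.2 fun b => hv a b⟩

/-- At the center of its Möbius ball the difference is at most `C p₀`, which tends to 0. -/
theorem tendsto_tensorHBar_sub (hn : 1 ≤ n) (hρ : IsDefiningFunction (n := n) ρ) (hα : α ≤ 1)
    (hg : MemMWeak ρ (j + 2) α 2 g)
    (hR : MemHolder ρ j α 2 0 fun e z => scalarCurvature g e z + (n : ℝ) * ((n : ℝ) + 1))
    (hb : IsBackgroundChart ρ e) (hz : z ∈ (e.extend (𝓡∂ (n + 1))).target) (hz0 : z 0 = 0) :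
    Tendsto (fun y => tensorHBar ρ g e y - traceFreeHessBar ρ g e y) (𝓝[chartInterior e] z)
      (𝓝 0) := by
  obtain ⟨K, hK, hKe, s, hs, hp⟩ := exists_halfBall_mobiusIn hz hz0
  refine tendsto_pi_nhds.2 fun a => tendsto_pi_nhds.2 fun b => ?_
  obtain ⟨C, hC⟩ := (ub_inv_mul_tensorHBar_sub hn hρ hα hg hR hb hK hKe a b).bound
  have h0 : Tendsto (fun y : Coord n => C * y 0) (𝓝[chartInterior e] z) (𝓝 0) := by
    have h := ((EuclideanSpace.proj (𝕜 := ℝ) (0 : Fin (n + 1))).continuous.const_mul C).tendsto z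
    rw [show (EuclideanSpace.proj (𝕜 := ℝ) (0 : Fin (n + 1))) z = 0 from hz0, mul_zero] at h
    exact h.mono_left nhdsWithin_le_nhds
  refine squeeze_zero_norm' ?_ h0
  filter_upwards [halfBall_mem_nhdsWithin hb.1 hs] with p h
  have h1 := hC ⟨p, hp p h.1 h.2⟩ _ center_mem_hypBall
  have hp0 : 0 < p 0 := h.2
  simp only [mobius_center, abs_mul, abs_inv, abs_of_pos hp0] at h1
  rwa [inv_mul_le_iff₀ hp0, mul_comm] at h1

theorem extendsContinuously_traceFreeHessBar (hρ : IsDefiningFunction (n := n) ρ) (hα : α ≤ 1)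
    (hg : MemMWeak ρ (j + 2) α 2 g) : ExtendsContinuously ρ (traceFreeHessBar ρ g) :=
  ⟨fun _ he => continuousOn_traceFreeHessBar hρ hα hg he, fun _ hb =>
    exists_isExtension hb.1 (continuousOn_traceFreeHessBar hρ hα hg hb.1) fun _ hz hz0 =>
      exists_tendsto_traceFreeHessBar hρ hα hg hb hz hz0⟩

theorem extendsContinuously_tensorHBar (hn : 1 ≤ n) (hρ : IsDefiningFunction (n := n) ρ)
    (hα : α ≤ 1) (hg : MemMWeak ρ (j + 2) α 2 g)
    (hR : MemHolder ρ j α 2 0 fun e z => scalarCurvature g e z + (n : ℝ) * ((n : ℝ) + 1)) :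
    ExtendsContinuously ρ (tensorHBar ρ g) := by
  refine ⟨fun _ he => continuousOn_tensorHBar hn hρ hα hg he, fun e hb =>
    exists_isExtension hb.1 (continuousOn_tensorHBar hn hρ hα hg hb.1) fun z hz hz0 => ?_⟩
  obtain ⟨v, hv⟩ := exists_tendsto_traceFreeHessBar hρ hα hg hb hz hz0
  refine ⟨0 + v, ((tendsto_tensorHBar_sub hn hρ hα hg hR hb hz hz0).add hv).congr fun y => ?_⟩
  exact sub_add_cancel _ _

/-- Limits from the interior are unique at boundary points, and the difference of the two tensors
has limit 0. -/
theorem agreeOnBoundary (hn : 1 ≤ n) (hρ : IsDefiningFunction (n := n) ρ)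
    (hα : α ≤ 1) (hg : MemMWeak ρ (j + 2) α 2 g)
    (hR : MemHolder ρ j α 2 0 fun e z => scalarCurvature g e z + (n : ℝ) * ((n : ℝ) + 1)) :
    AgreeOnBoundary ρ (tensorHBar ρ g) (traceFreeHessBar ρ g) := by
  refine ⟨extendsContinuously_tensorHBar hn hρ hα hg hR,
    extendsContinuously_traceFreeHessBar hρ hα hg, fun e hb v₁ v₂ h₁ h₂ z hz => ?_⟩
  have hz0 : z 0 = 0 := by
    rw [← hb.funComp_eq hz.1]
    exact (hρ.eq_zero_iff _).2 hz.2
  have : (𝓝[chartInterior e] z).NeBot :=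
    mem_closure_iff_nhdsWithin_neBot.1 (mem_closure_chartInterior hb.1 hz.1)
  have hsub : chartInterior e ⊆ (e.extend (𝓡∂ (n + 1))).target := inter_subset_left
  have h := ((h₁.1 z hz.1).mono hsub).tendsto.sub ((h₂.1 z hz.1).mono hsub).tendsto
  refine sub_eq_zero.1 (tendsto_nhds_unique h
    ((tendsto_tensorHBar_sub hn hρ hα hg hR hb hz.1 hz0).congr' ?_))
  filter_upwards [self_mem_nhdsWithin] with y hy
  rw [h₁.2 hy, h₂.2 hy]

end Extension

end AH

end

theorem mainTheorem10 {n : ℕ} (hn : 1 ≤ n)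
    {M : Type*} [TopologicalSpace M] [T2Space M] [CompactSpace M]
    [ChartedSpace (EuclideanHalfSpace (n + 1)) M] [IsManifold (𝓡∂ (n + 1)) ∞ M]
    (ρ : M → ℝ) (hρ : AH.IsDefiningFunction (n := n) ρ)
    (k : ℕ) (hk : 2 ≤ k) (α : ℝ) (hα₀ : 0 ≤ α) (hα₁ : α < 1)
    (g : AH.TwoTensor n M) (hg : AH.MemMWeak ρ k α 2 g)
    (hR : AH.MemHolder ρ (k - 2) α 2 0
      (fun e z => AH.scalarCurvature g e z + (n : ℝ) * ((n : ℝ) + 1))) :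
    AH.ExtendsContinuously ρ (AH.tensorHBar ρ g) ∧
    AH.MemHolder ρ (k - 1) α 3 2
      (fun e z => AH.tensorHBar ρ g e z - AH.traceFreeHessBar ρ g e z) ∧
    AH.AgreeOnBoundary ρ (AH.tensorHBar ρ g) (AH.traceFreeHessBar ρ g) := by
  -- With `k = j + 2` the truncated subtractions `k - 1` and `k - 2` become `j + 1` and `j`.
  obtain ⟨j, rfl⟩ := Nat.exists_eq_add_of_le' hk
  exact ⟨AH.extendsContinuously_tensorHBar hn hρ hα₁.le hg hR,
    AH.memHolder_tensorHBar_sub hn hρ hα₁.le hg hR, AH.agreeOnBoundary hn hρ hα₁.le hg hR⟩
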